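/- Let $M$ be a smooth ($C^\infty$), Hausdorff, paracompact manifold of dimension $d$. A local vector field on $M$ is a smooth vector field $X$ on an open subset of $M$; $\mathrm{Fl}^X_t$ denotes its maximal local flow. Let $D$ be a set of local vector fields that is everywhere defined, i.e. the domains of its elements cover $M$. For $n\ge 1$, $\xi=(X_1,\dots,X_n)\in D^n$ and $T=(t_1,\dots,t_n)\in\mathbb R^n$ put $\xi_T:=\mathrm{Fl}^{X_1}_{t_1}\circ\dots\circ\mathrm{Fl}^{X_n}_{t_n}$, on its maximal domain. The $D$-orbit of $m\in M$ is the set of all $\xi_T(m)$; it is trivial if it equals $\{m\}$. Its natural topology is the finest topology for which all the maps $T\mapsto \xi_T(m)$, on their domains in $\mathbb R^n$, are continuous. A distribution $\Delta$ assigns to each $m\in M$ a linear subspace $\Delta(m)\subseteq T_mM$. Let $\Delta_D(m)$ be the span of all $X(m)$ with $X\in D$ defined at $m$. A distribution is smooth if it is of the form $\Delta_{D'}$ for some everywhere defined $D'$, and $D$-invariant if $T_m\xi_T(\Delta(m))\subseteq\Delta(\xi_T(m))$ for all $\xi\in D^n$, $n\ge1$, $T\in\mathbb R^n$ and all $m$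 in the domain of $\xi_T$. Let $P_D$ be the smallest $D$-invariant distribution containing $\Delta_D$. The set of all local vector fields $X$ with $X(m)\in\Delta(m)$ for all $m$ in the domain of $X$ is denoted by $D_\Delta$, and $\Delta$ is called involutive if $D_\Delta$ is closed under the Lie bracket (taken on the intersection of the domains). An immersive submanifold of $M$ is a subset $S$ with a topology and a $C^\infty$-structure making it a Hausdorff, paracompact manifold of dimension at least $1$ such that the inclusion $S\hookrightarrow M$ is an immersion. It is an integral manifold of $\Delta$ if $T_sS=\Delta(s)$ for all $s\in S$. A maximal integral manifold of $\Delta$ is a connected, non-empty integral manifold $S$ such that every connected integral manifold of $\Delta$ that intersects $S$ is an open submanifold of $S$. A smooth distribution $\Delta$ has the maximal integral manifold property if through each $m\in M$ with $P_{D_\Delta}(m)\neq 0$ there passes a maximal integral manifold of $\Delta$. Then: (i) Every non-trivial $D$-orbit $S$, equipped with its natural topology, admits a unique $C^\infty$-structure for which it is an immersive submanifold of $M$. Its dimension is $\dim P_D(x)$, for every $x\in S$. (ii) With this topology and $C^\infty$-structure, each non-trivial $D$-orbit is a maximal integral manifold of $P_D$; conversely, every maximal integral manifold of $P_D$ is a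 non-trivial $D$-orbit, with this topology and $C^\infty$-structure. (iii) $P_D$ is smooth and has the maximal integral manifold property. (iv) $P_D$ is involutive. -/

import Mathlib

open Set TopologicalSpace
open scoped Manifold ContDiff Topology

noncomputable section

namespace Sussmann

universe u

/-! Throughout, `M` is a `C^∞` manifold of dimension `d`, without boundary. -/

/-- A local vector field on `M`: a smooth vector field on an open (possibly empty) subset `domain`.
The values of `toFun` outside `domain` are never used. -/
structure LocalVectorField (d : ℕ) (M : Type u) [TopologicalSpace M]
    [ChartedSpace (EuclideanSpace ℝ (Fin d)) M] [IsManifold (𝓡 d) ∞ M] where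
  domain : Opens M
  toFun : (x : M) → TangentSpace (𝓡 d) x
  smooth : ContMDiffOn (𝓡 d) (𝓡 d).tangent ∞
    (fun x ↦ (⟨x, toFun x⟩ : TangentBundle (𝓡 d) M)) domain

/-- A distribution (of possibly non-constant rank) assigns to each point a linear subspace of the
tangent space. Containment of distributions is the pointwise order. -/
abbrev Distribution (d : ℕ) (M : Type u) [TopologicalSpace M]
    [ChartedSpace (EuclideanSpace ℝ (Fin d)) M] : Type u :=
  (x : M) → Submodule ℝ (TangentSpace (𝓡 d) x)

section Basic

variable {d : ℕ} {M : Type u} [TopologicalSpace M] [ChartedSpace (EuclideanSpace ℝ (Fin d)) M]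
  [IsManifold (𝓡 d) ∞ M]

/-- The Lie bracket of two local vector fields, on the intersection of their domains. -/
def LocalVectorField.bracket (X Y : LocalVectorField d M) : LocalVectorField d M where
  domain := X.domain ⊓ Y.domain
  toFun := VectorField.mlieBracket (𝓡 d) X.toFun Y.toFun
  smooth := by
    intro x hx
    have hX : ContMDiffAt (𝓡 d) (𝓡 d).tangent ((⊤ : ℕ∞) : WithTop ℕ∞)
        (fun x ↦ (⟨x, X.toFun x⟩ : TangentBundle (𝓡 d) M)) x :=
      (X.smooth x hx.1).contMDiffAt (X.domain.isOpen.mem_nhds hx.1)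
    have hY : ContMDiffAt (𝓡 d) (𝓡 d).tangent ((⊤ : ℕ∞) : WithTop ℕ∞)
        (fun x ↦ (⟨x, Y.toFun x⟩ : TangentBundle (𝓡 d) M)) x :=
      (Y.smooth x hx.2).contMDiffAt (Y.domain.isOpen.mem_nhds hx.2)
    have : IsManifold (𝓡 d) (((⊤ : ℕ∞) : WithTop ℕ∞) + 1) M := by
      have h : (((⊤ : ℕ∞) : WithTop ℕ∞) + 1) = ∞ := rfl
      rw [h]; infer_instance
    have : IsManifold (𝓡 d) (minSmoothness ℝ 2) M := by
      rw [minSmoothness_of_isRCLikeNormedField]; infer_instance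
    exact (hX.mlieBracket_vectorField (m := ⊤) hY (by simp)).contMDiffWithinAt

/-- `γ` restricts to an integral curve of `X`, inside the domain of `X`, on an open interval that
contains `0` and `t`, and it starts at `m` at time `0`. -/
def IsFlowCurve (X : LocalVectorField d M) (t : ℝ) (m : M) (γ : ℝ → M) : Prop :=
  γ 0 = m ∧ ∃ a b : ℝ, 0 ∈ Ioo a b ∧ t ∈ Ioo a b ∧
    IsMIntegralCurveOn (I := 𝓡 d) γ X.toFun (Ioo a b) ∧ ∀ s ∈ Ioo a b, γ s ∈ X.domain

/-- The maximal domain of the flow of `X`, a subset of `ℝ × M`. -/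
def flowDomain (X : LocalVectorField d M) : Set (ℝ × M) :=
  {p | ∃ γ : ℝ → M, IsFlowCurve X p.1 p.2 γ}

open Classical in
/-- The flow `Fl^X_t (m)` of `X`; only its values for `(t, m) ∈ flowDomain X` are meaningful. -/
def flow (X : LocalVectorField d M) (t : ℝ) (m : M) : M :=
  if h : ∃ γ : ℝ → M, IsFlowCurve X t m γ then h.choose t else m

/-- `ξ_T (m) = Fl^{X_1}_{t_1} (Fl^{X_2}_{t_2} (⋯ Fl^{X_n}_{t_n} (m) ⋯))` for `ξ = (X_1, …, X_n)` and
`T = (t_1, …, t_n)`; only its values for `(T, m) ∈ multiflowDomain ξ` are meaningful. -/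
def multiflow : {n : ℕ} → (Fin n → LocalVectorField d M) → (Fin n → ℝ) → M → M
  | 0, _, _, m => m
  | _ + 1, ξ, T, m => flow (ξ 0) (T 0) (multiflow (Fin.tail ξ) (Fin.tail T) m)

/-- The maximal domain of `(T, m) ↦ ξ_T (m)`, a subset of `ℝⁿ × M`. -/
def multiflowDomain : {n : ℕ} → (Fin n → LocalVectorField d M) → Set ((Fin n → ℝ) × M)
  | 0, _ => univ
  | _ + 1, ξ => {p | (Fin.tail p.1, p.2) ∈ multiflowDomain (Fin.tail ξ) ∧
      (p.1 0, multiflow (Fin.tail ξ) (Fin.tail p.1) p.2) ∈ flowDomain (ξ 0)}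

/-- The domain of `T ↦ ξ_T (m)`. -/
def timeDomain {n : ℕ} (ξ : Fin n → LocalVectorField d M) (m : M) : Set (Fin n → ℝ) :=
  {T | (T, m) ∈ multiflowDomain ξ}

/-- The domains of the members of `D` cover `M`. -/
def EverywhereDefined (D : Set (LocalVectorField d M)) : Prop :=
  ∀ m : M, ∃ X ∈ D, m ∈ X.domain

/-- The non-empty finite tuples of members of `D`. -/
def Word (D : Set (LocalVectorField d M)) : Type u :=
  (n : {n : ℕ // 1 ≤ n}) × (Fin n → D)

/-- The length of a tuple. -/
def Word.length {D : Set (LocalVectorField d M)} (w : Word D) : ℕ := w.1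

/-- The vector fields in a tuple. -/
def Word.fields {D : Set (LocalVectorField d M)} (w : Word D) :
    Fin w.length → LocalVectorField d M := fun i ↦ (w.2 i : LocalVectorField d M)

/-- The `D`-orbit of `m`: all points `ξ_T (m)`. -/
def orbit (D : Set (LocalVectorField d M)) (m : M) : Set M :=
  {x | ∃ (w : Word D) (T : Fin w.length → ℝ), T ∈ timeDomain w.fields m ∧
    multiflow w.fields T m = x}

/-- The set `S`, without any topology (in particular without the trace topology of `M`). -/
def Pts (S : Set M) : Type u := {x : M // x ∈ S}

/-- The map `T ↦ ξ_T (m)`, on its domain and with values in the orbit of `m`. -/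
def orbitMap (D : Set (LocalVectorField d M)) (m : M) (w : Word D)
    (T : timeDomain w.fields m) : Pts (orbit D m) :=
  ⟨multiflow w.fields T m, w, T, T.2, rfl⟩

/-- The natural topology on a set `S` which is the orbit of `m`: the finest topology for which all
the maps `T ↦ ξ_T (m)` are continuous. -/
@[reducible]
def orbitTopology (D : Set (LocalVectorField d M)) (m : M) (S : Set M) (h : S = orbit D m) :
    TopologicalSpace (Pts S) :=
  ⨆ w : Word D, TopologicalSpace.coinduced
    (fun T : timeDomain w.fields m ↦ (⟨(orbitMap D m w T).1, h ▸ (orbitMap D m w T).2⟩ : Pts S))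
    inferInstance

/-- The distribution `Δ_D` spanned by `D`. -/
def spanned (D : Set (LocalVectorField d M)) : Distribution d M := fun m ↦
  Submodule.span ℝ {v | ∃ X ∈ D, m ∈ X.domain ∧ X.toFun m = v}

/-- A distribution is smooth if it is spanned by an everywhere defined set of local vector
fields. -/
def Distribution.IsSmooth (Δ : Distribution d M) : Prop :=
  ∃ D : Set (LocalVectorField d M), EverywhereDefined D ∧ Δ = spanned D

/-- The set `D_Δ` of all local vector fields that belong to `Δ`. -/
def Distribution.fields (Δ : Distribution d M) : Set (LocalVectorField d M) :=
  {X | ∀ m ∈ X.domain, X.toFun m ∈ Δ m}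

/-- A distribution is `D`-invariant if it is mapped into itself by the tangent maps of all the
local diffeomorphisms `ξ_T` generated by `D`. -/
def Distribution.IsInvariant (D : Set (LocalVectorField d M)) (Δ : Distribution d M) : Prop :=
  ∀ (w : Word D) (T : Fin w.length → ℝ) (m : M), T ∈ timeDomain w.fields m →
    ∀ v ∈ Δ m, mfderiv (𝓡 d) (𝓡 d) (multiflow w.fields T) m v ∈ Δ (multiflow w.fields T m)

/-- The distribution `P_D`: the smallest `D`-invariant distribution that contains `Δ_D`, that is,
the intersection of all of these. -/
def orbitDistribution (D : Set (LocalVectorField d M)) : Distribution d M :=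
  sInf {Δ | Δ.IsInvariant D ∧ spanned D ≤ Δ}

theorem orbitDistribution_isLeast (D : Set (LocalVectorField d M)) :
    IsLeast {Δ : Distribution d M | Δ.IsInvariant D ∧ spanned D ≤ Δ} (orbitDistribution D) := by
  refine ⟨⟨fun w T m hT v hv ↦ ?_, le_sInf fun Δ hΔ ↦ hΔ.2⟩, fun Δ hΔ ↦ sInf_le hΔ⟩
  simp only [orbitDistribution, sInf_apply, Submodule.mem_iInf] at hv ⊢
  exact fun Δ ↦ Δ.2.1 w T m hT v (hv Δ)

/-- A set of local vector fields is involutive if it is closed under the Lie bracket. -/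
def IsInvolutiveSet (D : Set (LocalVectorField d M)) : Prop :=
  ∀ X ∈ D, ∀ Y ∈ D, X.bracket Y ∈ D

/-- A distribution is involutive if the set of local vector fields belonging to it is. -/
def Distribution.IsInvolutive (Δ : Distribution d M) : Prop :=
  IsInvolutiveSet Δ.fields

/-- The data making the subset `S` of `M` an immersive submanifold of `M`: a topology and a
`C^∞`-structure of some dimension `dim ≥ 1`, Hausdorff and paracompact, for which the inclusion
into `M` is an immersion. -/
structure ImmersiveStructure (d : ℕ) {M : Type u} [TopologicalSpace M]
    [ChartedSpace (EuclideanSpace ℝ (Fin d)) M] [IsManifold (𝓡 d) ∞ M] (S : Set M) where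
  dim : ℕ
  one_le_dim : 1 ≤ dim
  [topology : TopologicalSpace (Pts S)]
  [charts : ChartedSpace (EuclideanSpace ℝ (Fin dim)) (Pts S)]
  [isManifold : IsManifold (𝓡 dim) ∞ (Pts S)]
  [t2 : T2Space (Pts S)]
  [paracompact : ParacompactSpace (Pts S)]
  contMDiff_incl : ContMDiff (𝓡 dim) (𝓡 d) ∞ (fun x : Pts S ↦ x.1)
  injective_mfderiv : ∀ x : Pts S,
    Function.Injective (mfderiv (𝓡 dim) (𝓡 d) (fun x : Pts S ↦ x.1) x)

namespace ImmersiveStructure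

variable {R S : Set M}

/-- The set `S` with the topology and the smooth structure given by `N`. -/
def Carrier (_N : ImmersiveStructure d S) : Type u := Pts S

instance (N : ImmersiveStructure d S) : TopologicalSpace N.Carrier := N.topology

instance (N : ImmersiveStructure d S) :
    ChartedSpace (EuclideanSpace ℝ (Fin N.dim)) N.Carrier := N.charts

instance (N : ImmersiveStructure d S) : IsManifold (𝓡 N.dim) ∞ N.Carrier := N.isManifold

/-- The inclusion map of the submanifold into `M`. -/
def incl (N : ImmersiveStructure d S) : N.Carrier → M := Subtype.val

/-- The inclusion map between two submanifolds of `M`, one of which contains the other as a set. -/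
def inclusion (N : ImmersiveStructure d R) (N' : ImmersiveStructure d S) (h : R ⊆ S) :
    N.Carrier → N'.Carrier := Set.inclusion h

/-- Two submanifold structures on the same set coincide, that is, the identity is a diffeomorphism
between them. -/
def Same (N N' : ImmersiveStructure d S) : Prop :=
  ContMDiff (𝓡 N.dim) (𝓡 N'.dim) ∞ (N.inclusion N' Subset.rfl) ∧
    ContMDiff (𝓡 N'.dim) (𝓡 N.dim) ∞ (N'.inclusion N Subset.rfl)

/-- `N` is an open submanifold of `N'`: the inclusion is defined, and it is a (necessarily
injective) local diffeomorphism, that is, a diffeomorphism onto an open subset. -/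
def IsOpenSubmanifold (N : ImmersiveStructure d R) (N' : ImmersiveStructure d S) : Prop :=
  ∃ h : R ⊆ S, IsLocalDiffeomorph (𝓡 N.dim) (𝓡 N'.dim) ∞ (N.inclusion N' h)

/-- `N` is an integral manifold of `Δ`: its tangent spaces, viewed as subspaces of the tangent
spaces of `M`, are the spaces of `Δ`. -/
def IsIntegral (N : ImmersiveStructure d S) (Δ : Distribution d M) : Prop :=
  ∀ x : N.Carrier, (mfderiv (𝓡 N.dim) (𝓡 d) N.incl x).range = Δ (N.incl x)

/-- `N` is a maximal integral manifold of `Δ`: it is a connected integral manifold, and each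
connected integral manifold that intersects it is an open submanifold of it. -/
def IsMaximalIntegral (N : ImmersiveStructure d S) (Δ : Distribution d M) : Prop :=
  ConnectedSpace N.Carrier ∧ N.IsIntegral Δ ∧
    ∀ (R : Set M) (N' : ImmersiveStructure d R), ConnectedSpace N'.Carrier → N'.IsIntegral Δ →
      (R ∩ S).Nonempty → N'.IsOpenSubmanifold N

end ImmersiveStructure

/-- Through each point `m` at which the smallest `D_Δ`-invariant distribution containing `Δ_{D_Δ}`
does not vanish there passes a maximal integral manifold of `Δ`. -/
def Distribution.HasMaximalIntegralManifolds (Δ : Distribution d M) : Prop :=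
  ∀ m : M, orbitDistribution Δ.fields m ≠ ⊥ →
    ∃ (S : Set M) (N : ImmersiveStructure d S), m ∈ S ∧ N.IsMaximalIntegral Δ

end Basic

end Sussmann

end

open Set TopologicalSpace
open scoped Manifold ContDiff Topology

noncomputable section

set_option linter.unusedSectionVars false

namespace Sussmann

universe u

/-! ### Superposition operators on spaces of continuous maps -/

section Nemytskii

variable {K : Type*} [TopologicalSpace K] [CompactSpace K]
  {E F : Type u} [NormedAddCommGroup E] [NormedSpace ℝ E] [NormedAddCommGroup F] [NormedSpace ℝ F]

/-! The space `P_D(x)` is spanned by the vectors obtained from values of members of `D` by applying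
tangent maps of flows of `D` (`orbitDistribution_eq_span_generator`). Flows are invertible and both
directions preserve `P_D`, so its rank is constant along an orbit. Each generator is the velocity of
a motion inside the orbit: flow back to where the field of `D` lives, follow that field for a short
time, and flow forward again. Performing such motions for a basis of generators, one after the
other, gives a map from a `k`-dimensional space into the orbit that is immersive at `0`
(`Generator.exists_family`, `exists_orbit_plaque`). All derivatives of such maps lie in `P_D`
(`mfderiv_multiflow_time_mem`), so constancy of rank turns the map into a parametrized integral
manifold, a plaque.

The other pillar is uniqueness of plaques (`exists_factorization` and its manifold versions): a map
tangent to a smooth distribution whose rank along the map is the dimension of a plaque, and which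
meets the plaque, factors smoothly through it near the meeting point. Involutivity is not needed. In
coordinates that straighten the plaque, the component `w` of the map transverse to it satisfies
`‖dw‖ ≤ C ‖w‖` and vanishes at one point, hence vanishes nearby by Grönwall.

Factorization makes plaques open in the natural topology, so that they serve as charts of the orbit.
It also makes an integral manifold contained in another one an open submanifold, and determines the
topology of an integral manifold from its underlying set. A connected integral manifold cannot leave
an orbit, because the orbits cut it into disjoint open pieces; this gives maximality.
Paracompactness is a Poincaré–Volterra argument (`paracompactSpace_of_injective`). The smooth
structure is unique because a continuous map into an immersive submanifold is smooth as soon as it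
is smooth into `M`. Finally `P_D` is involutive because brackets of fields tangent to a plaque are
tangent to it, and trivial orbits are exactly those where `P_D` vanishes
(`orbitDistribution_eq_bot_iff`).

The flows themselves are shown to be smooth by applying the inverse function theorem to the integral
equation on a space of continuous curves. -/

/-- Pointwise evaluation of a continuous family of linear maps, as a bounded bilinear map. -/
def pointwiseApply (K : Type*) [TopologicalSpace K] [CompactSpace K] (E F : Type*)
    [NormedAddCommGroup E] [NormedSpace ℝ E] [NormedAddCommGroup F] [NormedSpace ℝ F] :
    C(K, E →L[ℝ] F) →L[ℝ] C(K, E) →L[ℝ] C(K, F) :=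
  LinearMap.mkContinuous₂
    (LinearMap.mk₂ ℝ (fun (A : C(K, E →L[ℝ] F)) (h : C(K, E)) ↦
        (⟨fun t ↦ A t (h t), A.continuous.clm_apply h.continuous⟩ : C(K, F)))
      (fun _ _ _ ↦ by ext; simp) (fun _ _ _ ↦ by ext; simp)
      (fun _ _ _ ↦ by ext; simp) (fun _ _ _ ↦ by ext; simp)) 1 (by
    intro A h
    rw [one_mul, ContinuousMap.norm_le _ (by positivity)]
    intro t
    exact (A t).le_of_opNorm_le_of_le (A.norm_coe_le_norm t) (h.norm_coe_le_norm t))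

/-- Post-composition with `f'` is continuous for the sup norm. Hence `f'` varies by at most `c`
along all the segments from `γ t` to `γ' t` at once, and the mean value inequality gives an error
bound uniform in `t`. -/
theorem hasFDerivAt_postcomp (f : C(E, F)) (f' : C(E, E →L[ℝ] F))
    (hf : ∀ x, HasFDerivAt f (f' x) x) (γ : C(K, E)) :
    HasFDerivAt (fun γ : C(K, E) ↦ f.comp γ) (pointwiseApply K E F (f'.comp γ)) γ := by
  rw [hasFDerivAt_iff_isLittleO, Asymptotics.isLittleO_iff]
  intro c hc
  have hcont : ContinuousAt (fun γ : C(K, E) ↦ f'.comp γ) γ :=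
    (ContinuousMap.continuous_postcomp f').continuousAt
  obtain ⟨δ, hδ, hball⟩ := (Metric.continuousAt_iff (f := fun γ : C(K, E) ↦ f'.comp γ) (a := γ)).1 hcont c hc
  filter_upwards [Metric.ball_mem_nhds γ hδ] with γ' hγ'
  rw [ContinuousMap.norm_le _ (by positivity)]
  intro t
  have key := Convex.norm_image_sub_le_of_norm_hasFDerivWithin_le' (f := f) (f' := fun x ↦ f' x)
    (φ := f' (γ t)) (C := c) (s := segment ℝ (γ t) (γ' t)) (x := γ t) (y := γ' t)
    (fun x _ ↦ (hf x).hasFDerivWithinAt) ?_ (convex_segment _ _) (left_mem_segment _ _ _)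
    (right_mem_segment _ _ _)
  · refine key.trans ?_
    gcongr
    exact (γ' - γ).norm_coe_le_norm t
  · intro x hx
    rw [segment_eq_image'] at hx
    obtain ⟨s, hs, rfl⟩ := hx
    have hmem : dist (γ + s • (γ' - γ)) γ < δ := by
      rw [dist_eq_norm, add_sub_cancel_left, norm_smul, Real.norm_of_nonneg hs.1]
      calc s * ‖γ' - γ‖ ≤ 1 * ‖γ' - γ‖ := by gcongr; exact hs.2
        _ < δ := by rw [one_mul, ← dist_eq_norm]; exact hγ'
    have := (ContinuousMap.dist_apply_le_dist (f := f'.comp (γ + s • (γ' - γ))) (g := f'.comp γ)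
      t).trans (hball hmem).le
    rw [dist_eq_norm] at this
    exact this

/-- The superposition operator of a `C^n` map between normed spaces is `C^n` on spaces of
continuous maps. -/
theorem contDiff_postcomp (n : ℕ) {E F : Type u} [NormedAddCommGroup E] [NormedSpace ℝ E]
    [NormedAddCommGroup F] [NormedSpace ℝ F] (f : C(E, F)) (hf : ContDiff ℝ n f) :
    ContDiff ℝ n (fun γ : C(K, E) ↦ f.comp γ) := by
  induction n generalizing F with
  | zero =>
    rw [Nat.cast_zero, contDiff_zero]
    exact ContinuousMap.continuous_postcomp f
  | succ n ih =>
    have h := contDiff_succ_iff_fderiv (𝕜 := ℝ) (n := n) (f := f)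
    rw [show ((n + 1 : ℕ) : WithTop ℕ∞) = n + 1 by push_cast; rfl] at hf ⊢
    obtain ⟨hd, -, hf'⟩ := contDiff_succ_iff_fderiv.1 hf
    -- The derivative is governed by another superposition operator, with values in `E →L[ℝ] F`. The
    -- induction therefore generalizes the target, and `E` and `F` share a universe so that the new
    -- target is allowed.
    let f' : C(E, E →L[ℝ] F) := ⟨fderiv ℝ f, hf'.continuous⟩
    have hder := fun γ : C(K, E) ↦
      hasFDerivAt_postcomp f f' (fun x ↦ (hd x).hasFDerivAt) γ
    rw [contDiff_succ_iff_hasFDerivAt]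
    refine ⟨_, ?_, hder⟩
    exact (pointwiseApply K E F).contDiff.comp (ih f' hf')

end Nemytskii

/-! ### Inverse function theorem on a full neighbourhood -/

section Inverse

variable {E F : Type*} [NormedAddCommGroup E] [NormedSpace ℝ E] [NormedAddCommGroup F]
  [NormedSpace ℝ F] [CompleteSpace E]

/-- The inverse function theorem, with a smooth inverse on a whole neighbourhood. -/
theorem exists_openPartialHomeomorph_contDiffOn {f : E → F} {U : Set E} (hU : IsOpen U)
    (hf : ContDiffOn ℝ ∞ f U) {a : E} (ha : a ∈ U) (f' : E ≃L[ℝ] F)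
    (hf' : HasFDerivAt f (f' : E →L[ℝ] F) a) :
    ∃ e : OpenPartialHomeomorph E F, a ∈ e.source ∧ e.source ⊆ U ∧ (e : E → F) = f ∧
      ContDiffOn ℝ ∞ e.symm e.target := by
  have hfa : ContDiffAt ℝ ∞ f a := hf.contDiffAt (hU.mem_nhds ha)
  have hn : (∞ : WithTop ℕ∞) ≠ 0 := by simp
  let e₀ := hfa.toOpenPartialHomeomorph f hf' hn
  have he₀ : (e₀ : E → F) = f := hfa.toOpenPartialHomeomorph_coe hf' hn
  have hcont : ContinuousOn (fderiv ℝ f) U := hf.continuousOn_fderiv_of_isOpen hU (by simp)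
  have hopen : IsOpen (U ∩ fderiv ℝ f ⁻¹' range ((↑) : (E ≃L[ℝ] F) → E →L[ℝ] F)) :=
    hcont.isOpen_inter_preimage hU ContinuousLinearEquiv.isOpen
  -- Invertible operators form an open set; restricting to points with invertible derivative makes
  -- the inverse smooth on the whole target and not only at the image of `a`.
  set V := U ∩ fderiv ℝ f ⁻¹' range ((↑) : (E ≃L[ℝ] F) → E →L[ℝ] F) with hV
  refine ⟨e₀.restrOpen V hopen, ⟨hfa.mem_toOpenPartialHomeomorph_source hf' hn, ha, f', ?_⟩,
    fun x hx ↦ hx.2.1, he₀, ?_⟩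
  · exact hf'.fderiv.symm
  · intro y hy
    have hy' := (e₀.restrOpen V hopen).map_target hy
    rw [OpenPartialHomeomorph.restrOpen_source] at hy'
    obtain ⟨A, hA⟩ := hy'.2.2
    refine (OpenPartialHomeomorph.contDiffAt_symm (e₀.restrOpen V hopen) (f₀' := A) hy ?_ ?_)
      |>.contDiffWithinAt
    · rw [hA]
      exact ((hf.contDiffAt (hU.mem_nhds hy'.2.1)).differentiableAt hn).hasFDerivAt
    · exact hf.contDiffAt (hU.mem_nhds hy'.2.1)

end Inverse

/-! ### Smooth dependence of solutions of differential equations -/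

section SmoothFlow

variable {E : Type u} [NormedAddCommGroup E] [NormedSpace ℝ E] [CompleteSpace E]

/-- The operator mapping a continuous curve on `[0, 1]` to its primitive. -/
def primitive (E : Type*) [NormedAddCommGroup E] [NormedSpace ℝ E] [CompleteSpace E] :
    C(Icc (0 : ℝ) 1, E) →L[ℝ] C(Icc (0 : ℝ) 1, E) :=
  LinearMap.mkContinuous
    { toFun := fun γ ↦ ⟨fun t ↦ ∫ s in (0 : ℝ)..t, γ (projIcc 0 1 zero_le_one s),
        (intervalIntegral.continuous_primitive (fun _ _ ↦
          (γ.continuous.comp continuous_projIcc).intervalIntegrable _ _) 0).comp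
          continuous_subtype_val⟩
      map_add' := fun γ γ' ↦ by
        ext t
        exact intervalIntegral.integral_add
          ((γ.continuous.comp continuous_projIcc).intervalIntegrable _ _)
          ((γ'.continuous.comp continuous_projIcc).intervalIntegrable _ _)
      map_smul' := fun c γ ↦ by
        ext t
        exact intervalIntegral.integral_smul _ _ } 1 (by
    intro γ
    rw [one_mul, ContinuousMap.norm_le _ (norm_nonneg _)]
    intro t
    refine (intervalIntegral.norm_integral_le_of_norm_le_const (C := ‖γ‖)
      (fun s _ ↦ γ.norm_coe_le_norm _)).trans ?_
    rw [sub_zero, abs_of_nonneg t.2.1]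
    exact mul_le_of_le_one_right (norm_nonneg _) t.2.2)

/-- The flow of a smooth vector field on a Banach space is locally smooth. -/
theorem exists_contDiffOn_flow {f : E → E} (hf : ContDiff ℝ ∞ f) (x₀ : E) :
    ∃ δ > 0, ∃ α : E × ℝ → E, ContDiffOn ℝ ∞ α (Metric.ball x₀ δ ×ˢ Ioo (-δ) δ) ∧
      ∀ x ∈ Metric.ball x₀ δ, α (x, 0) = x ∧
        ∀ t ∈ Ioo (-δ) δ, HasDerivAt (fun s ↦ α (x, s)) (f (α (x, t))) t := by
  let fc : C(E, E) := ⟨f, hf.continuous⟩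
  let Cu := C(Icc (0 : ℝ) 1, E)
  have hN : ContDiff ℝ ∞ (fun γ : Cu ↦ fc.comp γ) :=
    contDiff_infty.2 fun n ↦ contDiff_postcomp n fc (contDiff_infty.1 hf n)
  let cst : E →L[ℝ] Cu := ContinuousLinearMap.const ℝ (Icc (0 : ℝ) 1)
  -- With time rescaled, `s ↦ α (x, l * s)` on `[0, 1]` solves `γ = x + l ∫ f(γ)`, that is, `γ = G
  -- ((x, l), γ)`. The final time `l` has become a parameter like `x`.
  let G : (E × ℝ) × Cu → Cu := fun p ↦ cst p.1.1 + p.1.2 • primitive E (fc.comp p.2)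
  have hG : ContDiff ℝ ∞ G :=
    (cst.contDiff.comp (contDiff_fst.comp contDiff_fst)).add
      ((contDiff_snd.comp contDiff_fst).smul ((primitive E).contDiff.comp (hN.comp contDiff_snd)))
  let H : (E × ℝ) × Cu → (E × ℝ) × Cu := fun p ↦ (p.1, p.2 - G p)
  have hH : ContDiff ℝ ∞ H := contDiff_fst.prodMk (contDiff_snd.sub hG)
  let L : E × ℝ →L[ℝ] Cu := cst.comp (ContinuousLinearMap.fst ℝ E ℝ) +
    (ContinuousLinearMap.snd ℝ E ℝ).smulRight (primitive E (fc.comp (cst x₀)))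
  have hG' : HasFDerivAt G (L.comp (ContinuousLinearMap.fst ℝ (E × ℝ) Cu)) ((x₀, 0), cst x₀) := by
    have h1 : HasFDerivAt (fun p : (E × ℝ) × Cu ↦ cst p.1.1)
        (cst.comp ((ContinuousLinearMap.fst ℝ E ℝ).comp (ContinuousLinearMap.fst ℝ (E × ℝ) Cu)))
        ((x₀, 0), cst x₀) :=
      (cst.comp ((ContinuousLinearMap.fst ℝ E ℝ).comp
        (ContinuousLinearMap.fst ℝ (E × ℝ) Cu))).hasFDerivAt
    have h2 : HasFDerivAt (fun p : (E × ℝ) × Cu ↦ p.1.2)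
        ((ContinuousLinearMap.snd ℝ E ℝ).comp (ContinuousLinearMap.fst ℝ (E × ℝ) Cu))
        ((x₀, 0), cst x₀) :=
      ((ContinuousLinearMap.snd ℝ E ℝ).comp
        (ContinuousLinearMap.fst ℝ (E × ℝ) Cu)).hasFDerivAt
    have h3 : DifferentiableAt ℝ (fun p : (E × ℝ) × Cu ↦ primitive E (fc.comp p.2))
        ((x₀, 0), cst x₀) :=
      (((primitive E).contDiff.comp (hN.comp contDiff_snd)).differentiable (by simp)) _
    refine (h1.add (h2.smul h3.hasFDerivAt)).congr_fderiv ?_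
    ext p <;> simp [L]
  -- At `l = 0` the factor `l` kills the dependence of `G` on `γ` to first order, so the derivative
  -- of `H` is a shear and hence invertible.
  let T : ((E × ℝ) × Cu) ≃L[ℝ] ((E × ℝ) × Cu) :=
    (ContinuousLinearEquiv.refl ℝ (E × ℝ)).skewProd (ContinuousLinearEquiv.refl ℝ Cu) (-L)
  have hH' : HasFDerivAt H (T : ((E × ℝ) × Cu) →L[ℝ] ((E × ℝ) × Cu)) ((x₀, 0), cst x₀) := by
    refine (hasFDerivAt_fst.prodMk (hasFDerivAt_snd.sub hG')).congr_fderiv ?_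
    refine ContinuousLinearMap.ext fun p ↦ ?_
    refine Prod.ext rfl ?_
    simp [T, sub_eq_add_neg]
  obtain ⟨e, he, -, heH, hes⟩ := exists_openPartialHomeomorph_contDiffOn isOpen_univ
    hH.contDiffOn (mem_univ _) T hH'
  obtain ⟨ρ, hρ, hρs⟩ := Metric.mem_nhds_iff.1 (e.open_source.mem_nhds he)
  -- Picard–Lindelöf supplies solutions that are jointly continuous; their smoothness will come from
  -- `e.symm`.
  obtain ⟨ε, hε, a, r, _, _, hr, hpl⟩ :=
    IsPicardLindelof.of_contDiffAt_one ((hf.of_le (by simp)).contDiffAt (x := x₀))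
  obtain ⟨α, hα, hαc⟩ :=
    (hpl 0).exists_forall_mem_closedBall_eq_hasDerivWithinAt_continuousOn
  simp only [zero_sub, zero_add] at hα hαc
  have hr' : (0 : ℝ) < r := hr
  have hα0 : ContinuousAt α (x₀, 0) := hαc.continuousAt (prod_mem_nhds
    (Metric.closedBall_mem_nhds _ hr') (Icc_mem_nhds (by linarith) hε))
  have hαx₀ : α (x₀, 0) = x₀ := (hα x₀ (Metric.mem_closedBall_self hr'.le)).1
  obtain ⟨δ', hδ', hδα⟩ := Metric.continuousAt_iff.1 hα0 (ρ / 2) (by positivity)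
  rw [hαx₀] at hδα
  set δ := min (min δ' ρ) (min (r : ℝ) ε) with hδ
  have hδpos : 0 < δ := by positivity
  have h1 : δ ≤ δ' := (min_le_left _ _).trans (min_le_left _ _)
  have h2 : δ ≤ ρ := (min_le_left _ _).trans (min_le_right _ _)
  have h3 : δ ≤ r := (min_le_right _ _).trans (min_le_left _ _)
  have h4 : δ ≤ ε := (min_le_right _ _).trans (min_le_right _ _)
  have hball : ∀ x ∈ Metric.ball x₀ δ, x ∈ Metric.closedBall x₀ (r : ℝ) := fun x hx ↦
    (Metric.ball_subset_closedBall (Metric.ball_subset_ball h3 hx))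
  have hder : ∀ x ∈ Metric.ball x₀ δ, ∀ t ∈ Ioo (-δ) δ,
      HasDerivAt (fun s ↦ α (x, s)) (f (α (x, t))) t := fun x hx t ht ↦
    ((hα x (hball x hx)).2 t ⟨by linarith [ht.1], by linarith [ht.2]⟩).hasDerivAt
      (Icc_mem_nhds (by linarith [ht.1]) (by linarith [ht.2]))
  have hmul : ∀ l ∈ Ioo (-δ) δ, ∀ s ∈ Icc (0 : ℝ) 1, l * s ∈ Ioo (-δ) δ := by
    intro l hl s hs
    rw [mem_Ioo, ← abs_lt, abs_mul, abs_of_nonneg hs.1]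
    exact (mul_le_of_le_one_right (abs_nonneg _) hs.2).trans_lt (abs_lt.2 hl)
  -- By continuity the rescaled solution is uniformly close to the constant curve `x₀`, so it lies
  -- in the region where `H` is injective. It must then be the curve produced by `e.symm`, and
  -- evaluation at `1` recovers `α (x, l)`.
  have hsol : ∀ x ∈ Metric.ball x₀ δ, ∀ l ∈ Ioo (-δ) δ, ((x, l), (0 : Cu)) ∈ e.target ∧
      α (x, l) = (e.symm ((x, l), 0)).2 ⟨1, zero_le_one, le_rfl⟩ := by
    intro x hx l hl
    let γ : Cu := ⟨fun t ↦ α (x, l * t), by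
      rw [continuous_iff_continuousAt]
      intro t
      exact ContinuousAt.comp (f := fun t : Icc (0 : ℝ) 1 ↦ l * (t : ℝ)) (g := fun s ↦ α (x, s))
        (hder x hx _ (hmul l hl t t.2)).continuousAt (by fun_prop)⟩
    have hγ : H ((x, l), γ) = ((x, l), 0) := by
      refine Prod.ext rfl ?_
      change γ - (cst x + l • primitive E (fc.comp γ)) = 0
      rw [sub_eq_zero]
      refine ContinuousMap.ext fun t ↦ ?_
      change α (x, l * t) = x + l • ∫ s in (0 : ℝ)..t, f (γ (projIcc 0 1 zero_le_one s))
      have hint : ∫ s in (0 : ℝ)..t, l • f (γ (projIcc 0 1 zero_le_one s)) =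
          α (x, l * t) - α (x, l * 0) := by
        refine intervalIntegral.integral_eq_sub_of_hasDerivAt
          (f := fun s ↦ α (x, l * s)) ?_ ?_
        · intro s hs
          rw [uIcc_of_le t.2.1] at hs
          have hs' : s ∈ Icc (0 : ℝ) 1 := ⟨hs.1, hs.2.trans t.2.2⟩
          rw [projIcc_of_mem _ hs']
          have := (hder x hx (l * s) (hmul l hl s hs')).scomp s
            ((hasDerivAt_id s).const_mul l)
          rw [mul_one] at this
          exact this
        · exact (continuous_const.smul (hf.continuous.comp
            (γ.continuous.comp continuous_projIcc))).intervalIntegrable _ _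
      rw [intervalIntegral.integral_smul, mul_zero, (hα x (hball x hx)).1] at hint
      rw [hint]; abel
    have hmem : ((x, l), γ) ∈ e.source := by
      refine hρs ?_
      rw [Metric.mem_ball, Prod.dist_eq, Prod.dist_eq, max_lt_iff, max_lt_iff]
      refine ⟨⟨(Metric.mem_ball.1 hx).trans_le h2, ?_⟩, ?_⟩
      · rw [Real.dist_eq, sub_zero]
        exact (abs_lt.2 hl).trans_le h2
      · refine lt_of_le_of_lt ?_ (half_lt_self hρ)
        rw [ContinuousMap.dist_le (by positivity)]
        intro t
        refine (hδα ?_).le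
        rw [Prod.dist_eq, max_lt_iff]
        refine ⟨(Metric.mem_ball.1 hx).trans_le h1, ?_⟩
        rw [Real.dist_eq, sub_zero]
        exact (abs_lt.2 (hmul l hl t t.2)).trans_le h1
    have he' : e ((x, l), γ) = ((x, l), 0) := by rw [heH]; exact hγ
    refine ⟨he' ▸ e.map_source hmem, ?_⟩
    rw [← he', e.left_inv hmem]
    change α (x, l) = α (x, l * 1)
    rw [mul_one]
  refine ⟨δ, hδpos, α, ?_, fun x hx ↦ ⟨(hα x (hball x hx)).1, hder x hx⟩⟩
  have hcomp : ContDiffOn ℝ ∞ (fun p : E × ℝ ↦ (e.symm (p, 0)).2 ⟨1, zero_le_one, le_rfl⟩)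
      (Metric.ball x₀ δ ×ˢ Ioo (-δ) δ) := by
    refine (ContinuousMap.evalCLM ℝ (⟨1, zero_le_one, le_rfl⟩ : Icc (0 : ℝ) 1)).contDiff
      |>.comp_contDiffOn (contDiff_snd.comp_contDiffOn (hes.comp
        (contDiff_id.prodMk contDiff_const).contDiffOn ?_))
    exact fun p hp ↦ (hsol p.1 hp.1 p.2 hp.2).1
  exact hcomp.congr fun p hp ↦ (hsol p.1 hp.1 p.2 hp.2).2

end SmoothFlow

/-! ### Immersions and uniqueness of integral manifolds in a vector space -/

section Straightening

variable {E F G : Type*} [NormedAddCommGroup E] [NormedSpace ℝ E] [FiniteDimensional ℝ E]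
  [NormedAddCommGroup F] [NormedSpace ℝ F] [FiniteDimensional ℝ F]
  [NormedAddCommGroup G] [NormedSpace ℝ G]

/-- An immersion extends locally to a diffeomorphism defined on the product with a complement. -/
theorem exists_straightening {φ : F → E} {U : Set F} (hU : IsOpen U) (hφ : ContDiffOn ℝ ∞ φ U)
    {u₀ : F} (hu₀ : u₀ ∈ U) (hinj : Function.Injective (fderiv ℝ φ u₀)) :
    ∃ (C : Submodule ℝ E) (e : OpenPartialHomeomorph (F × C) E), (u₀, 0) ∈ e.source ∧
      (∀ p ∈ e.source, p.1 ∈ U) ∧ (∀ p, e p = φ p.1 + p.2) ∧ ContDiffOn ℝ ∞ e.symm e.target := by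
  obtain ⟨C, hC⟩ := Submodule.exists_isCompl (LinearMap.range (fderiv ℝ φ u₀).toLinearMap)
  have hdiff : DifferentiableAt ℝ φ u₀ :=
    (hφ.contDiffAt (hU.mem_nhds hu₀)).differentiableAt (by simp)
  let A : F × C →L[ℝ] E := (fderiv ℝ φ u₀).coprod C.subtypeL
  have hA : HasFDerivAt (fun p : F × C ↦ φ p.1 + (p.2 : E)) A (u₀, 0) := by
    have h1 : HasFDerivAt (fun p : F × C ↦ φ p.1)
        ((fderiv ℝ φ u₀).comp (ContinuousLinearMap.fst ℝ F C)) (u₀, 0) :=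
      HasFDerivAt.comp (f := Prod.fst) (g := φ) (u₀, (0 : C)) hdiff.hasFDerivAt hasFDerivAt_fst
    have h2 : HasFDerivAt (fun p : F × C ↦ (p.2 : E))
        (C.subtypeL.comp (ContinuousLinearMap.snd ℝ F C)) (u₀, 0) :=
      (C.subtypeL.comp (ContinuousLinearMap.snd ℝ F C)).hasFDerivAt
    refine (h1.add h2).congr_fderiv ?_
    ext p <;> simp [A]
  have hAinj : Function.Injective A := by
    rw [injective_iff_map_eq_zero]
    rintro ⟨u, z⟩ h
    have h' : fderiv ℝ φ u₀ u + (z : E) = 0 := h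
    have hz : (z : E) ∈ LinearMap.range (fderiv ℝ φ u₀).toLinearMap :=
      ⟨-u, by simpa using (eq_neg_of_add_eq_zero_right h').symm⟩
    have hz0 : (z : E) = 0 := by
      have := hC.disjoint.le_bot ⟨hz, z.2⟩
      simpa using this
    rw [hz0, add_zero] at h'
    exact Prod.ext (hinj (by simpa using h')) (Subtype.ext hz0)
  have hAsurj : Function.Surjective A := by
    intro x
    have hx : x ∈ LinearMap.range (fderiv ℝ φ u₀).toLinearMap ⊔ C := by
      rw [hC.sup_eq_top]; trivial
    obtain ⟨_, ⟨u, rfl⟩, z, hz, rfl⟩ := Submodule.mem_sup.1 hx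
    exact ⟨(u, ⟨z, hz⟩), rfl⟩
  let A' : (F × C) ≃L[ℝ] E :=
    (LinearEquiv.ofBijective (A : F × C →ₗ[ℝ] E) ⟨hAinj, hAsurj⟩).toContinuousLinearEquiv
  have hA' : HasFDerivAt (fun p : F × C ↦ φ p.1 + (p.2 : E)) (A' : F × C →L[ℝ] E) (u₀, 0) :=
    hA.congr_fderiv (by ext p <;> rfl)
  have hsm : ContDiffOn ℝ ∞ (fun p : F × C ↦ φ p.1 + (p.2 : E)) (U ×ˢ univ) :=
    (hφ.comp contDiff_fst.contDiffOn fun p hp ↦ hp.1).add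
      (C.subtypeL.contDiff.comp contDiff_snd).contDiffOn
  have : CompleteSpace (F × C) := FiniteDimensional.complete ℝ (F × C)
  obtain ⟨e, he1, he2, he3, he4⟩ := exists_openPartialHomeomorph_contDiffOn
    (hU.prod isOpen_univ) hsm (a := (u₀, 0)) ⟨hu₀, trivial⟩ A' hA'
  exact ⟨C, e, he1, fun p hp ↦ (he2 hp).1, fun p ↦ congrFun he3 p, he4⟩

/-- An immersion has a smooth local left inverse. -/
theorem exists_local_left_inverse {φ : F → E} {U : Set F} (hU : IsOpen U)
    (hφ : ContDiffOn ℝ ∞ φ U) {u₀ : F} (hu₀ : u₀ ∈ U)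
    (hinj : Function.Injective (fderiv ℝ φ u₀)) :
    ∃ r : E → F, ContDiffAt ℝ ∞ r (φ u₀) ∧ ∀ᶠ u in 𝓝 u₀, r (φ u) = u := by
  obtain ⟨C, e, he, -, heφ, hes⟩ := exists_straightening hU hφ hu₀ hinj
  have hφ' : ∀ u, e (u, 0) = φ u := fun u ↦ by simp [heφ]
  refine ⟨fun x ↦ (e.symm x).1, ?_, ?_⟩
  · refine contDiff_fst.contDiffAt.comp _ (hes.contDiffAt (e.open_target.mem_nhds ?_))
    rw [← hφ']
    exact e.map_source he
  · have : ∀ᶠ u in 𝓝 u₀, ((u, 0) : F × C) ∈ e.source :=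
      (Continuous.prodMk_left (0 : C)).continuousAt (e.open_source.mem_nhds he)
    filter_upwards [this] with u hu
    rw [← hφ', e.left_inv hu]

/-- In finite dimensions injectivity amounts to a lower bound `‖ζ‖ ≤ κ ‖A x₀ ζ‖`. A perturbation of
norm at most `1 / (2 * κ)` absorbs only half of it, which leaves the constant `2 * κ`. -/
theorem eventually_norm_le_of_injective {E F : Type*} [NormedAddCommGroup E] [NormedSpace ℝ E]
    [NormedAddCommGroup F] [NormedSpace ℝ F] [FiniteDimensional ℝ F] {Z : Type*}
    [TopologicalSpace Z] {A : Z → F →L[ℝ] E} {x₀ : Z} (hA : ContinuousAt A x₀)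
    (hinj : Function.Injective (A x₀)) :
    ∃ κ > 0, ∀ᶠ x in 𝓝 x₀, ∀ ζ, ‖ζ‖ ≤ κ * ‖A x ζ‖ := by
  obtain ⟨κ, hκ, hanti⟩ := (A x₀).toLinearMap.exists_antilipschitzWith
    (LinearMap.ker_eq_bot.2 hinj)
  have hκ' : (0 : ℝ) < κ := hκ
  refine ⟨2 * κ, by positivity, ?_⟩
  filter_upwards [Metric.continuousAt_iff'.1 hA (1 / (2 * κ)) (by positivity)] with x hx ζ
  have h1 : ‖ζ‖ ≤ κ * ‖A x₀ ζ‖ := by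
    simpa [dist_zero_right] using hanti.le_mul_dist ζ 0
  have h2 : ‖A x₀ ζ‖ ≤ ‖A x ζ‖ + 1 / (2 * κ) * ‖ζ‖ := by
    have : A x₀ ζ = A x ζ - (A x - A x₀) ζ := by simp
    rw [this]
    refine (norm_sub_le _ _).trans ?_
    gcongr
    refine (A x - A x₀).le_of_opNorm_le ?_ ζ
    rw [← dist_eq_norm]
    exact hx.le
  have h3 : κ * (1 / (2 * κ) * ‖ζ‖) = ‖ζ‖ / 2 := by field_simp
  have h4 := h1.trans (mul_le_mul_of_nonneg_left h2 hκ'.le)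
  rw [mul_add, h3] at h4
  linarith

/-- A map vanishing at the centre of a ball, whose derivative is bounded by a multiple of the map,
vanishes on the ball. -/
theorem eq_zero_of_norm_fderiv_le {C : Type*} [NormedAddCommGroup C] [NormedSpace ℝ C]
    {w : G → C} {v₀ : G} {ρ K : ℝ} (hw : DifferentiableOn ℝ w (Metric.ball v₀ ρ))
    (h0 : w v₀ = 0) (hK : ∀ v ∈ Metric.ball v₀ ρ, ∀ ξ, ‖fderiv ℝ w v ξ‖ ≤ K * ‖w v‖ * ‖ξ‖) :
    ∀ v ∈ Metric.ball v₀ ρ, w v = 0 := by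
  intro v hv
  have hρ : 0 < ρ := (dist_nonneg.trans_lt (Metric.mem_ball.1 hv))
  have hseg : ∀ t ∈ Icc (0 : ℝ) 1, v₀ + t • (v - v₀) ∈ Metric.ball v₀ ρ := fun t ht ↦
    (convex_ball v₀ ρ).add_smul_sub_mem (Metric.mem_ball_self hρ) hv ht
  have hder : ∀ t ∈ Icc (0 : ℝ) 1, HasDerivAt (fun t : ℝ ↦ w (v₀ + t • (v - v₀)))
      (fderiv ℝ w (v₀ + t • (v - v₀)) (v - v₀)) t := by
    intro t ht
    have h1 : HasDerivAt (fun t : ℝ ↦ v₀ + t • (v - v₀)) (v - v₀) t := by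
      simpa using ((hasDerivAt_id t).smul_const (v - v₀)).const_add v₀
    exact ((hw.differentiableAt (Metric.isOpen_ball.mem_nhds (hseg t ht))).hasFDerivAt).comp_hasDerivAt
      t h1
  -- Grönwall's inequality along the segment from `v₀` to `v`.
  have := eq_zero_of_abs_deriv_le_mul_abs_self_of_eq_zero_right (K := K * ‖v - v₀‖)
    (f := fun t : ℝ ↦ w (v₀ + t • (v - v₀))) (a := 0) (b := 1)
    (fun t ht ↦ (hder t ht).continuousAt.continuousWithinAt)
    (fun t ht ↦ (hder t (Ico_subset_Icc_self ht)).hasDerivWithinAt) (by simpa using h0)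
    (fun t ht ↦ by
      refine (hK _ (hseg t (Ico_subset_Icc_self ht)) (v - v₀)).trans (le_of_eq ?_)
      ring) 1 (right_mem_Icc.2 zero_le_one)
  simpa using this

/-- Let `φ` be an immersion tangent to the family of subspaces `range (Y x)`. A map which is tangent
to this family and meets the image of `φ` factors locally through `φ`. -/
theorem exists_factorization {φ : F → E} {U : Set F} (hU : IsOpen U)
    (hφ : ContDiffOn ℝ ∞ φ U) {u₀ : F} (hu₀ : u₀ ∈ U)
    (hinj : Function.Injective (fderiv ℝ φ u₀)) {Y : E → F →L[ℝ] E}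
    (hY : ContDiffAt ℝ 1 Y (φ u₀))
    (hφY : ∀ᶠ u in 𝓝 u₀, LinearMap.range (Y (φ u)).toLinearMap =
      LinearMap.range (fderiv ℝ φ u).toLinearMap)
    {g : G → E} {V : Set G} (hV : IsOpen V) (hg : ContDiffOn ℝ ∞ g V) {v₀ : G} (hv₀ : v₀ ∈ V)
    (hgv : g v₀ = φ u₀)
    (hgY : ∀ᶠ v in 𝓝 v₀, LinearMap.range (fderiv ℝ g v).toLinearMap ≤
      LinearMap.range (Y (g v)).toLinearMap) :
    ∃ (h : G → F) (W : Set G), IsOpen W ∧ v₀ ∈ W ∧ W ⊆ V ∧ ContDiffOn ℝ ∞ h W ∧ h v₀ = u₀ ∧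
      ∀ v ∈ W, h v ∈ U ∧ g v = φ (h v) := by
  obtain ⟨C, e, he, heU, heφ, hes⟩ := exists_straightening hU hφ hu₀ hinj
  have hφ' : ∀ u, e (u, 0) = φ u := fun u ↦ by simp [heφ]
  have htar : φ u₀ ∈ e.target := hφ' u₀ ▸ e.map_source he
  have hΨu₀ : e.symm (φ u₀) = (u₀, 0) := by rw [← hφ', e.left_inv he]
  have hΨd : ∀ x ∈ e.target, HasFDerivAt e.symm (fderiv ℝ e.symm x) x := fun x hx ↦
    ((hes.contDiffAt (e.open_target.mem_nhds hx)).differentiableAt (by simp)).hasFDerivAt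
  have hφd : ∀ u ∈ U, HasFDerivAt φ (fderiv ℝ φ u) u := fun u hu ↦
    ((hφ.contDiffAt (hU.mem_nhds hu)).differentiableAt (by simp)).hasFDerivAt
  -- `b` is the part of the frame `Y` transverse to the slices `C = const` of the straightened
  -- coordinates. It vanishes along the image of `φ`, where `Y` and `φ` have the same tangent
  -- spaces, and it is Lipschitz because it is `C^1`.
  let b : E → F →L[ℝ] C := fun x ↦
    ((ContinuousLinearMap.snd ℝ F C).comp (fderiv ℝ e.symm x)).comp (Y x)
  have hb : ContDiffAt ℝ 1 b (φ u₀) := by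
    refine ContDiffAt.clm_comp (contDiffAt_const.clm_comp ?_) hY
    exact ((hes.contDiffAt (e.open_target.mem_nhds htar)).fderiv_right (m := ∞) le_rfl).of_le
      (by simp)
  have hc : ContDiffAt ℝ 1 (fun p ↦ b (e p)) (u₀, 0) := by
    refine ContDiffAt.comp (g := b) (u₀, (0 : C)) (by rw [hφ']; exact hb) ?_
    have : (e : F × C → E) = fun p ↦ φ p.1 + p.2 := funext heφ
    rw [this]
    refine ContDiffAt.add ?_ (C.subtypeL.contDiff.comp contDiff_snd).contDiffAt
    exact ContDiffAt.comp (g := φ) (u₀, (0 : C))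
      ((hφ.contDiffAt (hU.mem_nhds hu₀)).of_le (by simp)) contDiff_fst.contDiffAt
  obtain ⟨K, s, hs, hlip⟩ := hc.exists_lipschitzOnWith
  have hb0 : ∀ᶠ u in 𝓝 u₀, b (φ u) = 0 := by
    have hsrc : ∀ᶠ u in 𝓝 u₀, ((u, 0) : F × C) ∈ e.source :=
      (Continuous.prodMk_left (0 : C)).continuousAt (e.open_source.mem_nhds he)
    filter_upwards [hφY, hsrc.eventually_nhds, hU.mem_nhds hu₀] with u hu hus huU
    refine ContinuousLinearMap.ext fun η ↦ ?_
    obtain ⟨ζ, hζ⟩ : Y (φ u) η ∈ LinearMap.range (fderiv ℝ φ u).toLinearMap :=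
      hu ▸ LinearMap.mem_range_self _ η
    have hζ' : fderiv ℝ φ u ζ = Y (φ u) η := hζ
    have hcomp : HasFDerivAt (fun u ↦ e.symm (φ u))
        ((fderiv ℝ e.symm (φ u)).comp (fderiv ℝ φ u)) u :=
      (hΨd _ (hφ' u ▸ e.map_source hus.self_of_nhds)).comp u (hφd u huU)
    have heq : (fun u ↦ e.symm (φ u)) =ᶠ[𝓝 u] fun u ↦ (u, (0 : C)) := by
      filter_upwards [hus] with u' hu'
      rw [← hφ', e.left_inv hu']
    have hid : HasFDerivAt (fun u : F ↦ (u, (0 : C)))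
        ((ContinuousLinearMap.id ℝ F).prod (0 : F →L[ℝ] C)) u :=
      (hasFDerivAt_id u).prodMk (hasFDerivAt_const _ _)
    have := DFunLike.congr_fun ((hcomp.congr_of_eventuallyEq heq.symm).unique hid) ζ
    change (fderiv ℝ e.symm (φ u) (Y (φ u) η)).2 = 0
    rw [← hζ']
    exact congrArg Prod.snd this
  -- The range of `Y (φ u₀)` has the dimension of `F`, so rank–nullity leaves no kernel.
  have hYinj : Function.Injective (Y (φ u₀)) := by
    rw [← ContinuousLinearMap.coe_coe, ← LinearMap.ker_eq_bot, ← Submodule.finrank_eq_zero]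
    have h1 := LinearMap.finrank_range_add_finrank_ker (Y (φ u₀)).toLinearMap
    rw [hφY.self_of_nhds, LinearMap.finrank_range_of_inj hinj] at h1
    omega
  obtain ⟨κ, hκ, hκY⟩ := eventually_norm_le_of_injective hY.continuousAt hYinj
  have hgc : ContinuousAt g v₀ := hg.continuousOn.continuousAt (hV.mem_nhds hv₀)
  have hgd : ∀ v ∈ V, HasFDerivAt g (fderiv ℝ g v) v := fun v hv ↦
    ((hg.contDiffAt (hV.mem_nhds hv)).differentiableAt (by simp)).hasFDerivAt
  have hgd' : ContinuousAt (fderiv ℝ g) v₀ :=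
    (hg.continuousOn_fderiv_of_isOpen hV (by simp)).continuousAt (hV.mem_nhds hv₀)
  have hΨc : ContinuousAt (fun v ↦ e.symm (g v)) v₀ :=
    ContinuousAt.comp (g := e.symm) (by rw [hgv]; exact e.symm.continuousAt htar) hgc
  have hΨg : e.symm (g v₀) = (u₀, 0) := by rw [hgv, hΨu₀]
  have hΨt : Filter.Tendsto (fun v ↦ e.symm (g v)) (𝓝 v₀) (𝓝 (u₀, 0)) := hΨg ▸ hΨc.tendsto
  have hΨt' : Filter.Tendsto (fun v ↦ (e.symm (g v)).1) (𝓝 v₀) (𝓝 u₀) :=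
    (continuous_fst.tendsto (u₀, (0 : C))).comp hΨt
  have hev1 : ∀ᶠ v in 𝓝 v₀, e.symm (g v) ∈ s := hΨt.eventually hs
  have hev2 : ∀ᶠ v in 𝓝 v₀, ((e.symm (g v)).1, (0 : C)) ∈ s :=
    (((Continuous.prodMk_left (0 : C)).tendsto u₀).comp hΨt').eventually hs
  have hev3 : ∀ᶠ v in 𝓝 v₀, b (φ (e.symm (g v)).1) = 0 := hΨt'.eventually hb0
  have hev4 : ∀ᶠ v in 𝓝 v₀, ∀ ζ, ‖ζ‖ ≤ κ * ‖Y (g v) ζ‖ := hgc.eventually (by rw [hgv]; exact hκY)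
  have hev5 : ∀ᶠ v in 𝓝 v₀, ‖fderiv ℝ g v‖ ≤ ‖fderiv ℝ g v₀‖ + 1 :=
    hgd'.norm.eventually_le_const (by linarith)
  have hev6 : ∀ᶠ v in 𝓝 v₀, g v ∈ e.target :=
    hgc.eventually (by rw [hgv]; exact e.open_target.mem_nhds htar)
  obtain ⟨ρ, hρ, hball⟩ := Metric.eventually_nhds_iff_ball.1
    (hev1.and <| hev2.and <| hev3.and <| hev4.and <| hev5.and <| hev6.and <| hgY.and <|
      hV.mem_nhds hv₀)
  have hder : ∀ v ∈ Metric.ball v₀ ρ, HasFDerivAt (fun v ↦ (e.symm (g v)).2)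
      (((ContinuousLinearMap.snd ℝ F C).comp (fderiv ℝ e.symm (g v))).comp (fderiv ℝ g v)) v := by
    intro v hv
    obtain ⟨-, -, -, -, -, h6, -, h8⟩ := hball v hv
    exact ((hΨd _ h6).comp v (hgd v h8)).snd
  -- Writing `dg(ξ) = Y ζ`, the transverse component `w` of `g` has `dw(ξ) = b ζ`. The lower bound
  -- for `Y` controls `ζ` by `ξ`, and the Lipschitz bound controls `b` by `w`, so Grönwall forces `w
  -- = 0`.
  have hzero := eq_zero_of_norm_fderiv_le (w := fun v ↦ (e.symm (g v)).2) (v₀ := v₀) (ρ := ρ)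
    (K := K * (κ * (‖fderiv ℝ g v₀‖ + 1)))
    (fun v hv ↦ (hder v hv).differentiableAt.differentiableWithinAt) (by rw [hΨg]) (by
      intro v hv ξ
      obtain ⟨h1, h2, h3, h4, h5, h6, h7, -⟩ := hball v hv
      rw [(hder v hv).fderiv]
      obtain ⟨ζ, hζ⟩ := h7 (LinearMap.mem_range_self _ ξ)
      have hζ' : Y (g v) ζ = fderiv ℝ g v ξ := hζ
      have hval : (((ContinuousLinearMap.snd ℝ F C).comp (fderiv ℝ e.symm (g v))).comp
          (fderiv ℝ g v)) ξ = b (g v) ζ := by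
        change (fderiv ℝ e.symm (g v) (fderiv ℝ g v ξ)).2 = (fderiv ℝ e.symm (g v) (Y (g v) ζ)).2
        rw [hζ']
      rw [hval]
      -- Compare with the projection of the point to the slice `C = 0`, where `b` vanishes; the
      -- distance of the two points is exactly the transverse component.
      have hbn : ‖b (g v)‖ ≤ K * ‖(e.symm (g v)).2‖ := by
        have := hlip.norm_sub_le h1 h2
        rw [hφ', h3, sub_zero, e.right_inv h6, Prod.norm_def, Prod.fst_sub, Prod.snd_sub, sub_self,
          sub_zero, norm_zero, max_eq_right (norm_nonneg _)] at this
        exact this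
      have hζn : ‖ζ‖ ≤ κ * ((‖fderiv ℝ g v₀‖ + 1) * ‖ξ‖) := by
        refine (h4 ζ).trans ?_
        rw [hζ']
        gcongr
        exact (fderiv ℝ g v).le_of_opNorm_le h5 ξ
      calc ‖b (g v) ζ‖ ≤ ‖b (g v)‖ * ‖ζ‖ := (b (g v)).le_opNorm ζ
        _ ≤ (K * ‖(e.symm (g v)).2‖) * (κ * ((‖fderiv ℝ g v₀‖ + 1) * ‖ξ‖)) := by gcongr
        _ = _ := by ring)
  refine ⟨fun v ↦ (e.symm (g v)).1, Metric.ball v₀ ρ, Metric.isOpen_ball, Metric.mem_ball_self hρ,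
    fun v hv ↦ (hball v hv).2.2.2.2.2.2.2, ?_, congrArg Prod.fst hΨg, ?_⟩
  · refine contDiff_fst.comp_contDiffOn (hes.comp (hg.mono ?_) ?_)
    · exact fun v hv ↦ (hball v hv).2.2.2.2.2.2.2
    · exact fun v hv ↦ (hball v hv).2.2.2.2.2.1
  · intro v hv
    have h6 := (hball v hv).2.2.2.2.2.1
    refine ⟨heU _ (e.map_target h6), ?_⟩
    have h0 : (e.symm (g v)).2 = 0 := hzero v hv
    rw [← hφ', ← h0]
    exact (e.right_inv h6).symm

end Straightening

/-! ### Pushing forward vector fields -/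

section PushForward

variable {E : Type*} [NormedAddCommGroup E] [NormedSpace ℝ E]
  {H : Type*} [TopologicalSpace H] {I : ModelWithCorners ℝ E H}
  {M : Type*} [TopologicalSpace M] [ChartedSpace H M] [IsManifold I ∞ M]
  {E' : Type*} [NormedAddCommGroup E'] [NormedSpace ℝ E']
  {H' : Type*} [TopologicalSpace H'] {I' : ModelWithCorners ℝ E' H'}
  {M' : Type*} [TopologicalSpace M'] [ChartedSpace H' M'] [IsManifold I' ∞ M']
  {E'' : Type*} [NormedAddCommGroup E''] [NormedSpace ℝ E'']
  {HN : Type*} [TopologicalSpace HN] {I'' : ModelWithCorners ℝ E'' HN}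
  {N : Type*} [TopologicalSpace N] [ChartedSpace HN N]

/-- The image of a smooth vector field under the tangent map of a smooth map is smooth. -/
theorem contMDiffOn_mfderiv_apply {f : M → M'} {s : Set M} (hs : IsOpen s)
    (hf : ContMDiffOn I I' ∞ f s) {X : (x : M) → TangentSpace I x} {u : Set M}
    (hX : ContMDiffOn I I.tangent ∞ (fun x ↦ (⟨x, X x⟩ : TangentBundle I M)) u)
    {g : N → M} {t : Set N} (hg : ContMDiffOn I'' I ∞ g t) (hgs : MapsTo g t s)
    (hgu : MapsTo g t u) :
    ContMDiffOn I'' I'.tangent ∞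
      (fun y ↦ (⟨f (g y), mfderiv I I' f (g y) (X (g y))⟩ : TangentBundle I' M')) t := by
  have h1 := hf.contMDiffOn_tangentMapWithin (m := ∞) (n := ∞) le_rfl hs.uniqueMDiffOn
  have h2 := h1.comp (hX.comp hg hgu) (fun y hy ↦ hgs hy)
  refine h2.congr fun y hy ↦ ?_
  change _ = (⟨f (g y), mfderivWithin I I' f s (g y) (X (g y))⟩ : TangentBundle I' M')
  rw [mfderivWithin_of_isOpen hs (hgs hy)]

end PushForward

/-! ### Vector fields in charts and their local flows -/

section Charts

variable {d : ℕ} {M : Type u} [TopologicalSpace M] [ChartedSpace (EuclideanSpace ℝ (Fin d)) M]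
  [IsManifold (𝓡 d) ∞ M]

local notation "𝔼" => EuclideanSpace ℝ (Fin d)

/-- The expression of a vector field in the chart around a point. -/
def chartField (x₀ : M) (X : (x : M) → TangentSpace (𝓡 d) x) (e : 𝔼) : 𝔼 :=
  mfderiv (𝓡 d) 𝓘(ℝ, 𝔼) (extChartAt (𝓡 d) x₀) ((extChartAt (𝓡 d) x₀).symm e)
    (X ((extChartAt (𝓡 d) x₀).symm e))

theorem LocalVectorField.contDiffOn_chartField (X : LocalVectorField d M) (x₀ : M) :
    ContDiffOn ℝ ∞ (chartField x₀ X.toFun)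
      ((extChartAt (𝓡 d) x₀).target ∩ (extChartAt (𝓡 d) x₀).symm ⁻¹' X.domain) := by
  rw [← contMDiffOn_iff_contDiffOn]
  have h := contMDiffOn_mfderiv_apply (isOpen_extChartAt_source (I := 𝓡 d) x₀)
    (contMDiffOn_extChartAt (n := ∞) (I := 𝓡 d) (x := x₀) |>.mono (by rw [extChartAt_source]))
    X.smooth (g := (extChartAt (𝓡 d) x₀).symm)
    (t := (extChartAt (𝓡 d) x₀).target ∩ (extChartAt (𝓡 d) x₀).symm ⁻¹' X.domain)
    ((contMDiffOn_extChartAt_symm x₀).mono inter_subset_left)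
    (fun e he ↦ (extChartAt (𝓡 d) x₀).map_target he.1) (fun e he ↦ he.2)
  exact contMDiff_snd_tangentBundle_modelSpace 𝔼 𝓘(ℝ, 𝔼) |>.comp_contMDiffOn h

theorem isOpen_chart_preimage (x₀ : M) {U : Set M} (hU : IsOpen U) :
    IsOpen ((extChartAt (𝓡 d) x₀).target ∩ (extChartAt (𝓡 d) x₀).symm ⁻¹' U) :=
  (continuousOn_extChartAt_symm x₀).isOpen_inter_preimage (isOpen_extChartAt_target x₀) hU

theorem mdifferentiableAt_extChartAt_symm (x₀ : M) {e : 𝔼}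
    (he : e ∈ (extChartAt (𝓡 d) x₀).target) :
    MDifferentiableAt 𝓘(ℝ, 𝔼) (𝓡 d) (extChartAt (𝓡 d) x₀).symm e :=
  ((contMDiffOn_extChartAt_symm (n := ∞) x₀).contMDiffAt
    ((isOpen_extChartAt_target x₀).mem_nhds he)).mdifferentiableAt (by simp)

theorem mfderiv_symm_mfderiv_extChartAt (x₀ : M) {e : 𝔼}
    (he : e ∈ (extChartAt (𝓡 d) x₀).target)
    (v : TangentSpace (𝓡 d) ((extChartAt (𝓡 d) x₀).symm e)) :
    mfderiv 𝓘(ℝ, 𝔼) (𝓡 d) (extChartAt (𝓡 d) x₀).symm e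
      (mfderiv (𝓡 d) 𝓘(ℝ, 𝔼) (extChartAt (𝓡 d) x₀) ((extChartAt (𝓡 d) x₀).symm e) v) = v := by
  have := DFunLike.congr_fun (mfderivWithin_extChartAt_symm_comp_mfderiv_extChartAt
    (I := 𝓡 d) (x := x₀) he) v
  rw [ModelWithCorners.Boundaryless.range_eq_univ, mfderivWithin_univ] at this
  exact this

theorem mfderiv_mfderiv_extChartAt_symm (x₀ : M) {e : 𝔼}
    (he : e ∈ (extChartAt (𝓡 d) x₀).target) (v : 𝔼) :
    mfderiv (𝓡 d) 𝓘(ℝ, 𝔼) (extChartAt (𝓡 d) x₀) ((extChartAt (𝓡 d) x₀).symm e)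
      (mfderiv 𝓘(ℝ, 𝔼) (𝓡 d) (extChartAt (𝓡 d) x₀).symm e v) = v := by
  have := DFunLike.congr_fun (mfderiv_extChartAt_comp_mfderivWithin_extChartAt_symm
    (I := 𝓡 d) (x := x₀) he) v
  rw [ModelWithCorners.Boundaryless.range_eq_univ, mfderivWithin_univ] at this
  exact this

/-- A smooth map on an open subset agrees near any given point with a globally smooth one. -/
theorem exists_contDiff_eqOn_ball {F : Type*} [NormedAddCommGroup F] [NormedSpace ℝ F]
    {f : 𝔼 → F} {U : Set 𝔼} (hU : IsOpen U) (hf : ContDiffOn ℝ ∞ f U) {x₀ : 𝔼} (hx₀ : x₀ ∈ U) :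
    ∃ r > 0, Metric.ball x₀ r ⊆ U ∧ ∃ g : 𝔼 → F, ContDiff ℝ ∞ g ∧ EqOn g f (Metric.ball x₀ r) := by
  obtain ⟨r, hr, hrU⟩ := Metric.isOpen_iff.1 hU x₀ hx₀
  -- The support of `χ`, a closed ball of radius `r / 2`, stays inside `U`, so the product with `f`
  -- is smooth everywhere; `χ` equals `1` on the ball of radius `r / 3`.
  let χ : ContDiffBump x₀ := ⟨r / 3, r / 2, by positivity, by linarith⟩
  refine ⟨r / 3, by positivity, (Metric.ball_subset_ball (by linarith)).trans hrU,
    fun x ↦ χ x • f x, ?_, fun x hx ↦ ?_⟩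
  · rw [← contMDiff_iff_contDiff]
    refine contMDiff_of_tsupport fun x hx ↦ ContDiffAt.contMDiffAt ?_
    have hx' : x ∈ U := by
      have h1 := tsupport_smul_subset_left _ _ hx
      rw [χ.tsupport_eq] at h1
      exact hrU (Metric.closedBall_subset_ball (by change r / 2 < r; linarith) h1)
    exact χ.contDiffAt.smul (hf.contDiffAt (hU.mem_nhds hx'))
  · change χ x • f x = f x
    rw [χ.one_of_mem_closedBall (Metric.ball_subset_closedBall hx), one_smul]

/-- Existence and smoothness of the local flow of a vector field. -/
theorem LocalVectorField.exists_local_flow (X : LocalVectorField d M) {x₀ : M}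
    (hx₀ : x₀ ∈ X.domain) :
    ∃ ε > 0, ∃ U : Set M, IsOpen U ∧ x₀ ∈ U ∧ ∃ F : ℝ × M → M,
      ContMDiffOn (𝓘(ℝ, ℝ).prod (𝓡 d)) (𝓡 d) ∞ F (Ioo (-ε) ε ×ˢ U) ∧
      ∀ x ∈ U, F (0, x) = x ∧ (∀ t ∈ Ioo (-ε) ε, F (t, x) ∈ X.domain) ∧
        IsMIntegralCurveOn (I := 𝓡 d) (fun t ↦ F (t, x)) X.toFun (Ioo (-ε) ε) := by
  set ψ := extChartAt (𝓡 d) x₀ with hψ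
  have hO := isOpen_chart_preimage (d := d) x₀ X.domain.isOpen
  have he₀ : ψ x₀ ∈ ψ.target ∩ ψ.symm ⁻¹' X.domain :=
    ⟨mem_extChartAt_target x₀, by
      rw [mem_preimage, extChartAt_to_inv]
      exact hx₀⟩
  obtain ⟨r, hr, hrO, f, hf, hfX⟩ :=
    exists_contDiff_eqOn_ball hO (X.contDiffOn_chartField x₀) he₀
  obtain ⟨δ, hδ, α, hα, hαf⟩ := exists_contDiffOn_flow hf (ψ x₀)
  have hα0 : ContinuousAt α (ψ x₀, 0) := hα.continuousOn.continuousAt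
    (prod_mem_nhds (Metric.ball_mem_nhds _ hδ) (Ioo_mem_nhds (by linarith) hδ))
  have hαx₀ : α (ψ x₀, 0) = ψ x₀ := (hαf _ (Metric.mem_ball_self hδ)).1
  obtain ⟨δ', hδ', hδα⟩ := Metric.continuousAt_iff.1 hα0 r hr
  rw [hαx₀] at hδα
  -- Besides keeping solutions defined, `ε` keeps them in the ball of radius `r`, where the globally
  -- defined field `f` is still the chart expression of `X`.
  set ε := min δ δ' with hε
  have hεpos : 0 < ε := by positivity
  have hsub : ∀ t ∈ Ioo (-ε) ε, t ∈ Ioo (-δ) δ := fun t ht ↦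
    ⟨by linarith [ht.1, min_le_left δ δ'], by linarith [ht.2, min_le_left δ δ']⟩
  have hsub' : ∀ e ∈ Metric.ball (ψ x₀) ε, e ∈ Metric.ball (ψ x₀) δ := fun e he ↦
    Metric.ball_subset_ball (min_le_left _ _) he
  have hαr : ∀ e ∈ Metric.ball (ψ x₀) ε, ∀ t ∈ Ioo (-ε) ε, α (e, t) ∈ Metric.ball (ψ x₀) r := by
    intro e he t ht
    refine hδα ?_
    rw [Prod.dist_eq, max_lt_iff, Real.dist_eq, sub_zero]
    exact ⟨(Metric.mem_ball.1 he).trans_le (min_le_right _ _),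
      (abs_lt.2 ht).trans_le (min_le_right _ _)⟩
  refine ⟨ε, hεpos, ψ.source ∩ ψ ⁻¹' Metric.ball (ψ x₀) ε,
    (continuousOn_extChartAt x₀).isOpen_inter_preimage (isOpen_extChartAt_source x₀)
      Metric.isOpen_ball, ⟨mem_extChartAt_source x₀, Metric.mem_ball_self hεpos⟩,
    fun p ↦ ψ.symm (α (ψ p.2, p.1)), ?_, ?_⟩
  · refine (contMDiffOn_extChartAt_symm (n := ∞) x₀).comp
      (t := (extChartAt (𝓡 d) x₀).target) (f := fun p : ℝ × M ↦ α (ψ p.2, p.1)) ?_ ?_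
    · refine (hα.contMDiffOn).comp (f := fun p : ℝ × M ↦ (ψ p.2, p.1)) ?_ ?_
      · refine ContMDiffOn.prodMk_space ?_ contMDiffOn_fst
        refine (contMDiffOn_extChartAt (n := ∞) (I := 𝓡 d) (x := x₀)).comp contMDiffOn_snd ?_
        intro p hp
        rw [← extChartAt_source (𝓡 d)]
        exact hp.2.1
      · intro p hp
        exact ⟨hsub' _ hp.2.2, hsub _ hp.1⟩
    · intro p hp
      exact (hrO (hαr _ hp.2.2 _ hp.1)).1
  · rintro x ⟨hxs, hxb⟩
    refine ⟨?_, fun t ht ↦ (hrO (hαr _ hxb t ht)).2, fun t ht ↦ ?_⟩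
    · change ψ.symm (α (ψ x, 0)) = x
      rw [(hαf _ (hsub' _ hxb)).1, ψ.left_inv hxs]
    · have htar := (hrO (hαr _ hxb t ht)).1
      have h1 : HasMFDerivAt 𝓘(ℝ, ℝ) 𝓘(ℝ, 𝔼) (fun s ↦ α (ψ x, s)) t
          ((1 : ℝ →L[ℝ] ℝ).smulRight (f (α (ψ x, t)))) :=
        ((hαf _ (hsub' _ hxb)).2 t (hsub t ht)).hasFDerivAt.hasMFDerivAt
      have h2 := (mdifferentiableAt_extChartAt_symm x₀ htar).hasMFDerivAt
      have h3 := HasMFDerivAt.comp t h2 h1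
      refine HasMFDerivAt.hasMFDerivWithinAt (HasMFDerivAt.congr_mfderiv h3 ?_)
      refine ContinuousLinearMap.ext fun (a : ℝ) ↦ ?_
      let L : 𝔼 →L[ℝ] 𝔼 := mfderiv 𝓘(ℝ, 𝔼) (𝓡 d) (extChartAt (𝓡 d) x₀).symm (α (ψ x, t))
      refine (L.map_smul a (f (α (ψ x, t)))).trans (congrArg (fun v : 𝔼 ↦ a • v) ?_)
      rw [hfX (hαr _ hxb t ht)]
      exact mfderiv_symm_mfderiv_extChartAt x₀ htar _

end Charts

/-! ### The maximal local flow: group law, open domain, smoothness -/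

section Flow

variable {d : ℕ} {M : Type u} [TopologicalSpace M] [ChartedSpace (EuclideanSpace ℝ (Fin d)) M]
  [IsManifold (𝓡 d) ∞ M] [T2Space M] {X : LocalVectorField d M}

theorem LocalVectorField.contMDiffAt (X : LocalVectorField d M) {x : M} (hx : x ∈ X.domain) :
    ContMDiffAt (𝓡 d) (𝓡 d).tangent ∞ (fun x ↦ (⟨x, X.toFun x⟩ : TangentBundle (𝓡 d) M)) x :=
  (X.smooth x hx).contMDiffAt (X.domain.isOpen.mem_nhds hx)

/-- Uniqueness of integral curves inside the domain of a local vector field. -/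
theorem integralCurve_eqOn {γ γ' : ℝ → M} {a b t₀ : ℝ} (ht₀ : t₀ ∈ Ioo a b)
    (hγ : IsMIntegralCurveOn (I := 𝓡 d) γ X.toFun (Ioo a b))
    (hγX : ∀ t ∈ Ioo a b, γ t ∈ X.domain)
    (hγ' : IsMIntegralCurveOn (I := 𝓡 d) γ' X.toFun (Ioo a b)) (h : γ t₀ = γ' t₀) :
    EqOn γ γ' (Ioo a b) := by
  have hloc : ∀ t ∈ Ioo a b, γ t = γ' t → γ =ᶠ[𝓝 t] γ' := fun t ht h ↦
    isMIntegralCurveAt_eventuallyEq_of_contMDiffAt_boundaryless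
      ((X.contMDiffAt (hγX t ht)).of_le (by simp)) (hγ.isMIntegralCurveAt (Ioo_mem_nhds ht.1 ht.2))
      (hγ'.isMIntegralCurveAt (Ioo_mem_nhds ht.1 ht.2)) h
  intro t ht
  -- Agreement of the two curves is a locally constant condition on a connected interval: agreement
  -- spreads by local uniqueness, disagreement because `M` is Hausdorff.
  refine (isPreconnected_Ioo.induction₂ (fun s s' ↦ γ s = γ' s ↔ γ s' = γ' s') ?_ ?_ ?_
    ht₀ ht).1 h
  · intro s hs
    by_cases hss : γ s = γ' s
    · filter_upwards [nhdsWithin_le_nhds (hloc s hs hss)] with s' hs'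
      exact iff_of_true hss hs'
    · have hc : ∀ᶠ s' in 𝓝 s, γ s' ≠ γ' s' :=
        (((hγ.continuousWithinAt hs).continuousAt (Ioo_mem_nhds hs.1 hs.2)).prodMk
          ((hγ'.continuousWithinAt hs).continuousAt (Ioo_mem_nhds hs.1 hs.2))).eventually
          (isClosed_diagonal.isOpen_compl.mem_nhds hss)
      filter_upwards [nhdsWithin_le_nhds hc] with s' hs'
      exact iff_of_false hss hs'
  · exact fun _ _ _ _ _ _ h₁ h₂ ↦ h₁.trans h₂
  · exact fun _ _ _ _ h ↦ h.symm

theorem IsFlowCurve.eq {t : ℝ} {m : M} {γ γ' : ℝ → M} (h : IsFlowCurve X t m γ)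
    (h' : IsFlowCurve X t m γ') : γ t = γ' t := by
  obtain ⟨h0, a, b, h0m, htm, hi, hd⟩ := h
  obtain ⟨h0', a', b', h0m', htm', hi', hd'⟩ := h'
  have hs : Ioo (max a a') (min b b') ⊆ Ioo a b :=
    Ioo_subset_Ioo (le_max_left _ _) (min_le_left _ _)
  have hs' : Ioo (max a a') (min b b') ⊆ Ioo a' b' :=
    Ioo_subset_Ioo (le_max_right _ _) (min_le_right _ _)
  exact integralCurve_eqOn (t₀ := 0) ⟨max_lt h0m.1 h0m'.1, lt_min h0m.2 h0m'.2⟩ (hi.mono hs)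
    (fun s h ↦ hd s (hs h)) (hi'.mono hs') (h0.trans h0'.symm)
    ⟨max_lt htm.1 htm'.1, lt_min htm.2 htm'.2⟩

/-- `flow` is defined by a choice of curve; uniqueness makes every admissible curve compute it. -/
theorem IsFlowCurve.flow_eq {t : ℝ} {m : M} {γ : ℝ → M} (h : IsFlowCurve X t m γ) :
    flow X t m = γ t := by
  have hex : ∃ γ : ℝ → M, IsFlowCurve X t m γ := ⟨γ, h⟩
  rw [flow, dif_pos hex]
  exact hex.choose_spec.eq h

/-- The flow line through a point of the flow domain, as an integral curve. -/
theorem exists_flow_line {t : ℝ} {m : M} (h : (t, m) ∈ flowDomain X) :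
    ∃ a b : ℝ, 0 ∈ Ioo a b ∧ t ∈ Ioo a b ∧ flow X 0 m = m ∧
      ∀ s ∈ Ioo a b, (s, m) ∈ flowDomain X ∧ flow X s m ∈ X.domain ∧
        HasMFDerivAt 𝓘(ℝ, ℝ) (𝓡 d) (fun s ↦ flow X s m) s
          ((1 : ℝ →L[ℝ] ℝ).smulRight (X.toFun (flow X s m))) := by
  obtain ⟨γ, h0, a, b, h0m, htm, hi, hd⟩ := h
  have hfc : ∀ s ∈ Ioo a b, IsFlowCurve X s m γ := fun s hs ↦ ⟨h0, a, b, h0m, hs, hi, hd⟩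
  have heq : ∀ s ∈ Ioo a b, flow X s m = γ s := fun s hs ↦ (hfc s hs).flow_eq
  refine ⟨a, b, h0m, htm, (heq 0 h0m).trans h0, fun s hs ↦ ⟨⟨γ, hfc s hs⟩, ?_, ?_⟩⟩
  · rw [heq s hs]
    exact hd s hs
  · have h1 := (hi s hs).hasMFDerivAt (Ioo_mem_nhds hs.1 hs.2)
    rw [heq s hs]
    refine h1.congr_of_eventuallyEq ?_
    filter_upwards [Ioo_mem_nhds hs.1 hs.2] with s' hs'
    exact heq s' hs'

/-- Autonomous equations are invariant under time translation, so a single integral curve yields the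
flow between any two of its points. Inverses of flows come from here. -/
theorem mem_flowDomain_of_curve {γ : ℝ → M} {a b s t : ℝ} (hs : s ∈ Ioo a b) (ht : t ∈ Ioo a b)
    (hi : IsMIntegralCurveOn (I := 𝓡 d) γ X.toFun (Ioo a b))
    (hd : ∀ s ∈ Ioo a b, γ s ∈ X.domain) :
    (t - s, γ s) ∈ flowDomain X ∧ flow X (t - s) (γ s) = γ t := by
  have hset : Ioo (a - s) (b - s) = {r | r + s ∈ Ioo a b} := by
    ext r
    simp [sub_lt_iff_lt_add, lt_sub_iff_add_lt]
  have hfc : IsFlowCurve X (t - s) (γ s) (γ ∘ (· + s)) := by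
    refine ⟨by simp, a - s, b - s, ⟨by linarith [hs.1], by linarith [hs.2]⟩,
      ⟨by linarith [ht.1], by linarith [ht.2]⟩, ?_, ?_⟩
    · rw [hset]
      exact hi.comp_add s
    · intro r hr
      rw [hset] at hr
      exact hd _ hr
  exact ⟨⟨_, hfc⟩, by rw [hfc.flow_eq]; simp⟩

theorem flow_neg {t : ℝ} {m : M} (h : (t, m) ∈ flowDomain X) :
    (-t, flow X t m) ∈ flowDomain X ∧ flow X (-t) (flow X t m) = m := by
  obtain ⟨γ, hγ⟩ := h
  rw [hγ.flow_eq]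
  obtain ⟨h0, a, b, h0m, htm, hi, hd⟩ := hγ
  have := mem_flowDomain_of_curve htm h0m hi hd
  rwa [zero_sub, h0] at this

theorem mem_domain_of_mem_flowDomain {t : ℝ} {m : M} (h : (t, m) ∈ flowDomain X) :
    m ∈ X.domain := by
  obtain ⟨a, b, h0, -, h0', hs⟩ := exists_flow_line h
  have := (hs 0 h0).2.1
  rwa [h0'] at this

theorem flow_mem_domain {t : ℝ} {m : M} (h : (t, m) ∈ flowDomain X) : flow X t m ∈ X.domain := by
  obtain ⟨a, b, -, ht, -, hs⟩ := exists_flow_line h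
  exact (hs t ht).2.1

theorem hasMFDerivAt_flow_time {t : ℝ} {m : M} (h : (t, m) ∈ flowDomain X) :
    HasMFDerivAt 𝓘(ℝ, ℝ) (𝓡 d) (fun s ↦ flow X s m) t
      ((1 : ℝ →L[ℝ] ℝ).smulRight (X.toFun (flow X t m))) := by
  obtain ⟨a, b, -, ht, -, hs⟩ := exists_flow_line h
  exact (hs t ht).2.2

theorem flow_add {s t : ℝ} {m : M} (hs : (s, m) ∈ flowDomain X)
    (ht : (t, flow X s m) ∈ flowDomain X) :
    (s + t, m) ∈ flowDomain X ∧ flow X (s + t) m = flow X t (flow X s m) := by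
  classical
  obtain ⟨γ₁, hγ₁⟩ := hs
  obtain ⟨γ₂, hγ₂⟩ := ht
  rw [hγ₂.flow_eq]
  rw [hγ₁.flow_eq] at hγ₂
  obtain ⟨h10, a, b, h0m, hsm, hi₁, hd₁⟩ := hγ₁
  obtain ⟨h20, a', b', h0m', htm', hi₂, hd₂⟩ := hγ₂
  have hset : {r : ℝ | r + -s ∈ Ioo a' b'} = Ioo (a' + s) (b' + s) := by
    ext r
    simp [← sub_eq_add_neg, lt_sub_iff_add_lt, sub_lt_iff_lt_add]
  have hi₂' : IsMIntegralCurveOn (I := 𝓡 d) (γ₂ ∘ (· + -s)) X.toFun (Ioo (a' + s) (b' + s)) := by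
    rw [← hset]
    exact hi₂.comp_add (-s)
  have hd₂' : ∀ r ∈ Ioo (a' + s) (b' + s), (γ₂ ∘ (· + -s)) r ∈ X.domain := by
    rw [← hset]
    exact fun r hr ↦ hd₂ _ hr
  have hover : EqOn γ₁ (γ₂ ∘ (· + -s)) (Ioo (max a (a' + s)) (min b (b' + s))) :=
    integralCurve_eqOn (t₀ := s) (X := X)
      ⟨max_lt hsm.1 (by linarith [h0m'.1]), lt_min hsm.2 (by linarith [h0m'.2])⟩
      (hi₁.mono (Ioo_subset_Ioo (le_max_left _ _) (min_le_left _ _)))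
      (fun r hr ↦ hd₁ r (Ioo_subset_Ioo (le_max_left _ _) (min_le_left _ _) hr))
      (hi₂'.mono (Ioo_subset_Ioo (le_max_right _ _) (min_le_right _ _))) (by simp [h20])
  -- The first curve followed by the translate of the second. They agree on the overlap of their
  -- intervals, so near every time the glued curve is one of the two.
  let γ : ℝ → M := fun r ↦ if r ∈ Ioo a b then γ₁ r else γ₂ (r + -s)
  have hγ1 : ∀ r ∈ Ioo a b, γ r = γ₁ r := fun r hr ↦ if_pos hr
  have hγ2 : ∀ r ∈ Ioo (a' + s) (b' + s), γ r = γ₂ (r + -s) := by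
    intro r hr
    by_cases hr' : r ∈ Ioo a b
    · rw [hγ1 r hr']
      exact hover ⟨max_lt hr'.1 hr.1, lt_min hr'.2 hr.2⟩
    · exact if_neg hr'
  have hcover : ∀ r ∈ Ioo (min a (a' + s)) (max b (b' + s)),
      r ∈ Ioo a b ∨ r ∈ Ioo (a' + s) (b' + s) := by
    intro r hr
    have hs' : s ∈ Ioo (a' + s) (b' + s) := ⟨by linarith [h0m'.1], by linarith [h0m'.2]⟩
    rcases le_total r s with hrs | hrs
    · rcases min_lt_iff.1 hr.1 with h | h
      · exact Or.inl ⟨h, hrs.trans_lt hsm.2⟩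
      · exact Or.inr ⟨h, hrs.trans_lt hs'.2⟩
    · rcases lt_max_iff.1 hr.2 with h | h
      · exact Or.inl ⟨hsm.1.trans_le hrs, h⟩
      · exact Or.inr ⟨hs'.1.trans_le hrs, h⟩
  have hfc : IsFlowCurve X (s + t) m γ := by
    refine ⟨(hγ1 0 h0m).trans h10, min a (a' + s), max b (b' + s),
      ⟨(min_le_left _ _).trans_lt h0m.1, h0m.2.trans_le (le_max_left _ _)⟩,
      ⟨(min_le_right _ _).trans_lt (by linarith [htm'.1]),
        lt_of_lt_of_le (by linarith [htm'.2]) (le_max_right _ _)⟩, ?_, ?_⟩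
    · intro r hr
      refine HasMFDerivAt.hasMFDerivWithinAt ?_
      rcases hcover r hr with h | h
      · rw [hγ1 r h]
        refine ((hi₁ r h).hasMFDerivAt (Ioo_mem_nhds h.1 h.2)).congr_of_eventuallyEq ?_
        filter_upwards [Ioo_mem_nhds h.1 h.2] with r' hr' using hγ1 r' hr'
      · rw [hγ2 r h]
        refine ((hi₂' r h).hasMFDerivAt (Ioo_mem_nhds h.1 h.2)).congr_of_eventuallyEq ?_
        filter_upwards [Ioo_mem_nhds h.1 h.2] with r' hr' using hγ2 r' hr'
    · intro r hr
      rcases hcover r hr with h | h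
      · rw [hγ1 r h]
        exact hd₁ r h
      · rw [hγ2 r h]
        exact hd₂' r h
  refine ⟨⟨γ, hfc⟩, ?_⟩
  rw [hfc.flow_eq, hγ2 _ ⟨by linarith [htm'.1], by linarith [htm'.2]⟩]
  congr 1
  ring

/-- Every point of the domain of a local vector field has a neighbourhood on which its flow is
defined and smooth for a uniform time. -/
theorem exists_flow_box {x₀ : M} (hx₀ : x₀ ∈ X.domain) :
    ∃ ε > 0, ∃ U : Set M, IsOpen U ∧ x₀ ∈ U ∧ Ioo (-ε) ε ×ˢ U ⊆ flowDomain X ∧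
      ContMDiffOn (𝓘(ℝ, ℝ).prod (𝓡 d)) (𝓡 d) ∞ (fun p : ℝ × M ↦ flow X p.1 p.2)
        (Ioo (-ε) ε ×ˢ U) := by
  obtain ⟨ε, hε, U, hU, hxU, F, hF, hFX⟩ := X.exists_local_flow hx₀
  have hmem : ∀ p ∈ Ioo (-ε) ε ×ˢ U, p ∈ flowDomain X ∧ flow X p.1 p.2 = F p := by
    rintro ⟨t, x⟩ ⟨ht, hx⟩
    have h0 : (0 : ℝ) ∈ Ioo (-ε) ε := ⟨by linarith, hε⟩
    have := mem_flowDomain_of_curve h0 ht (hFX x hx).2.2 (hFX x hx).2.1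
    rw [sub_zero, (hFX x hx).1] at this
    exact this
  exact ⟨ε, hε, U, hU, hxU, fun p hp ↦ (hmem p hp).1, hF.congr fun p hp ↦ (hmem p hp).2⟩

theorem flow_zero {x : M} (hx : x ∈ X.domain) : (0, x) ∈ flowDomain X ∧ flow X 0 x = x := by
  obtain ⟨ε, hε, U, -, hxU, hsub, -⟩ := exists_flow_box hx
  have h : (0, x) ∈ flowDomain X := hsub ⟨⟨by simpa using hε, hε⟩, hxU⟩
  obtain ⟨a, b, -, -, h0, -⟩ := exists_flow_line h
  exact ⟨h, h0⟩

theorem flowDomain_mem_nhds_and_contMDiffAt {p : ℝ × M} (hp : p ∈ flowDomain X) :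
    flowDomain X ∈ 𝓝 p ∧
      ContMDiffAt (𝓘(ℝ, ℝ).prod (𝓡 d)) (𝓡 d) ∞ (fun p : ℝ × M ↦ flow X p.1 p.2) p := by
  obtain ⟨t, m⟩ := p
  let Good : ℝ → Prop := fun t ↦ flowDomain X ∈ 𝓝 (t, m) ∧
      ContMDiffAt (𝓘(ℝ, ℝ).prod (𝓡 d)) (𝓡 d) ∞ (fun p : ℝ × M ↦ flow X p.1 p.2) (t, m)
  -- Near `(t, m)` the flow is `Fl_{t-s} ∘ Fl_s`, where the first factor is smooth on a flow box
  -- around `flow X s m`. Thus good behaviour passes from `s` to every `t` closer than the box time.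
  have hstep : ∀ (ε : ℝ) (U : Set M), IsOpen U → Ioo (-ε) ε ×ˢ U ⊆ flowDomain X →
      ContMDiffOn (𝓘(ℝ, ℝ).prod (𝓡 d)) (𝓡 d) ∞ (fun p : ℝ × M ↦ flow X p.1 p.2)
        (Ioo (-ε) ε ×ˢ U) →
      ∀ s t, |t - s| < ε → flow X s m ∈ U → Good s → Good t := by
    intro ε U hU hbox hsm s t hst hsU ⟨hg1, hg2⟩
    have hemb : ContinuousAt (fun p : ℝ × M ↦ (s, p.2)) (t, m) := by fun_prop
    have hfs : ContMDiffAt (𝓘(ℝ, ℝ).prod (𝓡 d)) (𝓡 d) ∞ (fun p : ℝ × M ↦ flow X s p.2) (t, m) :=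
      ContMDiffAt.comp (f := fun p : ℝ × M ↦ (s, p.2)) (t, m) hg2
        (contMDiffAt_const.prodMk contMDiffAt_snd)
    have hev : ∀ᶠ p : ℝ × M in 𝓝 (t, m), (s, p.2) ∈ flowDomain X ∧
        (p.1 - s, flow X s p.2) ∈ Ioo (-ε) ε ×ˢ U := by
      refine Filter.Eventually.and (hemb.eventually hg1) ?_
      have hc : ContinuousAt (fun p : ℝ × M ↦ (p.1 - s, flow X s p.2)) (t, m) :=
        (continuousAt_fst.sub continuousAt_const).prodMk hfs.continuousAt
      exact hc ((isOpen_Ioo.prod hU).mem_nhds ⟨abs_lt.1 hst, hsU⟩)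
    have heq : ∀ᶠ p : ℝ × M in 𝓝 (t, m), p ∈ flowDomain X ∧
        flow X p.1 p.2 = flow X (p.1 - s) (flow X s p.2) := by
      filter_upwards [hev] with p hp
      have := flow_add hp.1 (hbox hp.2)
      rwa [add_sub_cancel] at this
    refine ⟨heq.mono fun p hp ↦ hp.1, ?_⟩
    have hcomp : ContMDiffAt (𝓘(ℝ, ℝ).prod (𝓡 d)) (𝓡 d) ∞
        (fun p : ℝ × M ↦ flow X (p.1 - s) (flow X s p.2)) (t, m) := by
      refine ContMDiffAt.comp (I' := 𝓘(ℝ, ℝ).prod (𝓡 d))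
        (f := fun p : ℝ × M ↦ (p.1 - s, flow X s p.2))
        (g := fun p : ℝ × M ↦ flow X p.1 p.2) (t, m) ?_ ?_
      · exact hsm.contMDiffAt ((isOpen_Ioo.prod hU).mem_nhds hev.self_of_nhds.2)
      · exact (contMDiffAt_fst.sub contMDiffAt_const).prodMk hfs
    exact hcomp.congr_of_eventuallyEq (heq.mono fun p hp ↦ hp.2)
  obtain ⟨a, b, h0, ht, h0', hline⟩ := exists_flow_line hp
  -- The box around `flow X s m` has a uniform time and serves all nearby starting times, so
  -- goodness is locally constant along the flow line; it holds at time `0`.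
  refine (isPreconnected_Ioo.induction₂ (fun s s' ↦ Good s ↔ Good s') ?_
    (fun _ _ _ _ _ _ h₁ h₂ ↦ h₁.trans h₂) (fun _ _ _ _ h ↦ h.symm) h0 ht).1 ?_
  · intro s hs
    obtain ⟨ε, hε, U, hU, hsU, hbox, hsm⟩ := exists_flow_box (hline s hs).2.1
    have hcont : ContinuousAt (fun s ↦ flow X s m) s := (hline s hs).2.2.continuousAt
    filter_upwards [nhdsWithin_le_nhds (hcont (hU.mem_nhds hsU)),
      nhdsWithin_le_nhds (Metric.ball_mem_nhds s hε)] with s' hs'U hs'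
    rw [Metric.mem_ball, Real.dist_eq] at hs'
    exact ⟨hstep ε U hU hbox hsm s s' hs' hsU,
      hstep ε U hU hbox hsm s' s (by rwa [abs_sub_comm]) hs'U⟩
  · obtain ⟨ε, hε, U, hU, hmU, hbox, hsm⟩ := exists_flow_box (mem_domain_of_mem_flowDomain hp)
    have hn : Ioo (-ε) ε ×ˢ U ∈ 𝓝 ((0 : ℝ), m) :=
      (isOpen_Ioo.prod hU).mem_nhds ⟨⟨by linarith, hε⟩, hmU⟩
    exact ⟨Filter.mem_of_superset hn hbox, hsm.contMDiffAt hn⟩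

theorem isOpen_flowDomain (X : LocalVectorField d M) : IsOpen (flowDomain X) :=
  isOpen_iff_mem_nhds.2 fun _ hp ↦ (flowDomain_mem_nhds_and_contMDiffAt hp).1

theorem contMDiffAt_flow {p : ℝ × M} (hp : p ∈ flowDomain X) :
    ContMDiffAt (𝓘(ℝ, ℝ).prod (𝓡 d)) (𝓡 d) ∞ (fun p : ℝ × M ↦ flow X p.1 p.2) p :=
  (flowDomain_mem_nhds_and_contMDiffAt hp).2

theorem contMDiffAt_flow_point {t : ℝ} {m : M} (h : (t, m) ∈ flowDomain X) :
    ContMDiffAt (𝓡 d) (𝓡 d) ∞ (flow X t) m :=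
  ContMDiffAt.comp (f := fun x : M ↦ (t, x)) m (contMDiffAt_flow h)
    (contMDiffAt_const.prodMk contMDiffAt_id)

theorem eventually_mem_flowDomain {t : ℝ} {m : M} (h : (t, m) ∈ flowDomain X) :
    ∀ᶠ x in 𝓝 m, (t, x) ∈ flowDomain X :=
  (Continuous.prodMk_right t).continuousAt ((isOpen_flowDomain X).mem_nhds h)

theorem mfderiv_flow_neg_mfderiv_flow {t : ℝ} {m : M} (h : (t, m) ∈ flowDomain X)
    (v : TangentSpace (𝓡 d) m) :
    mfderiv (𝓡 d) (𝓡 d) (flow X (-t)) (flow X t m) (mfderiv (𝓡 d) (𝓡 d) (flow X t) m v) = v := by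
  have h1 := ((contMDiffAt_flow_point h).mdifferentiableAt (by simp)).hasMFDerivAt
  have h2 := ((contMDiffAt_flow_point (flow_neg h).1).mdifferentiableAt (by simp)).hasMFDerivAt
  have h3 := h2.comp m h1
  have h4 : HasMFDerivAt (𝓡 d) (𝓡 d) (flow X (-t) ∘ flow X t) m
      (ContinuousLinearMap.id ℝ (TangentSpace (𝓡 d) m)) := by
    refine (hasMFDerivAt_id m).congr_of_eventuallyEq ?_
    filter_upwards [eventually_mem_flowDomain h] with x hx
    exact (flow_neg hx).2
  exact DFunLike.congr_fun (hasMFDerivAt_unique h3 h4) v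

end Flow

/-! ### Compositions of flows, the distribution `P_D` and orbits -/

section Words

variable {d : ℕ} {M : Type u} [TopologicalSpace M] [ChartedSpace (EuclideanSpace ℝ (Fin d)) M]
  [IsManifold (𝓡 d) ∞ M] {D : Set (LocalVectorField d M)}

/-- The tuple consisting of one vector field. -/
def Word.single {X : LocalVectorField d M} (hX : X ∈ D) : Word D :=
  ⟨⟨1, le_rfl⟩, fun _ ↦ ⟨X, hX⟩⟩

/-- Adding a vector field at the front of a tuple. -/
def Word.cons {X : LocalVectorField d M} (hX : X ∈ D) (w : Word D) : Word D :=
  ⟨⟨w.length + 1, Nat.le_add_left _ _⟩, Fin.cons (⟨X, hX⟩ : D) w.2⟩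

variable {X : LocalVectorField d M}

theorem Word.mem_timeDomain_single (hX : X ∈ D) {T : Fin 1 → ℝ} {m : M} :
    T ∈ timeDomain (Word.single hX).fields m ↔ (T 0, m) ∈ flowDomain X :=
  ⟨fun h ↦ h.2, fun h ↦ ⟨trivial, h⟩⟩

theorem Word.multiflow_cons (hX : X ∈ D) (w : Word D) (t : ℝ) (T : Fin w.length → ℝ) (m : M) :
    multiflow (Word.cons hX w).fields (Fin.cons t T : Fin (w.length + 1) → ℝ) m =
      flow X t (multiflow w.fields T m) := rfl

theorem Word.mem_timeDomain_cons (hX : X ∈ D) (w : Word D) {t : ℝ} {T : Fin w.length → ℝ}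
    {m : M} : (Fin.cons t T : Fin (w.length + 1) → ℝ) ∈ timeDomain (Word.cons hX w).fields m ↔
      T ∈ timeDomain w.fields m ∧ (t, multiflow w.fields T m) ∈ flowDomain X := Iff.rfl

variable [T2Space M]

section Family

variable {E : Type*} [NormedAddCommGroup E] [NormedSpace ℝ E]
  {H : Type*} [TopologicalSpace H] {I : ModelWithCorners ℝ E H}
  {P : Type*} [TopologicalSpace P] [ChartedSpace H P]

/-- The derivative of a family of points moved along the flow of `X`. -/
theorem hasMFDerivAt_flow_family {τ : P → ℝ} {g : P → M} {p : P}
    {τ' : TangentSpace I p →L[ℝ] ℝ} {g' : TangentSpace I p →L[ℝ] TangentSpace (𝓡 d) (g p)}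
    (hτ : HasMFDerivAt I 𝓘(ℝ, ℝ) τ p τ') (hg : HasMFDerivAt I (𝓡 d) g p g')
    (hX : (τ p, g p) ∈ flowDomain X) :
    HasMFDerivAt I (𝓡 d) (fun p ↦ flow X (τ p) (g p)) p
      (τ'.smulRight (X.toFun (flow X (τ p) (g p))) +
        (mfderiv (𝓡 d) (𝓡 d) (flow X (τ p)) (g p)).comp g') := by
  have hfl : MDifferentiableAt (𝓘(ℝ, ℝ).prod (𝓡 d)) (𝓡 d) (fun q : ℝ × M ↦ flow X q.1 q.2)
      (τ p, g p) := (contMDiffAt_flow hX).mdifferentiableAt (by simp)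
  have h1 := hfl.hasMFDerivAt.comp p (hτ.prodMk hg)
  refine h1.congr_mfderiv (ContinuousLinearMap.ext fun ξ ↦ ?_)
  refine (mfderiv_prod_eq_add_apply hfl).trans ?_
  exact congrArg₂ (· + ·) (DFunLike.congr_fun (hasMFDerivAt_flow_time hX).mfderiv (τ' ξ)) rfl

theorem contMDiffAt_flow_family {τ : P → ℝ} {g : P → M} {p : P}
    (hτ : ContMDiffAt I 𝓘(ℝ, ℝ) ∞ τ p) (hg : ContMDiffAt I (𝓡 d) ∞ g p)
    (hX : (τ p, g p) ∈ flowDomain X) :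
    ContMDiffAt I (𝓡 d) ∞ (fun p ↦ flow X (τ p) (g p)) p :=
  ContMDiffAt.comp (I' := 𝓘(ℝ, ℝ).prod (𝓡 d)) (f := fun p ↦ (τ p, g p))
    (g := fun q : ℝ × M ↦ flow X q.1 q.2) p (contMDiffAt_flow hX) (hτ.prodMk hg)

end Family

theorem contMDiff_tail (n : ℕ) :
    ContMDiff 𝓘(ℝ, Fin (n + 1) → ℝ) 𝓘(ℝ, Fin n → ℝ) ∞
      (fun T : Fin (n + 1) → ℝ ↦ (Fin.tail T : Fin n → ℝ)) :=
  ContDiff.contMDiff (contDiff_pi.2 fun i ↦ contDiff_apply ℝ ℝ (Fin.succ i))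

/-- The domain of a composition of flows is open, and the composition is smooth there. -/
theorem multiflowDomain_mem_nhds_and_contMDiffAt {n : ℕ} (ξ : Fin n → LocalVectorField d M)
    {p : (Fin n → ℝ) × M} (hp : p ∈ multiflowDomain ξ) :
    multiflowDomain ξ ∈ 𝓝 p ∧ ContMDiffAt (𝓘(ℝ, Fin n → ℝ).prod (𝓡 d)) (𝓡 d) ∞
      (fun p : (Fin n → ℝ) × M ↦ multiflow ξ p.1 p.2) p := by
  induction n with
  | zero => exact ⟨Filter.univ_mem, contMDiffAt_snd⟩
  | succ n ih =>
    obtain ⟨hp1, hp2⟩ := hp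
    obtain ⟨hn, hs⟩ := ih (Fin.tail ξ) hp1
    have htail : ContMDiffAt (𝓘(ℝ, Fin (n + 1) → ℝ).prod (𝓡 d))
        (𝓘(ℝ, Fin n → ℝ).prod (𝓡 d)) ∞
        (fun p : (Fin (n + 1) → ℝ) × M ↦ (Fin.tail p.1, p.2)) p :=
      (((contMDiff_tail n).contMDiffAt).comp p contMDiffAt_fst).prodMk contMDiffAt_snd
    have hs' : ContMDiffAt (𝓘(ℝ, Fin (n + 1) → ℝ).prod (𝓡 d)) (𝓡 d) ∞
        (fun p : (Fin (n + 1) → ℝ) × M ↦ multiflow (Fin.tail ξ) (Fin.tail p.1) p.2) p :=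
      ContMDiffAt.comp (f := fun p : (Fin (n + 1) → ℝ) × M ↦ (Fin.tail p.1, p.2)) p hs htail
    have h0 : ContMDiffAt (𝓘(ℝ, Fin (n + 1) → ℝ).prod (𝓡 d)) 𝓘(ℝ, ℝ) ∞
        (fun p : (Fin (n + 1) → ℝ) × M ↦ p.1 0) p :=
      ((contDiff_apply ℝ ℝ (0 : Fin (n + 1))).contMDiff.contMDiffAt).comp p contMDiffAt_fst
    refine ⟨?_, contMDiffAt_flow_family h0 hs' hp2⟩
    refine Filter.inter_mem (htail.continuousAt hn) ?_
    exact (h0.continuousAt.prodMk hs'.continuousAt).preimage_mem_nhds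
      ((isOpen_flowDomain (ξ 0)).mem_nhds hp2)

theorem isOpen_timeDomain {n : ℕ} (ξ : Fin n → LocalVectorField d M) (m : M) :
    IsOpen (timeDomain ξ m) := by
  rw [isOpen_iff_mem_nhds]
  intro T hT
  exact (Continuous.prodMk_left m).continuousAt.preimage_mem_nhds
    (multiflowDomain_mem_nhds_and_contMDiffAt ξ hT).1

theorem contMDiffAt_multiflow_time {n : ℕ} (ξ : Fin n → LocalVectorField d M) {m : M}
    {T : Fin n → ℝ} (hT : T ∈ timeDomain ξ m) :
    ContMDiffAt 𝓘(ℝ, Fin n → ℝ) (𝓡 d) ∞ (fun T ↦ multiflow ξ T m) T :=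
  ContMDiffAt.comp (f := fun T : Fin n → ℝ ↦ (T, m)) T
    (multiflowDomain_mem_nhds_and_contMDiffAt ξ hT).2 (contMDiffAt_id.prodMk contMDiffAt_const)

theorem contMDiffAt_multiflow_point {n : ℕ} (ξ : Fin n → LocalVectorField d M) {m : M}
    {T : Fin n → ℝ} (hT : T ∈ timeDomain ξ m) :
    ContMDiffAt (𝓡 d) (𝓡 d) ∞ (multiflow ξ T) m :=
  ContMDiffAt.comp (f := fun x : M ↦ (T, x)) m
    (multiflowDomain_mem_nhds_and_contMDiffAt ξ hT).2 (contMDiffAt_const.prodMk contMDiffAt_id)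

/-- A tuple acts as a composition of single flows, so the chain rule reduces invariance to tuples of
length one. All later invariance checks are made flow by flow. -/
theorem Distribution.isInvariant_iff {Δ : Distribution d M} :
    Δ.IsInvariant D ↔ ∀ X ∈ D, ∀ (t : ℝ) (m : M), (t, m) ∈ flowDomain X →
      ∀ v ∈ Δ m, mfderiv (𝓡 d) (𝓡 d) (flow X t) m v ∈ Δ (flow X t m) := by
  constructor
  · intro h X hX t m ht v hv
    exact h (Word.single hX) (fun _ ↦ t) m ((Word.mem_timeDomain_single hX).2 ht) v hv
  · intro h w T m hT v hv
    suffices ∀ (n : ℕ) (ξ : Fin n → LocalVectorField d M), (∀ i, ξ i ∈ D) →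
        ∀ T : Fin n → ℝ, T ∈ timeDomain ξ m →
        mfderiv (𝓡 d) (𝓡 d) (multiflow ξ T) m v ∈ Δ (multiflow ξ T m) from
      this w.length w.fields (fun i ↦ (w.2 i).2) T hT
    intro n
    induction n with
    | zero =>
      intro ξ hξ T hT
      have : multiflow ξ T = id := rfl
      rw [this, mfderiv_id]
      exact hv
    | succ n ih =>
      intro ξ hξ T hT
      have h1 := ih (Fin.tail ξ) (fun i ↦ hξ i.succ) (Fin.tail T) hT.1
      have h2 := h (ξ 0) (hξ 0) (T 0) _ hT.2 _ h1
      have hd := (contMDiffAt_multiflow_point (Fin.tail ξ) (T := Fin.tail T) hT.1).mdifferentiableAt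
        (by simp)
      have hc := mfderiv_comp m ((contMDiffAt_flow_point hT.2).mdifferentiableAt (by simp)) hd
      have : multiflow ξ T = flow (ξ 0) (T 0) ∘ multiflow (Fin.tail ξ) (Fin.tail T) := rfl
      rw [this, hc]
      exact h2

theorem mfderiv_flow_mem_orbitDistribution (hX : X ∈ D) {t : ℝ} {m : M}
    (ht : (t, m) ∈ flowDomain X) {v : TangentSpace (𝓡 d) m} (hv : v ∈ orbitDistribution D m) :
    mfderiv (𝓡 d) (𝓡 d) (flow X t) m v ∈ orbitDistribution D (flow X t m) :=
  Distribution.isInvariant_iff.1 (orbitDistribution_isLeast D).1.1 X hX t m ht v hv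

theorem mem_orbitDistribution (hX : X ∈ D) {m : M} (hm : m ∈ X.domain) :
    X.toFun m ∈ orbitDistribution D m :=
  (orbitDistribution_isLeast D).1.2 m (Submodule.subset_span ⟨X, hX, hm, rfl⟩)

theorem orbitDistribution_le {Δ : Distribution d M} (hD : ∀ X ∈ D, ∀ m ∈ X.domain, X.toFun m ∈ Δ m)
    (hΔ : ∀ X ∈ D, ∀ (t : ℝ) (m : M), (t, m) ∈ flowDomain X →
      ∀ v ∈ Δ m, mfderiv (𝓡 d) (𝓡 d) (flow X t) m v ∈ Δ (flow X t m)) :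
    orbitDistribution D ≤ Δ := by
  refine (orbitDistribution_isLeast D).2 ⟨Distribution.isInvariant_iff.2 hΔ, fun m ↦ ?_⟩
  refine Submodule.span_le.2 ?_
  rintro _ ⟨X, hX, hm, rfl⟩
  exact hD X hX m hm

/-- The generators of `P_D`: values of members of `D`, moved by tangent maps of flows of `D`. -/
inductive Generator (D : Set (LocalVectorField d M)) : (x : M) → TangentSpace (𝓡 d) x → Prop
  | base {X : LocalVectorField d M} (hX : X ∈ D) {x : M} (hx : x ∈ X.domain) :
    Generator D x (X.toFun x)
  | push {X : LocalVectorField d M} (hX : X ∈ D) {t : ℝ} {x : M} (ht : (t, x) ∈ flowDomain X)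
    {v : TangentSpace (𝓡 d) x} (hv : Generator D x v) :
    Generator D (flow X t x) (mfderiv (𝓡 d) (𝓡 d) (flow X t) x v)

/-- The span of the generators contains `Δ_D` and is invariant by linearity, so minimality applies.
This makes it possible to choose a basis of `P_D(x)` whose members can be realized by motions inside
an orbit. -/
theorem orbitDistribution_eq_span_generator (x : M) :
    orbitDistribution D x = Submodule.span ℝ {v | Generator D x v} := by
  refine le_antisymm ?_ (Submodule.span_le.2 fun v hv ↦ ?_)
  · refine (orbitDistribution_le (Δ := fun x ↦ Submodule.span ℝ {v | Generator D x v}) ?_ ?_) x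
    · exact fun X hX m hm ↦ Submodule.subset_span (Generator.base hX hm)
    · intro X hX t m ht v hv
      have hle : Submodule.span ℝ {v | Generator D m v} ≤
          (Submodule.span ℝ {v | Generator D (flow X t m) v}).comap
            (mfderiv (𝓡 d) (𝓡 d) (flow X t) m).toLinearMap :=
        Submodule.span_le.2 fun v hv ↦ Submodule.subset_span (Generator.push hX ht hv)
      exact hle hv
  · induction hv with
    | base hX hx => exact mem_orbitDistribution hX hx
    | push hX ht _ ih => exact mfderiv_flow_mem_orbitDistribution hX ht ih

/-- The image of a vector field under the flow of another one. -/
def LocalVectorField.push (X Y : LocalVectorField d M) (t : ℝ) : LocalVectorField d M where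
  domain := ⟨{x | (-t, x) ∈ flowDomain X ∧ flow X (-t) x ∈ Y.domain}, by
    rw [isOpen_iff_mem_nhds]
    intro x hx
    exact Filter.inter_mem (eventually_mem_flowDomain hx.1)
      ((contMDiffAt_flow_point hx.1).continuousAt (Y.domain.isOpen.mem_nhds hx.2))⟩
  toFun := fun x ↦ mfderiv (𝓡 d) (𝓡 d) (flow X t) (flow X (-t) x) (Y.toFun (flow X (-t) x))
  smooth := by
    have hopen : IsOpen {x | (t, x) ∈ flowDomain X} :=
      isOpen_iff_mem_nhds.2 fun x hx ↦ eventually_mem_flowDomain hx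
    have h := contMDiffOn_mfderiv_apply hopen
      (f := flow X t) (fun x hx ↦ (contMDiffAt_flow_point hx).contMDiffWithinAt) Y.smooth
      (g := flow X (-t)) (t := {x | (-t, x) ∈ flowDomain X ∧ flow X (-t) x ∈ Y.domain})
      (fun x hx ↦ (contMDiffAt_flow_point hx.1).contMDiffWithinAt)
      (fun x hx ↦ by simpa using (flow_neg hx.1).1) (fun x hx ↦ hx.2)
    refine h.congr fun x hx ↦ ?_
    have hback : flow X t (flow X (-t) x) = x := by simpa using (flow_neg hx.1).2
    -- The base points agree only propositionally; since all tangent spaces are the same model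
    -- space, a generic `y` allows the substitution.
    have key : ∀ (y : M) (v : EuclideanSpace ℝ (Fin d)), y = x →
        (⟨x, v⟩ : TangentBundle (𝓡 d) M) = ⟨y, v⟩ := by
      rintro y v rfl
      rfl
    exact key _ _ hback

/-- A field in `P_D` pushed forward by a flow of `D` is again a field in `P_D`. Hence the span of
all such fields is an invariant distribution containing `Δ_D`, and minimality gives the nontrivial
inclusion; smoothness of `P_D` follows. -/
theorem orbitDistribution_eq_spanned_fields (D : Set (LocalVectorField d M)) :
    orbitDistribution D = spanned (orbitDistribution D).fields := by
  refine le_antisymm (orbitDistribution_le ?_ ?_) fun x ↦ Submodule.span_le.2 ?_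
  · exact fun X hX m hm ↦
      Submodule.subset_span ⟨X, fun m hm ↦ mem_orbitDistribution hX hm, hm, rfl⟩
  · intro X hX t m ht v hv
    have hle : spanned (orbitDistribution D).fields m ≤
        (spanned (orbitDistribution D).fields (flow X t m)).comap
          (mfderiv (𝓡 d) (𝓡 d) (flow X t) m).toLinearMap := by
      refine Submodule.span_le.2 ?_
      rintro _ ⟨Y, hY, hm, rfl⟩
      refine Submodule.subset_span ⟨X.push Y t, ?_, ?_, ?_⟩
      · rintro x ⟨hx, hxY⟩
        have h1 := mfderiv_flow_mem_orbitDistribution hX (t := t) (m := flow X (-t) x)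
          (by simpa using (flow_neg hx).1) (hY _ hxY)
        have hback : flow X t (flow X (-t) x) = x := by simpa using (flow_neg hx).2
        have key : ∀ (y : M) (v : EuclideanSpace ℝ (Fin d)), y = x →
            v ∈ (orbitDistribution D y : Submodule ℝ (EuclideanSpace ℝ (Fin d))) →
            v ∈ (orbitDistribution D x : Submodule ℝ (EuclideanSpace ℝ (Fin d))) := by
          rintro y v rfl h
          exact h
        exact key _ _ hback h1
      · refine ⟨(flow_neg ht).1, ?_⟩
        rw [(flow_neg ht).2]
        exact hm
      · change mfderiv (𝓡 d) (𝓡 d) (flow X t) (flow X (-t) (flow X t m))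
          (Y.toFun (flow X (-t) (flow X t m))) = _
        rw [(flow_neg ht).2]
        rfl
    exact hle hv
  · rintro _ ⟨X, hX, hm, rfl⟩
    exact hX x hm

theorem everywhereDefined_fields_orbitDistribution (hD : EverywhereDefined D) :
    EverywhereDefined (orbitDistribution D).fields := fun m ↦
  let ⟨X, hX, hm⟩ := hD m
  ⟨X, fun _ h ↦ mem_orbitDistribution hX h, hm⟩

theorem orbitDistribution_isSmooth (hD : EverywhereDefined D) :
    (orbitDistribution D).IsSmooth :=
  ⟨_, everywhereDefined_fields_orbitDistribution hD, orbitDistribution_eq_spanned_fields D⟩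

section Orbit

theorem orbit_induction {m : M} {Q : M → Prop} (h0 : Q m)
    (hQ : ∀ X ∈ D, ∀ (t : ℝ) (y : M), Q y → (t, y) ∈ flowDomain X → Q (flow X t y)) :
    ∀ x ∈ orbit D m, Q x := by
  rintro x ⟨w, T, hT, rfl⟩
  suffices ∀ (n : ℕ) (ξ : Fin n → LocalVectorField d M), (∀ i, ξ i ∈ D) →
      ∀ T : Fin n → ℝ, T ∈ timeDomain ξ m → Q (multiflow ξ T m) from
    this w.length w.fields (fun i ↦ (w.2 i).2) T hT
  intro n
  induction n with
  | zero => exact fun _ _ _ _ ↦ h0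
  | succ n ih =>
    exact fun ξ hξ T hT ↦
      hQ _ (hξ 0) _ _ (ih (Fin.tail ξ) (fun i ↦ hξ i.succ) (Fin.tail T) hT.1) hT.2

theorem flow_mem_orbit (hX : X ∈ D) {t : ℝ} {m y : M} (hy : y ∈ orbit D m)
    (ht : (t, y) ∈ flowDomain X) : flow X t y ∈ orbit D m := by
  obtain ⟨w, T, hT, rfl⟩ := hy
  exact ⟨Word.cons hX w, Fin.cons t T, (Word.mem_timeDomain_cons hX w).2 ⟨hT, ht⟩,
    Word.multiflow_cons hX w t T m⟩

/-- Tuples are non-empty, so a field defined at `m` is needed, run for time `0`. -/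
theorem mem_orbit_self (hD : EverywhereDefined D) (m : M) : m ∈ orbit D m := by
  obtain ⟨X, hX, hm⟩ := hD m
  exact ⟨Word.single hX, fun _ ↦ 0, (Word.mem_timeDomain_single hX).2 (flow_zero hm).1,
    (flow_zero hm).2⟩

theorem orbit_trans {m x y : M} (hx : x ∈ orbit D m) (hy : y ∈ orbit D x) : y ∈ orbit D m :=
  orbit_induction (Q := fun y ↦ y ∈ orbit D m) hx
    (fun _ hX _ _ hy ht ↦ flow_mem_orbit hX hy ht) y hy

theorem orbit_symm (hD : EverywhereDefined D) {m x : M} (hx : x ∈ orbit D m) : m ∈ orbit D x := by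
  refine orbit_induction (Q := fun x ↦ m ∈ orbit D x) (mem_orbit_self hD m) ?_ x hx
  intro X hX t y hy ht
  refine orbit_trans ?_ hy
  have := flow_mem_orbit hX (mem_orbit_self hD (flow X t y)) (flow_neg ht).1
  rwa [(flow_neg ht).2] at this

theorem orbit_eq (hD : EverywhereDefined D) {m x : M} (hx : x ∈ orbit D m) :
    orbit D x = orbit D m :=
  Subset.antisymm (fun _ hy ↦ orbit_trans hx hy) (fun _ hy ↦ orbit_trans (orbit_symm hD hx) hy)

instance (x : M) : FiniteDimensional ℝ (TangentSpace (𝓡 d) x) :=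
  inferInstanceAs (FiniteDimensional ℝ (EuclideanSpace ℝ (Fin d)))

/-- The tangent map of a flow is injective and preserves `P_D`. Applied to the reverse flow as well,
this gives equality of ranks. -/
theorem finrank_orbitDistribution_flow_le (hX : X ∈ D) {t : ℝ} {m : M}
    (ht : (t, m) ∈ flowDomain X) :
    Module.finrank ℝ (orbitDistribution D m) ≤
      Module.finrank ℝ (orbitDistribution D (flow X t m)) := by
  have hinj : Function.Injective (mfderiv (𝓡 d) (𝓡 d) (flow X t) m) := fun v w h ↦ by
    rw [← mfderiv_flow_neg_mfderiv_flow ht v, h, mfderiv_flow_neg_mfderiv_flow ht w]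
  refine LinearMap.finrank_le_finrank_of_injective
    (f := ((mfderiv (𝓡 d) (𝓡 d) (flow X t) m).toLinearMap.restrict
      (fun v hv ↦ mfderiv_flow_mem_orbitDistribution hX ht hv))) ?_
  intro v w h
  exact Subtype.ext (hinj (congrArg Subtype.val h))

theorem finrank_orbitDistribution_flow (hX : X ∈ D) {t : ℝ} {m : M}
    (ht : (t, m) ∈ flowDomain X) :
    Module.finrank ℝ (orbitDistribution D (flow X t m)) =
      Module.finrank ℝ (orbitDistribution D m) := by
  refine le_antisymm ?_ (finrank_orbitDistribution_flow_le hX ht)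
  have := finrank_orbitDistribution_flow_le hX (flow_neg ht).1
  rwa [(flow_neg ht).2] at this

/-- The rank of `P_D` is constant along an orbit. -/
theorem finrank_orbitDistribution_of_mem_orbit {m x : M} (hx : x ∈ orbit D m) :
    Module.finrank ℝ (orbitDistribution D x) = Module.finrank ℝ (orbitDistribution D m) :=
  orbit_induction (Q := fun x ↦ Module.finrank ℝ (orbitDistribution D x) =
    Module.finrank ℝ (orbitDistribution D m)) rfl
    (fun _ hX _ _ hy ht ↦ (finrank_orbitDistribution_flow hX ht).trans hy) x hx

end Orbit

end Words

/-! ### Immersions into a manifold, read in charts -/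

section ChartReading

variable {d : ℕ} {M : Type u} [TopologicalSpace M] [ChartedSpace (EuclideanSpace ℝ (Fin d)) M]
  [IsManifold (𝓡 d) ∞ M] {F : Type*} [NormedAddCommGroup F] [NormedSpace ℝ F]

local notation "𝔼" => EuclideanSpace ℝ (Fin d)

theorem injective_mfderiv_extChartAt (x₀ : M) {x : M} (hx : x ∈ (extChartAt (𝓡 d) x₀).source) :
    Function.Injective (mfderiv (𝓡 d) 𝓘(ℝ, 𝔼) (extChartAt (𝓡 d) x₀) x) := by
  obtain ⟨A, hA⟩ := isInvertible_mfderiv_extChartAt (I := 𝓡 d) hx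
  rw [← hA]
  exact A.injective

theorem fderiv_chart_comp (x₀ : M) {φ : F → M} {u : F}
    (hφ : MDifferentiableAt 𝓘(ℝ, F) (𝓡 d) φ u) (hu : φ u ∈ (extChartAt (𝓡 d) x₀).source) :
    fderiv ℝ (fun u ↦ extChartAt (𝓡 d) x₀ (φ u)) u =
      (mfderiv (𝓡 d) 𝓘(ℝ, 𝔼) (extChartAt (𝓡 d) x₀) (φ u)).comp
        (mfderiv 𝓘(ℝ, F) (𝓡 d) φ u) := by
  rw [← mfderiv_eq_fderiv]
  exact mfderiv_comp u (mdifferentiableAt_extChartAt (by rwa [extChartAt_source] at hu)) hφ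

theorem contDiffOn_chart_comp (x₀ : M) {φ : F → M} {U : Set F}
    (hφ : ContMDiffOn 𝓘(ℝ, F) (𝓡 d) ∞ φ U) :
    ContDiffOn ℝ ∞ (fun u ↦ extChartAt (𝓡 d) x₀ (φ u))
      (U ∩ φ ⁻¹' (extChartAt (𝓡 d) x₀).source) := by
  rw [← contMDiffOn_iff_contDiffOn]
  refine (contMDiffOn_extChartAt (n := ∞) (I := 𝓡 d) (x := x₀)).comp (hφ.mono inter_subset_left) ?_
  intro u hu
  rw [← extChartAt_source (𝓡 d)]
  exact hu.2

theorem isOpen_inter_preimage_source (x₀ : M) {φ : F → M} {U : Set F} (hU : IsOpen U)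
    (hφ : ContMDiffOn 𝓘(ℝ, F) (𝓡 d) ∞ φ U) :
    IsOpen (U ∩ φ ⁻¹' (extChartAt (𝓡 d) x₀).source) :=
  hφ.continuousOn.isOpen_inter_preimage hU (isOpen_extChartAt_source x₀)

variable [FiniteDimensional ℝ F]

/-- A smooth map from a vector space which is immersive at a point has a smooth local left inverse
there. -/
theorem exists_left_inverse_of_immersion {φ : F → M} {U : Set F} (hU : IsOpen U)
    (hφ : ContMDiffOn 𝓘(ℝ, F) (𝓡 d) ∞ φ U) {u₀ : F} (hu₀ : u₀ ∈ U)
    (hinj : Function.Injective (mfderiv 𝓘(ℝ, F) (𝓡 d) φ u₀)) :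
    ∃ r : M → F, ContMDiffAt (𝓡 d) 𝓘(ℝ, F) ∞ r (φ u₀) ∧ ∀ᶠ u in 𝓝 u₀, r (φ u) = u := by
  have hsrc : φ u₀ ∈ (extChartAt (𝓡 d) (φ u₀)).source := mem_extChartAt_source (φ u₀)
  have hd : MDifferentiableAt 𝓘(ℝ, F) (𝓡 d) φ u₀ :=
    (hφ.contMDiffAt (hU.mem_nhds hu₀)).mdifferentiableAt (by simp)
  obtain ⟨r, hr, hru⟩ := exists_local_left_inverse (isOpen_inter_preimage_source (φ u₀) hU hφ)
    (contDiffOn_chart_comp (φ u₀) hφ) (u₀ := u₀) ⟨hu₀, hsrc⟩ (by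
      rw [fderiv_chart_comp _ hd hsrc]
      exact (injective_mfderiv_extChartAt (φ u₀) hsrc).comp hinj)
  exact ⟨fun x ↦ r (extChartAt (𝓡 d) (φ u₀) x),
    hr.contMDiffAt.comp (φ u₀) (contMDiffAt_extChartAt), hru⟩

/-- Immersive points of a smooth map form an open set. -/
theorem eventually_injective_mfderiv {φ : F → M} {U : Set F} (hU : IsOpen U)
    (hφ : ContMDiffOn 𝓘(ℝ, F) (𝓡 d) ∞ φ U) {u₀ : F} (hu₀ : u₀ ∈ U)
    (hinj : Function.Injective (mfderiv 𝓘(ℝ, F) (𝓡 d) φ u₀)) :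
    ∀ᶠ u in 𝓝 u₀, Function.Injective (mfderiv 𝓘(ℝ, F) (𝓡 d) φ u) := by
  have hd : ∀ u ∈ U, MDifferentiableAt 𝓘(ℝ, F) (𝓡 d) φ u := fun u hu ↦
    (hφ.contMDiffAt (hU.mem_nhds hu)).mdifferentiableAt (by simp)
  have hsrc : φ u₀ ∈ (extChartAt (𝓡 d) (φ u₀)).source := mem_extChartAt_source (φ u₀)
  have hopen := isOpen_inter_preimage_source (φ u₀) hU hφ
  have hmem : u₀ ∈ U ∩ φ ⁻¹' (extChartAt (𝓡 d) (φ u₀)).source := ⟨hu₀, hsrc⟩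
  have hc := ((contDiffOn_chart_comp (φ u₀) hφ).continuousOn_fderiv_of_isOpen hopen
    (by simp)).continuousAt (hopen.mem_nhds hmem)
  obtain ⟨κ, hκ, hev⟩ := eventually_norm_le_of_injective hc (by
    rw [fderiv_chart_comp _ (hd _ hu₀) hsrc]
    exact (injective_mfderiv_extChartAt (φ u₀) hsrc).comp hinj)
  filter_upwards [hev, hopen.mem_nhds hmem] with u hu hmu
  have hinj' : Function.Injective (fderiv ℝ (fun u ↦ extChartAt (𝓡 d) (φ u₀) (φ u)) u) := by
    rw [injective_iff_map_eq_zero]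
    intro ζ hζ
    have := hu ζ
    rw [hζ, norm_zero, mul_zero] at this
    exact norm_le_zero_iff.1 this
  rw [fderiv_chart_comp _ (hd _ hmu.1) hmu.2] at hinj'
  exact Function.Injective.of_comp hinj'

end ChartReading

/-! ### Smooth families of points inside an orbit -/

section Plaques

variable {d : ℕ} {M : Type u} [TopologicalSpace M] [ChartedSpace (EuclideanSpace ℝ (Fin d)) M]
  [IsManifold (𝓡 d) ∞ M] [T2Space M] {D : Set (LocalVectorField d M)} {X : LocalVectorField d M}
  {F : Type*} [NormedAddCommGroup F] [NormedSpace ℝ F]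

local notation "𝔼" => EuclideanSpace ℝ (Fin d)

/-- A family of points of the orbit of `m` of the form `ξ_{A(u)} (m)`, with `A` smooth. -/
def IsOrbitFamily (D : Set (LocalVectorField d M)) (m : M) (W : Set F) (φ : F → M) : Prop :=
  ∃ (w : Word D) (A : F → Fin w.length → ℝ), ContDiffOn ℝ ∞ A W ∧
    ∀ u ∈ W, A u ∈ timeDomain w.fields m ∧ multiflow w.fields (A u) m = φ u

/-- Varying the outermost time gives a value of a member of `D`; varying an inner time gives a
vector in `P_D` transported by the outer flow. Both remain in `P_D`. -/
theorem mfderiv_multiflow_time_mem {n : ℕ} (ξ : Fin n → LocalVectorField d M) (hξ : ∀ i, ξ i ∈ D)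
    {m : M} {T : Fin n → ℝ} (hT : T ∈ timeDomain ξ m) (a : Fin n → ℝ) :
    mfderiv 𝓘(ℝ, Fin n → ℝ) (𝓡 d) (fun T ↦ multiflow ξ T m) T a ∈
      orbitDistribution D (multiflow ξ T m) := by
  induction n with
  | zero =>
    have : (fun T : Fin 0 → ℝ ↦ multiflow ξ T m) = fun _ ↦ m := rfl
    rw [this, mfderiv_const]
    exact Submodule.zero_mem _
  | succ n ih =>
    obtain ⟨hT1, hT2⟩ := hT
    have h1 := ih (Fin.tail ξ) (fun i ↦ hξ i.succ) hT1
    have hm := ((contMDiffAt_multiflow_time (Fin.tail ξ) hT1).mdifferentiableAt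
      (by simp)).hasMFDerivAt
    have htail := ((contMDiff_tail n).contMDiffAt (x := T)).mdifferentiableAt (by simp)
    have hm' := HasMFDerivAt.comp (g := fun T ↦ multiflow (Fin.tail ξ) T m)
      (f := fun T : Fin (n + 1) → ℝ ↦ (Fin.tail T : Fin n → ℝ)) T hm htail.hasMFDerivAt
    have h0 : HasMFDerivAt 𝓘(ℝ, Fin (n + 1) → ℝ) 𝓘(ℝ, ℝ) (fun T : Fin (n + 1) → ℝ ↦ T 0) T
        (ContinuousLinearMap.proj (R := ℝ) (φ := fun _ : Fin (n + 1) ↦ ℝ) 0) :=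
      (ContinuousLinearMap.proj (R := ℝ) (φ := fun _ : Fin (n + 1) ↦ ℝ) 0).hasFDerivAt.hasMFDerivAt
    have hfl := hasMFDerivAt_flow_family (X := ξ 0) h0 hm' hT2
    have heq : (fun T ↦ multiflow ξ T m) = fun T : Fin (n + 1) → ℝ ↦ flow (ξ 0) (T 0)
      (((fun T ↦ multiflow (Fin.tail ξ) T m) ∘
        (fun T : Fin (n + 1) → ℝ ↦ (Fin.tail T : Fin n → ℝ))) T) := rfl
    rw [heq, hfl.mfderiv]
    refine Submodule.add_mem _ (Submodule.smul_mem _ _ ?_) ?_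
    · exact mem_orbitDistribution (hξ 0) (flow_mem_domain hT2)
    · exact mfderiv_flow_mem_orbitDistribution (hξ 0) hT2 (h1 _)

namespace IsOrbitFamily

variable {m : M} {W : Set F} {φ : F → M}

theorem const {x : M} (hx : x ∈ orbit D m) (W : Set F) : IsOrbitFamily D m W (fun _ ↦ x) := by
  obtain ⟨w, T, hT, rfl⟩ := hx
  exact ⟨w, fun _ ↦ T, contDiffOn_const, fun _ _ ↦ ⟨hT, rfl⟩⟩

theorem mono (h : IsOrbitFamily D m W φ) {W' : Set F} (hW : W' ⊆ W) : IsOrbitFamily D m W' φ := by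
  obtain ⟨w, A, hA, hφ⟩ := h
  exact ⟨w, A, hA.mono hW, fun u hu ↦ hφ u (hW hu)⟩

theorem mem_orbit (h : IsOrbitFamily D m W φ) {u : F} (hu : u ∈ W) : φ u ∈ orbit D m := by
  obtain ⟨w, A, hA, hφ⟩ := h
  exact ⟨w, A u, hφ u hu⟩

theorem flow (h : IsOrbitFamily D m W φ) (hX : X ∈ D) {τ : F → ℝ} (hτ : ContDiffOn ℝ ∞ τ W)
    (hdom : ∀ u ∈ W, (τ u, φ u) ∈ flowDomain X) :
    IsOrbitFamily D m W (fun u ↦ Sussmann.flow X (τ u) (φ u)) := by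
  obtain ⟨w, A, hA, hφ⟩ := h
  refine ⟨Word.cons hX w, fun u ↦ (Fin.cons (τ u) (A u) : Fin (w.length + 1) → ℝ), ?_, ?_⟩
  · refine contDiffOn_pi.2 fun i ↦ ?_
    refine Fin.cases ?_ (fun j ↦ ?_) i
    · exact hτ
    · exact contDiffOn_pi.1 hA j
  · intro u hu
    refine ⟨(Word.mem_timeDomain_cons hX w).2 ⟨(hφ u hu).1, ?_⟩, ?_⟩
    · rw [(hφ u hu).2]
      exact hdom u hu
    · refine (Word.multiflow_cons hX w _ _ m).trans ?_
      rw [(hφ u hu).2]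

theorem contMDiffOn (h : IsOrbitFamily D m W φ) :
    ContMDiffOn 𝓘(ℝ, F) (𝓡 d) ∞ φ W := by
  obtain ⟨w, A, hA, hφ⟩ := h
  have hs : ContMDiffOn 𝓘(ℝ, Fin w.length → ℝ) (𝓡 d) ∞ (fun T ↦ multiflow w.fields T m)
      (timeDomain w.fields m) := fun T hT ↦
    (contMDiffAt_multiflow_time w.fields hT).contMDiffWithinAt
  exact (hs.comp hA.contMDiffOn fun u hu ↦ (hφ u hu).1).congr fun u hu ↦ (hφ u hu).2.symm

theorem mfderiv_mem (h : IsOrbitFamily D m W φ) (hW : IsOpen W) {u : F} (hu : u ∈ W)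
    (ζ : TangentSpace 𝓘(ℝ, F) u) :
    mfderiv 𝓘(ℝ, F) (𝓡 d) φ u ζ ∈ orbitDistribution D (φ u) := by
  obtain ⟨w, A, hA, hφ⟩ := h
  have h1 := ((contMDiffAt_multiflow_time w.fields (hφ u hu).1).mdifferentiableAt
      (by simp)).hasMFDerivAt
  have h2 : HasMFDerivAt 𝓘(ℝ, F) 𝓘(ℝ, Fin w.length → ℝ) A u (fderiv ℝ A u) :=
    ((hA.contDiffAt (hW.mem_nhds hu)).differentiableAt (by simp)).hasFDerivAt.hasMFDerivAt
  have h3 := h1.comp u h2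
  have heq : φ =ᶠ[𝓝 u] (fun T ↦ multiflow w.fields T m) ∘ A := by
    filter_upwards [hW.mem_nhds hu] with u' hu'
    exact (hφ u' hu').2.symm
  rw [(h3.congr_of_eventuallyEq heq).mfderiv, ← (hφ u hu).2]
  exact mfderiv_multiflow_time_mem w.fields (fun i ↦ (w.2 i).2) (hφ u hu).1 _

end IsOrbitFamily

theorem mfderiv_flow_mfderiv_flow_neg {t : ℝ} {m : M} (h : (t, m) ∈ flowDomain X)
    (v : TangentSpace (𝓡 d) (flow X t m)) :
    mfderiv (𝓡 d) (𝓡 d) (flow X t) m (mfderiv (𝓡 d) (𝓡 d) (flow X (-t)) (flow X t m) v) = v := by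
  have := mfderiv_flow_neg_mfderiv_flow (flow_neg h).1 v
  rw [neg_neg, (flow_neg h).2] at this
  exact this

/-- An orbit family through `x` can be modified so that its derivative there changes by a rank one
map with image spanned by a given generator of `P_D`. -/
theorem Generator.exists_family {m x : M} {v : TangentSpace (𝓡 d) x} (hv : Generator D x v)
    (ℓ : F →L[ℝ] ℝ) (W : Set F) (hW : IsOpen W) (h0 : 0 ∈ W) (φ : F → M)
    (hφ : IsOrbitFamily D m W φ) (hφ0 : φ 0 = x) (L : F →L[ℝ] 𝔼)
    (hL : HasMFDerivAt 𝓘(ℝ, F) (𝓡 d) φ 0 L) :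
    ∃ (W' : Set F) (φ' : F → M), IsOpen W' ∧ 0 ∈ W' ∧ IsOrbitFamily D m W' φ' ∧ φ' 0 = x ∧
      HasMFDerivAt 𝓘(ℝ, F) (𝓡 d) φ' 0 (L + ℓ.smulRight (M₂ := 𝔼) v) := by
  induction hv generalizing W φ L with
  | @base X hX x hx =>
    subst hφ0
    have hdom : (ℓ 0, φ 0) ∈ flowDomain X := by rw [map_zero]; exact (flow_zero hx).1
    have hcont : ContinuousOn (fun u ↦ (ℓ u, φ u)) W :=
      ℓ.continuous.continuousOn.prodMk hφ.contMDiffOn.continuousOn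
    refine ⟨W ∩ (fun u ↦ (ℓ u, φ u)) ⁻¹' flowDomain X, fun u ↦ flow X (ℓ u) (φ u),
      hcont.isOpen_inter_preimage hW (isOpen_flowDomain X), ⟨h0, hdom⟩,
      (hφ.mono inter_subset_left).flow hX ℓ.contDiff.contDiffOn (fun u hu ↦ hu.2),
      by simpa using (flow_zero hx).2, ?_⟩
    have hℓ : HasMFDerivAt 𝓘(ℝ, F) 𝓘(ℝ, ℝ) ℓ 0 ℓ := ℓ.hasFDerivAt.hasMFDerivAt
    refine (hasMFDerivAt_flow_family hℓ hL hdom).congr_mfderiv ?_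
    refine ContinuousLinearMap.ext fun (ζ : F) ↦ ?_
    -- At the parameter `0` the flow time is `ℓ 0 = 0` and the flow is the identity near `φ 0`, so
    -- moving by `X` only adds the term `ℓ ⊗ X` to the derivative.
    have hflow0 : HasMFDerivAt (𝓡 d) (𝓡 d) (flow X (ℓ 0)) (φ 0)
        (ContinuousLinearMap.id ℝ (TangentSpace (𝓡 d) (φ 0))) := by
      refine (hasMFDerivAt_id (φ 0)).congr_of_eventuallyEq ?_
      filter_upwards [X.domain.isOpen.mem_nhds hx] with y hy
      rw [map_zero]
      exact (flow_zero hy).2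
    have e1 : X.toFun (flow X (ℓ 0) (φ 0)) = (X.toFun (φ 0) : 𝔼) := by
      rw [map_zero, (flow_zero hx).2]
    have e2 : mfderiv (𝓡 d) (𝓡 d) (flow X (ℓ 0)) (φ 0) (L ζ) = (L ζ : 𝔼) :=
      DFunLike.congr_fun hflow0.mfderiv (L ζ)
    refine (congrArg₂ (fun a b : 𝔼 ↦ ℓ ζ • a + b) e1 e2).trans (add_comm _ _)
  -- Conjugation: move the family back by `Fl_{-t}`, modify it there by the induction hypothesis,
  -- and move it forward by `Fl_t`. The two tangent maps cancel on `L` and send the added vector to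
  -- the pushed generator.
  | @push X hX t x ht v hv ih =>
    have hdom : (-t, φ 0) ∈ flowDomain X := by rw [hφ0]; exact (flow_neg ht).1
    have hcont : ContinuousOn (fun u ↦ (-t, φ u)) W :=
      continuousOn_const.prodMk hφ.contMDiffOn.continuousOn
    have hφ1 : IsOrbitFamily D m (W ∩ (fun u ↦ (-t, φ u)) ⁻¹' flowDomain X)
        (fun u ↦ flow X (-t) (φ u)) :=
      (hφ.mono inter_subset_left).flow hX contDiffOn_const (fun u hu ↦ hu.2)
    have hd1 : HasMFDerivAt (𝓡 d) (𝓡 d) (flow X (-t)) (φ 0)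
        (mfderiv (𝓡 d) (𝓡 d) (flow X (-t)) (φ 0)) :=
      ((contMDiffAt_flow_point hdom).mdifferentiableAt (by simp)).hasMFDerivAt
    obtain ⟨W', φ', hW', h0', hφ', hφ0', hd'⟩ := ih _
      (hcont.isOpen_inter_preimage hW (isOpen_flowDomain X)) ⟨h0, hdom⟩ _ hφ1
      (by rw [hφ0]; exact (flow_neg ht).2) _ (hd1.comp 0 hL)
    subst hφ0'
    have hcont' : ContinuousOn (fun u ↦ (t, φ' u)) W' :=
      continuousOn_const.prodMk hφ'.contMDiffOn.continuousOn
    refine ⟨W' ∩ (fun u ↦ (t, φ' u)) ⁻¹' flowDomain X, fun u ↦ flow X t (φ' u),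
      hcont'.isOpen_inter_preimage hW' (isOpen_flowDomain X), ⟨h0', ht⟩,
      (hφ'.mono inter_subset_left).flow hX contDiffOn_const (fun u hu ↦ hu.2), rfl, ?_⟩
    have hd2 := ((contMDiffAt_flow_point ht).mdifferentiableAt (by simp)).hasMFDerivAt
    refine (hd2.comp 0 hd').congr_mfderiv ?_
    refine ContinuousLinearMap.ext fun (ζ : F) ↦ ?_
    let B : 𝔼 →L[ℝ] 𝔼 := mfderiv (𝓡 d) (𝓡 d) (flow X t) (φ' 0)
    have e1 : B (mfderiv (𝓡 d) (𝓡 d) (flow X (-t)) (φ 0) (L ζ) : 𝔼) = L ζ := by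
      rw [hφ0]
      exact mfderiv_flow_mfderiv_flow_neg ht _
    refine (B.map_add _ _).trans ?_
    exact congrArg₂ (fun a b : 𝔼 ↦ a + b) e1 (B.map_smul _ _)

end Plaques

/-! ### Parametrized integral manifolds and factorization through them -/

section Plaques

variable {d : ℕ} {M : Type u} [TopologicalSpace M] [ChartedSpace (EuclideanSpace ℝ (Fin d)) M]
  [IsManifold (𝓡 d) ∞ M] {F : Type*} [NormedAddCommGroup F] [NormedSpace ℝ F]

local notation "𝔼" => EuclideanSpace ℝ (Fin d)

/-- A parametrized integral manifold of `Δ`. -/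
structure IsPlaque (Δ : Distribution d M) (U : Set F) (φ : F → M) : Prop where
  isOpen : IsOpen U
  contMDiffOn : ContMDiffOn 𝓘(ℝ, F) (𝓡 d) ∞ φ U
  injective : ∀ u ∈ U, Function.Injective (mfderiv 𝓘(ℝ, F) (𝓡 d) φ u)
  range_eq : ∀ u ∈ U, (mfderiv 𝓘(ℝ, F) (𝓡 d) φ u).range = Δ (φ u)

theorem IsPlaque.mdifferentiableAt {Δ : Distribution d M} {U : Set F} {φ : F → M}
    (h : IsPlaque Δ U φ) {u : F} (hu : u ∈ U) : MDifferentiableAt 𝓘(ℝ, F) (𝓡 d) φ u :=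
  (h.contMDiffOn.contMDiffAt (h.isOpen.mem_nhds hu)).mdifferentiableAt (by simp)

theorem IsPlaque.finrank_eq {Δ : Distribution d M} {U : Set F} {φ : F → M}
    (h : IsPlaque Δ U φ) {u : F} (hu : u ∈ U) :
    Module.finrank ℝ (Δ (φ u)) = Module.finrank ℝ F := by
  rw [← h.range_eq u hu]
  exact LinearMap.finrank_range_of_inj (h.injective u hu)

variable [FiniteDimensional ℝ F]

/-- A smooth distribution has a smooth frame near a point, in the chart around this point. It spans
the distribution at the points where the rank is the same. -/
theorem Distribution.IsSmooth.exists_frame {Δ : Distribution d M} (hΔ : Δ.IsSmooth) (x₀ : M)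
    (hF : Module.finrank ℝ (Δ x₀) = Module.finrank ℝ F) :
    ∃ Y : 𝔼 → F →L[ℝ] 𝔼, ContDiffAt ℝ ∞ Y (extChartAt (𝓡 d) x₀ x₀) ∧
      ∀ᶠ x in 𝓝 x₀, Module.finrank ℝ (Δ x) = Module.finrank ℝ F →
        LinearMap.range (Y (extChartAt (𝓡 d) x₀ x)).toLinearMap =
          (Δ x).map (mfderiv (𝓡 d) 𝓘(ℝ, 𝔼) (extChartAt (𝓡 d) x₀) x).toLinearMap := by
  obtain ⟨D, -, rfl⟩ := hΔ
  set ψ := extChartAt (𝓡 d) x₀ with hψ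
  -- Choose members of `D` whose values at `x₀` form a basis; they remain independent nearby and
  -- constitute the frame.
  obtain ⟨f, hf, -, hind⟩ : ∃ f : Fin (Module.finrank ℝ F) → TangentSpace (𝓡 d) x₀,
      (∀ i, f i ∈ {v | ∃ X ∈ D, x₀ ∈ X.domain ∧ X.toFun x₀ = v}) ∧
      Submodule.span ℝ (range f) =
        Submodule.span ℝ {v | ∃ X ∈ D, x₀ ∈ X.domain ∧ X.toFun x₀ = v} ∧
      LinearIndependent ℝ f := by
    rw [← hF]
    exact Submodule.exists_fun_fin_finrank_span_eq ℝ _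
  choose X hXD hXx hXf using hf
  let b := Module.finBasis ℝ F
  let Y : 𝔼 → F →L[ℝ] 𝔼 := fun e ↦ ∑ i, ContinuousLinearMap.smulRightL ℝ F 𝔼
    (LinearMap.toContinuousLinearMap (b.coord i)) (chartField x₀ (X i).toFun e)
  have hYapp : ∀ e ζ, Y e ζ = ∑ i, b.coord i ζ • chartField x₀ (X i).toFun e := by
    intro e ζ
    simp [Y]
  have hψx₀ : ψ.symm (ψ x₀) = x₀ := extChartAt_to_inv x₀
  have hY : ContDiffAt ℝ ∞ Y (ψ x₀) := by
    refine ContDiffAt.sum fun i _ ↦ (ContinuousLinearMap.contDiff _).contDiffAt.comp _ ?_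
    refine ((X i).contDiffOn_chartField x₀).contDiffAt
      ((isOpen_chart_preimage x₀ (X i).domain.isOpen).mem_nhds ⟨mem_extChartAt_target x₀, ?_⟩)
    rw [mem_preimage, extChartAt_to_inv]
    exact hXx i
  have hYinj : Function.Injective (Y (ψ x₀)) := by
    rw [injective_iff_map_eq_zero]
    intro ζ hζ
    let B : 𝔼 →L[ℝ] 𝔼 := mfderiv (𝓡 d) 𝓘(ℝ, 𝔼) ψ x₀
    let f' : Fin (Module.finrank ℝ F) → 𝔼 := f
    have hcf : ∀ i, chartField x₀ (X i).toFun (ψ x₀) = B (f' i) := by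
      intro i
      refine Eq.trans ?_ (congrArg B (hXf i))
      change mfderiv (𝓡 d) 𝓘(ℝ, 𝔼) ψ (ψ.symm (ψ x₀)) ((X i).toFun (ψ.symm (ψ x₀))) = _
      rw [hψx₀]
      rfl
    have h1 : B (∑ i, b.coord i ζ • f' i) = 0 := by
      rw [map_sum, ← hζ, hYapp]
      refine Finset.sum_congr rfl fun i _ ↦ ?_
      rw [hcf, map_smul]
    have h2 : (∑ i, b.coord i ζ • f' i) = 0 :=
      injective_mfderiv_extChartAt x₀ (mem_extChartAt_source x₀) (h1.trans (map_zero B).symm)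
    have h3 := Fintype.linearIndependent_iff.1 hind (fun i ↦ b.coord i ζ) h2
    exact b.ext_elem fun i ↦ by simpa using h3 i
  obtain ⟨κ, -, hev⟩ := eventually_norm_le_of_injective hY.continuousAt hYinj
  refine ⟨Y, hY, ?_⟩
  have hcont : ContinuousAt ψ x₀ := continuousAt_extChartAt x₀
  filter_upwards [hcont.eventually hev, extChartAt_source_mem_nhds (I := 𝓡 d) x₀,
    Filter.eventually_all.2 fun i ↦ (X i).domain.isOpen.mem_nhds (hXx i)] with x hx hxs hxX hfin
  have hinjx : Function.Injective (Y (ψ x)) := by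
    rw [injective_iff_map_eq_zero]
    intro ζ hζ
    have := hx ζ
    rw [hζ, norm_zero, mul_zero] at this
    exact norm_le_zero_iff.1 this
  have hfd (Q : Submodule ℝ 𝔼) : FiniteDimensional ℝ Q := inferInstance
  -- The frame always lies in the distribution. It can miss part of it where the rank jumps up,
  -- which `hfin` excludes.
  refine @Submodule.eq_of_le_of_finrank_eq ℝ 𝔼 _ _ _ _ _ (hfd _) ?_ ?_
  · rintro _ ⟨ζ, rfl⟩
    change Y (ψ x) ζ ∈ _
    rw [hYapp]
    refine Submodule.sum_mem _ fun i _ ↦ Submodule.smul_mem _ _ ?_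
    refine ⟨(X i).toFun x, Submodule.subset_span ⟨X i, hXD i, hxX i, rfl⟩, ?_⟩
    change _ = mfderiv (𝓡 d) 𝓘(ℝ, 𝔼) ψ (ψ.symm (ψ x)) ((X i).toFun (ψ.symm (ψ x)))
    rw [ψ.left_inv hxs]
    rfl
  · rw [LinearMap.finrank_range_of_inj hinjx]
    refine hfin.symm.trans ?_
    exact ((Submodule.equivMapOfInjective _ (injective_mfderiv_extChartAt x₀ hxs) _).finrank_eq)

theorem range_fderiv_chart_comp {G : Type*} [NormedAddCommGroup G] [NormedSpace ℝ G] (x₀ : M)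
    {φ : G → M} {u : G} (hφ : MDifferentiableAt 𝓘(ℝ, G) (𝓡 d) φ u)
    (hu : φ u ∈ (extChartAt (𝓡 d) x₀).source) :
    LinearMap.range (fderiv ℝ (fun u ↦ extChartAt (𝓡 d) x₀ (φ u)) u).toLinearMap =
      (mfderiv 𝓘(ℝ, G) (𝓡 d) φ u).range.map
        (mfderiv (𝓡 d) 𝓘(ℝ, 𝔼) (extChartAt (𝓡 d) x₀) (φ u)).toLinearMap := by
  rw [fderiv_chart_comp x₀ hφ hu]
  exact LinearMap.range_comp _ _

/-- A map from a vector space which is tangent to a smooth distribution, at whose points the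
distribution has the dimension of a given plaque, factors locally through the plaque. -/
theorem IsPlaque.exists_factorization_vectorSpace {Δ : Distribution d M} (hΔ : Δ.IsSmooth)
    {U : Set F} {φ : F → M} (hφ : IsPlaque Δ U φ) {u₀ : F} (hu₀ : u₀ ∈ U)
    {G : Type*} [NormedAddCommGroup G] [NormedSpace ℝ G] {g : G → M} {V : Set G} (hV : IsOpen V)
    (hg : ContMDiffOn 𝓘(ℝ, G) (𝓡 d) ∞ g V) {v₀ : G} (hv₀ : v₀ ∈ V) (hgφ : g v₀ = φ u₀)
    (hgΔ : ∀ v ∈ V, (mfderiv 𝓘(ℝ, G) (𝓡 d) g v).range ≤ Δ (g v))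
    (hrank : ∀ v ∈ V, Module.finrank ℝ (Δ (g v)) = Module.finrank ℝ F) :
    ∃ (h : G → F) (W : Set G), IsOpen W ∧ v₀ ∈ W ∧ W ⊆ V ∧ ContDiffOn ℝ ∞ h W ∧ h v₀ = u₀ ∧
      ∀ v ∈ W, h v ∈ U ∧ g v = φ (h v) := by
  have hrank₀ := hφ.finrank_eq hu₀
  set x₀ := φ u₀ with hx₀
  obtain ⟨Y, hY, hYΔ⟩ := hΔ.exists_frame x₀ hrank₀
  have hsrc : φ u₀ ∈ (extChartAt (𝓡 d) x₀).source := mem_extChartAt_source x₀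
  have hU' := isOpen_inter_preimage_source x₀ hφ.isOpen hφ.contMDiffOn
  have hV' := isOpen_inter_preimage_source x₀ hV hg
  have hφc : ContinuousAt φ u₀ :=
    hφ.contMDiffOn.continuousOn.continuousAt (hφ.isOpen.mem_nhds hu₀)
  have hgc : ContinuousAt g v₀ := hg.continuousOn.continuousAt (hV.mem_nhds hv₀)
  obtain ⟨h, W, hW, hvW, hWV, hh, hh0, hfac⟩ := exists_factorization hU'
    (contDiffOn_chart_comp x₀ hφ.contMDiffOn) ⟨hu₀, hsrc⟩
    (by
      rw [fderiv_chart_comp _ (hφ.mdifferentiableAt hu₀) hsrc]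
      exact (injective_mfderiv_extChartAt x₀ hsrc).comp (hφ.injective u₀ hu₀))
    (hY.of_le (by simp))
    (by
      filter_upwards [hφc.eventually hYΔ, hU'.mem_nhds ⟨hu₀, hsrc⟩] with u hu hmu
      rw [hu (hφ.finrank_eq hmu.1),
        range_fderiv_chart_comp x₀ (hφ.mdifferentiableAt hmu.1) hmu.2, hφ.range_eq u hmu.1])
    hV' (contDiffOn_chart_comp x₀ hg) (v₀ := v₀) ⟨hv₀, by rw [mem_preimage, hgφ]; exact hsrc⟩
    (by rw [hgφ])
    (by
      have hgc' : Filter.Tendsto g (𝓝 v₀) (𝓝 x₀) := by rw [← hgφ]; exact hgc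
      filter_upwards [hgc'.eventually hYΔ,
        hV'.mem_nhds ⟨hv₀, by rw [mem_preimage, hgφ]; exact hsrc⟩] with v hv hmv
      rw [hv (hrank v hmv.1), range_fderiv_chart_comp x₀
        ((hg.contMDiffAt (hV.mem_nhds hmv.1)).mdifferentiableAt (by simp)) hmv.2]
      exact Submodule.map_mono (hgΔ v hmv.1))
  refine ⟨h, W, hW, hvW, fun v hv ↦ (hWV hv).1, hh, hh0, fun v hv ↦ ⟨(hfac v hv).1.1, ?_⟩⟩
  exact (extChartAt (𝓡 d) x₀).injOn (hWV hv).2 (hfac v hv).1.2 (hfac v hv).2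

/-- A map which is tangent to a smooth distribution, at whose points the distribution has the
dimension of a given plaque, factors locally through the plaque. -/
theorem IsPlaque.exists_factorization {Δ : Distribution d M} (hΔ : Δ.IsSmooth)
    {U : Set F} {φ : F → M} (hφ : IsPlaque Δ U φ) {u₀ : F} (hu₀ : u₀ ∈ U)
    {E H : Type*} [NormedAddCommGroup E] [NormedSpace ℝ E] [TopologicalSpace H]
    {I : ModelWithCorners ℝ E H} [I.Boundaryless] {P : Type*} [TopologicalSpace P]
    [ChartedSpace H P] [IsManifold I ∞ P] {g : P → M} {V : Set P} (hV : IsOpen V)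
    (hg : ContMDiffOn I (𝓡 d) ∞ g V) {v₀ : P} (hv₀ : v₀ ∈ V) (hgφ : g v₀ = φ u₀)
    (hgΔ : ∀ v ∈ V, (mfderiv I (𝓡 d) g v).range ≤ Δ (g v))
    (hrank : ∀ v ∈ V, Module.finrank ℝ (Δ (g v)) = Module.finrank ℝ F) :
    ∃ (h : P → F) (W : Set P), IsOpen W ∧ v₀ ∈ W ∧ W ⊆ V ∧ ContMDiffOn I 𝓘(ℝ, F) ∞ h W ∧
      h v₀ = u₀ ∧ ∀ v ∈ W, h v ∈ U ∧ g v = φ (h v) := by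
  set θ := extChartAt I v₀ with hθ
  have hV' : IsOpen (θ.target ∩ θ.symm ⁻¹' V) :=
    (continuousOn_extChartAt_symm v₀).isOpen_inter_preimage (isOpen_extChartAt_target v₀) hV
  have hsm : ContMDiffOn 𝓘(ℝ, E) I ∞ θ.symm θ.target := contMDiffOn_extChartAt_symm v₀
  have hg' : ContMDiffOn 𝓘(ℝ, E) (𝓡 d) ∞ (g ∘ θ.symm) (θ.target ∩ θ.symm ⁻¹' V) :=
    hg.comp (hsm.mono inter_subset_left) (fun e he ↦ he.2)
  have hback : θ.symm (θ v₀) = v₀ := extChartAt_to_inv v₀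
  obtain ⟨h, W, hW, hvW, hWV, hh, hh0, hfac⟩ := hφ.exists_factorization_vectorSpace hΔ hu₀ hV' hg'
    (v₀ := θ v₀) ⟨mem_extChartAt_target v₀, by rw [mem_preimage, hback]; exact hv₀⟩
    (by rw [Function.comp_apply, hback, hgφ])
    (by
      intro e he
      have h1 : MDifferentiableAt 𝓘(ℝ, E) I θ.symm e :=
        (hsm.contMDiffAt ((isOpen_extChartAt_target v₀).mem_nhds he.1)).mdifferentiableAt (by simp)
      have h2 : MDifferentiableAt I (𝓡 d) g (θ.symm e) :=
        (hg.contMDiffAt (hV.mem_nhds he.2)).mdifferentiableAt (by simp)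
      rw [mfderiv_comp e h2 h1]
      exact (LinearMap.range_comp_le_range _ _).trans (hgΔ _ he.2))
    (fun e he ↦ hrank _ he.2)
  refine ⟨h ∘ θ, θ.source ∩ θ ⁻¹' W,
    (continuousOn_extChartAt v₀).isOpen_inter_preimage (isOpen_extChartAt_source v₀) hW,
    ⟨mem_extChartAt_source v₀, hvW⟩, ?_, ?_, hh0, ?_⟩
  · rintro v ⟨hvs, hv⟩
    have := (hWV hv).2
    rwa [mem_preimage, θ.left_inv hvs] at this
  · refine hh.contMDiffOn.comp ((contMDiffOn_extChartAt (n := ∞) (I := I) (x := v₀)).mono ?_)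
      (fun v hv ↦ hv.2)
    rw [← extChartAt_source I]
    exact inter_subset_left
  · rintro v ⟨hvs, hv⟩
    have := hfac _ hv
    rw [Function.comp_apply, θ.left_inv hvs] at this
    exact this

end Plaques

/-! ### Plaques of `P_D` inside an orbit -/

section OrbitPlaques

variable {d : ℕ} {M : Type u} [TopologicalSpace M] [ChartedSpace (EuclideanSpace ℝ (Fin d)) M]
  [IsManifold (𝓡 d) ∞ M] [T2Space M] {D : Set (LocalVectorField d M)}

/-- Through each point of an orbit there passes an injectively parametrized integral manifold of
`P_D` contained in the orbit. -/
theorem exists_orbit_plaque {m x : M} (hx : x ∈ orbit D m) {k : ℕ}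
    (hk : Module.finrank ℝ (orbitDistribution D m) = k) :
    ∃ (U : Set (EuclideanSpace ℝ (Fin k))) (φ : EuclideanSpace ℝ (Fin k) → M),
      IsPlaque (orbitDistribution D) U φ ∧ 0 ∈ U ∧ φ 0 = x ∧ IsOrbitFamily D m U φ ∧
        InjOn φ U := by
  have hkx : Module.finrank ℝ (Submodule.span ℝ {v | Generator D x v}) = k := by
    rw [← orbitDistribution_eq_span_generator, finrank_orbitDistribution_of_mem_orbit hx, hk]
  obtain ⟨v, hv, hspan, hind⟩ : ∃ v : Fin k → TangentSpace (𝓡 d) x, (∀ i, Generator D x (v i)) ∧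
      Submodule.span ℝ (range v) = Submodule.span ℝ {v | Generator D x v} ∧
      LinearIndependent ℝ v := by
    subst hkx
    exact Submodule.exists_fun_fin_finrank_span_eq ℝ {v | Generator D x v}
  let ℓ : Fin k → EuclideanSpace ℝ (Fin k) →L[ℝ] ℝ := fun i ↦ EuclideanSpace.proj i
  let v' : Fin k → EuclideanSpace ℝ (Fin d) := v
  -- The basis vectors are inserted one at a time, each along its own coordinate function, starting
  -- from the constant family.
  have hfam : ∀ s : Finset (Fin k), ∃ (W : Set (EuclideanSpace ℝ (Fin k)))
      (φ : EuclideanSpace ℝ (Fin k) → M), IsOpen W ∧ 0 ∈ W ∧ IsOrbitFamily D m W φ ∧ φ 0 = x ∧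
      HasMFDerivAt 𝓘(ℝ, EuclideanSpace ℝ (Fin k)) (𝓡 d) φ 0
        (∑ i ∈ s, (ℓ i).smulRight (v' i)) := by
    intro s
    induction s using Finset.induction_on with
    | empty =>
      exact ⟨univ, fun _ ↦ x, isOpen_univ, trivial, IsOrbitFamily.const hx _, rfl,
        hasMFDerivAt_const x 0⟩
    | insert i s hi ih =>
      obtain ⟨W, φ, hW, h0, hφ, hφ0, hd⟩ := ih
      have hsum : ∑ j ∈ insert i s, (ℓ j).smulRight (v' j) =
          ∑ j ∈ s, (ℓ j).smulRight (v' j) + (ℓ i).smulRight (v' i) := by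
        rw [Finset.sum_insert hi, add_comm]
      obtain ⟨W', φ', h1, h2, h3, h4, h5⟩ :=
        (hv i).exists_family (ℓ i) W hW h0 φ hφ hφ0 _ hd
      exact ⟨W', φ', h1, h2, h3, h4, h5.congr_mfderiv hsum.symm⟩
  obtain ⟨W, φ, hW, h0, hφ, hφ0, hd⟩ := hfam Finset.univ
  have hinj0 : Function.Injective
      (mfderiv 𝓘(ℝ, EuclideanSpace ℝ (Fin k)) (𝓡 d) φ 0) := by
    rw [hd.mfderiv]
    refine (injective_iff_map_eq_zero (∑ i, (ℓ i).smulRight (v' i))).2 fun ζ hζ ↦ ?_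
    have hζ' : ∑ i, ℓ i ζ • v' i = 0 := by
      rw [← hζ]
      simp
    have h3 := Fintype.linearIndependent_iff.1 hind (fun i ↦ ℓ i ζ) hζ'
    ext i
    exact h3 i
  have hev := eventually_injective_mfderiv hW hφ.contMDiffOn h0 hinj0
  obtain ⟨r, -, hr⟩ := exists_left_inverse_of_immersion hW hφ.contMDiffOn h0 hinj0
  obtain ⟨U, hUsub, hU, h0U⟩ := eventually_nhds_iff.1 (hev.and (hr.and (hW.mem_nhds h0)))
  have hφU : IsOrbitFamily D m U φ := hφ.mono fun u hu ↦ (hUsub u hu).2.2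
  refine ⟨U, φ, ⟨hU, hφU.contMDiffOn, fun u hu ↦ (hUsub u hu).1, fun u hu ↦ ?_⟩, h0U, hφ0, hφU, ?_⟩
  -- The image of the derivative is inside `P_D` and has dimension `k`, which is the rank of `P_D`
  -- at every point of the orbit.
  · refine Submodule.eq_of_le_of_finrank_eq ?_ ?_
    · rintro _ ⟨ζ, rfl⟩
      exact hφU.mfderiv_mem hU hu ζ
    · rw [finrank_orbitDistribution_of_mem_orbit (hφU.mem_orbit hu), hk]
      exact (LinearMap.finrank_range_of_inj (hUsub u hu).1).trans finrank_euclideanSpace_fin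
  · intro u hu u' hu' h
    rw [← (hUsub u hu).2.1, ← (hUsub u' hu').2.1, h]

end OrbitPlaques

/-! ### Paracompactness of connected manifolds injected into `M` -/

section PoincareVolterra

/-- In a preconnected space, an open cover whose members each meet only countably many others has
only countably many non-empty members. -/
theorem countable_nonempty_of_cover {P ι : Type*} [TopologicalSpace P] [PreconnectedSpace P]
    {U : ι → Set P} (hU : ∀ i, IsOpen (U i)) (hcov : ⋃ i, U i = univ)
    (hcount : ∀ i, {j | (U i ∩ U j).Nonempty}.Countable) : {i | (U i).Nonempty}.Countable := by
  rcases isEmpty_or_nonempty P with hP | ⟨⟨p⟩⟩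
  · convert countable_empty (α := ι)
    exact eq_empty_of_forall_notMem fun i hi ↦ hP.elim hi.some
  obtain ⟨i₀, hi₀⟩ := mem_iUnion.1 (hcov ▸ mem_univ p : p ∈ ⋃ i, U i)
  -- `A n` holds the indices reached from `i₀` by a chain of `n` consecutive overlaps. The union of
  -- all sets reached is clopen, since a set not reached is disjoint from every set reached.
  let A : ℕ → Set ι := fun n ↦ Nat.rec {i₀} (fun _ B ↦ ⋃ i ∈ B, {j | (U i ∩ U j).Nonempty}) n
  have hA : ∀ n, (A n).Countable := by
    intro n
    induction n with
    | zero => exact countable_singleton i₀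
    | succ n ih => exact ih.biUnion fun i _ ↦ hcount i
  have hstep : ∀ i ∈ ⋃ n, A n, ∀ j, (U i ∩ U j).Nonempty → j ∈ ⋃ n, A n := by
    intro i hi j hij
    obtain ⟨n, hn⟩ := mem_iUnion.1 hi
    exact mem_iUnion.2 ⟨n + 1, mem_iUnion₂.2 ⟨i, hn, hij⟩⟩
  have hclopen : IsClopen (⋃ i ∈ ⋃ n, A n, U i) := by
    refine ⟨⟨?_⟩, isOpen_biUnion fun i _ ↦ hU i⟩
    have : (⋃ i ∈ ⋃ n, A n, U i)ᶜ = ⋃ i ∈ (⋃ n, A n)ᶜ, U i := by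
      ext q
      simp only [mem_compl_iff, mem_iUnion₂, not_exists, exists_prop]
      constructor
      · intro hq
        obtain ⟨j, hj⟩ := mem_iUnion.1 (hcov ▸ mem_univ q : q ∈ ⋃ i, U i)
        exact ⟨j, fun hjA ↦ hq j ⟨hjA, hj⟩, hj⟩
      · rintro ⟨j, hjA, hj⟩ i ⟨hi, hqi⟩
        exact hjA (hstep i hi j ⟨q, hqi, hj⟩)
    rw [this]
    exact isOpen_biUnion fun i _ ↦ hU i
  have huniv := hclopen.eq_univ ⟨p, mem_iUnion₂.2 ⟨i₀, mem_iUnion.2 ⟨0, rfl⟩, hi₀⟩⟩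
  refine (countable_iUnion hA).mono fun j ⟨q, hq⟩ ↦ ?_
  obtain ⟨i, hi, hqi⟩ := mem_iUnion₂.1 (huniv ▸ mem_univ q : q ∈ ⋃ i ∈ ⋃ n, A n, U i)
  exact hstep i hi j ⟨q, hqi, hq⟩

variable {M P : Type*} [TopologicalSpace M] [T2Space M] [ParacompactSpace M]
  [TopologicalSpace P] [PreconnectedSpace P]

/-- A connected space that maps continuously to a paracompact manifold only sees countably many
open subsets of it. -/
theorem exists_countable_basis_on_range (E : Type*) [NormedAddCommGroup E] [NormedSpace ℝ E]
    [FiniteDimensional ℝ E] [ChartedSpace E M] {j : P → M} (hj : Continuous j) :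
    ∃ B : Set (Set M), B.Countable ∧ (∀ b ∈ B, IsOpen b) ∧
      ∀ (p : P) (V : Set M), IsOpen V → j p ∈ V → ∃ b ∈ B, j p ∈ b ∧ b ⊆ V := by
  have : LocallyCompactSpace M := ChartedSpace.locallyCompactSpace E M
  have hK : ∀ x : M, ∃ K : Set M, IsCompact K ∧ K ∈ 𝓝 x ∧ K ⊆ (chartAt E x).source := fun x ↦ by
    obtain ⟨K, h1, h2, h3⟩ := local_compact_nhds ((chartAt E x).open_source.mem_nhds
      (mem_chart_source E x))
    exact ⟨K, h3, h1, h2⟩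
  choose K hKc hKn hKs using hK
  -- `M` may have uncountably many components, so countability has to come from the connectedness of
  -- `P`. Each `V x` lies in a compact set and so meets finitely many others; hence only countably
  -- many have non-empty preimage in `P`.
  obtain ⟨V, hVo, hVc, hVf, hVK⟩ := precise_refinement (fun x ↦ interior (K x))
    (fun x ↦ isOpen_interior) (eq_univ_of_forall fun x ↦ mem_iUnion.2 ⟨x,
      mem_interior_iff_mem_nhds.2 (hKn x)⟩)
  have hcount : {x | (j ⁻¹' V x).Nonempty}.Countable := by
    refine countable_nonempty_of_cover (fun x ↦ (hVo x).preimage hj) ?_ fun x ↦ ?_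
    · rw [← preimage_iUnion, hVc, preimage_univ]
    · refine ((hVf.finite_nonempty_inter_compact (hKc x)).subset ?_).countable
      rintro y ⟨p, hpx, hpy⟩
      exact ⟨j p, hpy, interior_subset (hVK x hpx)⟩
  have hsc : ∀ x : M, ∃ B : Set (Set M), B.Countable ∧ (∀ b ∈ B, IsOpen b) ∧
      ∀ y ∈ (chartAt E x).source, ∀ W : Set M, IsOpen W → y ∈ W → ∃ b ∈ B, y ∈ b ∧ b ⊆ W := by
    intro x
    have : SecondCountableTopology (chartAt E x).source :=
      (chartAt E x).secondCountableTopology_source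
    refine ⟨(fun s ↦ Subtype.val '' s) '' countableBasis (chartAt E x).source,
      (countable_countableBasis _).image _, ?_, ?_⟩
    · rintro _ ⟨s, hs, rfl⟩
      exact (chartAt E x).open_source.isOpenMap_subtype_val s
        ((isBasis_countableBasis _).isOpen hs)
    · intro y hy W hW hyW
      obtain ⟨s, hs, hys, hsW⟩ := (isBasis_countableBasis (chartAt E x).source).exists_subset_of_mem_open
        (a := ⟨y, hy⟩) (show _ ∈ Subtype.val ⁻¹' W from hyW) (hW.preimage continuous_subtype_val)
      exact ⟨_, ⟨s, hs, rfl⟩, ⟨_, hys, rfl⟩, image_subset_iff.2 hsW⟩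
  choose B hBc hBo hB using hsc
  refine ⟨⋃ x ∈ {x | (j ⁻¹' V x).Nonempty}, B x, hcount.biUnion fun x _ ↦ hBc x, ?_, ?_⟩
  · intro b hb
    obtain ⟨x, -, hx⟩ := mem_iUnion₂.1 hb
    exact hBo x b hx
  · intro p W hW hp
    obtain ⟨x, hx⟩ := mem_iUnion.1 (hVc ▸ mem_univ (j p) : j p ∈ ⋃ x, V x)
    obtain ⟨b, hb, h1, h2⟩ := hB x (j p) (hKs x (interior_subset (hVK x hx))) W hW hp
    exact ⟨b, mem_iUnion₂.2 ⟨x, ⟨p, hx⟩, hb⟩, h1, h2⟩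

/-- A connected manifold that maps continuously and injectively to a paracompact manifold is
paracompact. -/
theorem paracompactSpace_of_injective (E F : Type*) [NormedAddCommGroup E] [NormedSpace ℝ E]
    [FiniteDimensional ℝ E] [NormedAddCommGroup F] [NormedSpace ℝ F] [FiniteDimensional ℝ F]
    [ChartedSpace E M] [ChartedSpace F P] [T2Space P] {j : P → M} (hj : Continuous j)
    (hinj : Function.Injective j) : ParacompactSpace P := by
  have : LocallyCompactSpace P := ChartedSpace.locallyCompactSpace F P
  have : LocallyConnectedSpace P := ChartedSpace.locallyConnectedSpace F P
  obtain ⟨B, hBc, hBo, hB⟩ := exists_countable_basis_on_range E hj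
  let 𝒰 : Set (Set P) := {C | ∃ b ∈ B, (∃ p ∈ j ⁻¹' b, C = connectedComponentIn (j ⁻¹' b) p) ∧
    ∃ K, IsCompact K ∧ IsSeparable K ∧ C ⊆ K}
  have hopen : ∀ C ∈ 𝒰, IsOpen C := by
    rintro _ ⟨b, hb, ⟨p, -, rfl⟩, -⟩
    exact ((hBo b hb).preimage hj).connectedComponentIn
  have hcov : ∀ p, ∃ C ∈ 𝒰, p ∈ C := by
    intro p
    obtain ⟨K, hKn, hKs, hKc⟩ := local_compact_nhds ((chartAt F p).open_source.mem_nhds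
      (mem_chart_source F p))
    have hKsep : IsSeparable K := by
      have h1 : IsSeparable (range fun u : (chartAt F p).target ↦ (chartAt F p).symm u) :=
        isSeparable_range (continuousOn_iff_continuous_domRestrict.1 (chartAt F p).continuousOn_symm)
      refine h1.mono fun q hq ↦ ?_
      exact ⟨⟨chartAt F p q, (chartAt F p).map_source (hKs hq)⟩,
        (chartAt F p).left_inv (hKs hq)⟩
    have hfr : IsCompact (frontier K) := hKc.of_isClosed_subset isClosed_frontier
      hKc.isClosed.frontier_subset
    have hpint : p ∈ interior K := mem_interior_iff_mem_nhds.2 hKn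
    -- By injectivity `j p` is not in the compact set `j '' frontier K`, so a basic open set can
    -- avoid that set. The component of its preimage through `p` cannot cross the frontier and is
    -- trapped in `K`.
    obtain ⟨b, hb, hpb, hbs⟩ := hB p (j '' frontier K)ᶜ (hfr.image hj).isClosed.isOpen_compl (by
      rintro ⟨q, hq, hqp⟩
      exact hq.2 (hinj hqp ▸ hpint))
    refine ⟨connectedComponentIn (j ⁻¹' b) p, ⟨b, hb, ⟨p, hpb, rfl⟩, K, hKc, hKsep, ?_⟩,
      mem_connectedComponentIn hpb⟩
    refine (IsPreconnected.subset_left_of_subset_union isOpen_interior hKc.isClosed.isOpen_compl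
      (disjoint_compl_right_iff_subset.2 interior_subset) (fun q hq ↦ ?_)
      ⟨p, mem_connectedComponentIn hpb, hpint⟩ isPreconnected_connectedComponentIn).trans
      interior_subset
    by_contra hnot
    rw [mem_union, not_or, mem_compl_iff, not_not] at hnot
    exact hbs (connectedComponentIn_subset (j ⁻¹' b) p hq) ⟨q, ⟨subset_closure hnot.2, hnot.1⟩, rfl⟩
  have hcount : 𝒰.Countable := by
    have h1 := countable_nonempty_of_cover (U := fun C : 𝒰 ↦ C.1) (fun C ↦ hopen C C.2)
      (eq_univ_of_forall fun p ↦ by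
        obtain ⟨C, hC, hp⟩ := hcov p
        exact mem_iUnion.2 ⟨⟨C, hC⟩, hp⟩) ?_
    · have h2 : {C : 𝒰 | C.1.Nonempty} = univ := by
        refine eq_univ_of_forall ?_
        rintro ⟨_, b, hb, ⟨p, hp, rfl⟩, -⟩
        exact ⟨p, mem_connectedComponentIn hp⟩
      rw [h2, countable_univ_iff] at h1
      exact h1
    · rintro ⟨C, hC⟩
      obtain ⟨b, hb, -, K, -, ⟨Q, hQc, hQ⟩, hCK⟩ := id hC
      have h2 : (⋃ b ∈ B, (fun q ↦ connectedComponentIn (j ⁻¹' b) q) '' Q).Countable :=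
        hBc.biUnion fun b _ ↦ hQc.image _
      refine Countable.mono (fun C' hC' ↦ ?_) (h2.preimage Subtype.val_injective)
      obtain ⟨b', hb', ⟨p', hp', hC'eq⟩, -⟩ := C'.2
      obtain ⟨z, hzC, hzC'⟩ := hC'
      -- An open component meeting `C` contains a point of the countable dense set `Q`. It is
      -- therefore determined by a pair `(b', q)`, and there are only countably many such pairs.
      obtain ⟨q, hq, hqQ⟩ := mem_closure_iff.1 (hQ (hCK hzC)) C'.1 (hopen _ C'.2) hzC'
      refine mem_iUnion₂.2 ⟨b', hb', q, hqQ, ?_⟩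
      rw [hC'eq] at hq ⊢
      exact (connectedComponentIn_eq hq).symm
  have hσ : SigmaCompactSpace P := by
    refine ⟨?_⟩
    have h1 : ∀ C : 𝒰, ∃ K, IsCompact K ∧ C.1 ⊆ K := by
      rintro ⟨_, b, hb, -, K, hK, -, hs⟩
      exact ⟨K, hK, hs⟩
    choose K hK hCK using h1
    have := hcount.to_subtype
    have h2 : IsSigmaCompact (⋃ C, K C) := isSigmaCompact_iUnion_of_isCompact K hK
    convert h2
    refine (eq_univ_of_forall fun p ↦ ?_).symm
    obtain ⟨C, hC, hp⟩ := hcov p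
    exact mem_iUnion.2 ⟨⟨C, hC⟩, hCK _ hp⟩
  infer_instance

end PoincareVolterra

/-! ### Manifold structures from charts whose inverses are plaques -/

section PlaqueManifold

variable {d : ℕ} {M : Type u} [TopologicalSpace M] [ChartedSpace (EuclideanSpace ℝ (Fin d)) M]
  [IsManifold (𝓡 d) ∞ M] {F : Type*} [NormedAddCommGroup F] [NormedSpace ℝ F]
  [FiniteDimensional ℝ F] {P : Type*} [TopologicalSpace P] {Δ : Distribution d M} {j : P → M}
  {e : P → OpenPartialHomeomorph P F}

theorem IsPlaque.mono {U V : Set F} {φ : F → M} (h : IsPlaque Δ U φ) (hV : IsOpen V)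
    (hVU : V ⊆ U) : IsPlaque Δ V φ :=
  ⟨hV, h.contMDiffOn.mono hVU, fun u hu ↦ h.injective u (hVU hu),
    fun u hu ↦ h.range_eq u (hVU hu)⟩

theorem IsPlaque.congr {U : Set F} {φ φ' : F → M} (h : IsPlaque Δ U φ) (heq : EqOn φ' φ U) :
    IsPlaque Δ U φ' := by
  have hev : ∀ u ∈ U, φ' =ᶠ[𝓝 u] φ := fun u hu ↦
    heq.eventuallyEq_of_mem (h.isOpen.mem_nhds hu)
  refine ⟨h.isOpen, h.contMDiffOn.congr heq, fun u hu ↦ ?_, fun u hu ↦ ?_⟩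
  · rw [(hev u hu).mfderiv_eq]
    exact h.injective u hu
  · have h1 := h.range_eq u hu
    rw [← heq hu] at h1
    rw [(hev u hu).mfderiv_eq]
    exact h1

/-- The charted space structure defined by a family of charts, one around each point. -/
@[reducible]
def chartedSpaceOfCharts (e : P → OpenPartialHomeomorph P F) (he : ∀ p, p ∈ (e p).source) :
    ChartedSpace F P where
  atlas := range e
  chartAt := e
  mem_chart_source := he
  chart_mem_atlas := mem_range_self

/-- Near a point the transition map is a smooth local left inverse of the immersion `j ∘ e'.symm`
applied to `j ∘ e.symm`. Its continuity, known from the charts, keeps it where the left inverse is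
valid. -/
theorem contDiffOn_transition_of_isPlaque {e e' : OpenPartialHomeomorph P F}
    (he : IsPlaque Δ e.target (j ∘ e.symm)) (he' : IsPlaque Δ e'.target (j ∘ e'.symm)) :
    ContDiffOn ℝ ∞ (e' ∘ e.symm) (e.symm.trans e').source := by
  intro u hu
  have hu1 : u ∈ e.target := by
    have := hu
    simp only [OpenPartialHomeomorph.trans_source, OpenPartialHomeomorph.symm_source] at this
    exact this.1
  have hu2 : e.symm u ∈ e'.source := by
    have := hu
    simp only [OpenPartialHomeomorph.trans_source] at this
    exact this.2
  refine ContDiffAt.contDiffWithinAt ?_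
  obtain ⟨r, hr, hru⟩ := exists_left_inverse_of_immersion he'.isOpen he'.contMDiffOn
    (e'.map_source hu2) (he'.injective _ (e'.map_source hu2))
  have hjp : (j ∘ e'.symm) (e' (e.symm u)) = (j ∘ e.symm) u := by
    simp [e'.left_inv hu2]
  rw [hjp] at hr
  have hsm := hr.comp u (he.contMDiffOn.contMDiffAt (he.isOpen.mem_nhds hu1))
  refine hsm.contDiffAt.congr_of_eventuallyEq ?_
  have hc : ContinuousAt (e' ∘ e.symm) u :=
    (e'.continuousAt hu2).comp (e.symm.continuousAt hu1)
  filter_upwards [hc.eventually hru, (e.symm.trans e').open_source.mem_nhds hu] with v hv hvs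
  have hv2 : e.symm v ∈ e'.source := by
    simp only [OpenPartialHomeomorph.trans_source] at hvs
    exact hvs.2
  rw [← hv]
  simp [e'.left_inv hv2]

theorem isManifold_of_isPlaque (he : ∀ p, p ∈ (e p).source)
    (hpl : ∀ p, IsPlaque Δ (e p).target (j ∘ (e p).symm)) :
    letI := chartedSpaceOfCharts e he
    IsManifold 𝓘(ℝ, F) ∞ P := by
  let := chartedSpaceOfCharts e he
  refine isManifold_of_contDiffOn 𝓘(ℝ, F) ∞ P ?_
  rintro _ _ ⟨p, rfl⟩ ⟨q, rfl⟩
  refine (contDiffOn_transition_of_isPlaque (hpl p) (hpl q)).mono ?_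
  exact fun u hu ↦ hu.1

theorem contMDiff_of_isPlaque (he : ∀ p, p ∈ (e p).source)
    (hpl : ∀ p, IsPlaque Δ (e p).target (j ∘ (e p).symm)) :
    letI := chartedSpaceOfCharts e he
    ContMDiff 𝓘(ℝ, F) (𝓡 d) ∞ j ∧
      (∀ p, Function.Injective (mfderiv 𝓘(ℝ, F) (𝓡 d) j p)) ∧
      ∀ p, (mfderiv 𝓘(ℝ, F) (𝓡 d) j p).range = Δ (j p) := by
  let := chartedSpaceOfCharts e he
  have hmf := isManifold_of_isPlaque he hpl
  have hchart : ∀ p : P, extChartAt 𝓘(ℝ, F) p p = e p p := fun p ↦ rfl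
  have hcd : ∀ p, ContMDiffAt 𝓘(ℝ, F) 𝓘(ℝ, F) ∞ (e p) p := fun p ↦
    contMDiffAt_extChartAt (I := 𝓘(ℝ, F)) (x := p)
  have hφ : ∀ p, ContMDiffAt 𝓘(ℝ, F) (𝓡 d) ∞ (j ∘ (e p).symm) (e p p) := fun p ↦
    (hpl p).contMDiffOn.contMDiffAt ((hpl p).isOpen.mem_nhds ((e p).map_source (he p)))
  have heq : ∀ p, j =ᶠ[𝓝 p] (j ∘ (e p).symm) ∘ (e p) := fun p ↦ by
    filter_upwards [(e p).open_source.mem_nhds (he p)] with q hq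
    simp [(e p).left_inv hq]
  have hbij : ∀ p, Function.Bijective (mfderiv 𝓘(ℝ, F) 𝓘(ℝ, F) (e p) p) := by
    intro p
    have := isInvertible_mfderiv_extChartAt (I := 𝓘(ℝ, F)) (mem_extChartAt_source (I := 𝓘(ℝ, F)) p)
    exact this.bijective
  have hder : ∀ p, mfderiv 𝓘(ℝ, F) (𝓡 d) j p =
      (mfderiv 𝓘(ℝ, F) (𝓡 d) (j ∘ (e p).symm) (e p p)).comp
        (mfderiv 𝓘(ℝ, F) 𝓘(ℝ, F) (e p) p) := by
    intro p
    rw [(heq p).mfderiv_eq]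
    exact mfderiv_comp p ((hφ p).mdifferentiableAt (by simp)) ((hcd p).mdifferentiableAt (by simp))
  refine ⟨fun p ↦ ((hφ p).comp p (hcd p)).congr_of_eventuallyEq (heq p), fun p ↦ ?_, fun p ↦ ?_⟩
  · rw [hder]
    exact ((hpl p).injective _ ((e p).map_source (he p))).comp (hbij p).injective
  · have h1 := (hpl p).range_eq _ ((e p).map_source (he p))
    rw [Function.comp_apply, (e p).left_inv (he p)] at h1
    rw [hder, ← h1]
    exact LinearMap.range_comp_of_range_eq_top _ (LinearMap.range_eq_top.2 (hbij p).surjective)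

end PlaqueManifold

/-! ### The natural topology and the manifold structure of an orbit -/

section OrbitManifold

variable {d : ℕ} {M : Type u} [TopologicalSpace M] [ChartedSpace (EuclideanSpace ℝ (Fin d)) M]
  [IsManifold (𝓡 d) ∞ M] [T2Space M] {D : Set (LocalVectorField d M)} {m : M} {S : Set M}

/-- The point `x` of `S`, as a point of the untopologized set. -/
def Pts.mk (x : M) (hx : x ∈ S) : Pts S := ⟨x, hx⟩

/-- The map `T ↦ ξ_T (m)` with values in a set that is the orbit of `m`. -/
def orbitParam (h : S = orbit D m) (w : Word D) (T : timeDomain w.fields m) : Pts S :=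
  ⟨(orbitMap D m w T).1, h ▸ (orbitMap D m w T).2⟩

theorem orbitTopology_eq (h : S = orbit D m) :
    orbitTopology D m S h =
      ⨆ w : Word D, TopologicalSpace.coinduced (orbitParam h w) inferInstance :=
  rfl

theorem continuous_orbitParam (h : S = orbit D m) (w : Word D) :
    Continuous[inferInstance, orbitTopology D m S h] (orbitParam h w) := by
  rw [continuous_iff_coinduced_le, orbitTopology_eq]
  exact le_iSup (fun w : Word D ↦ TopologicalSpace.coinduced (orbitParam h w) inferInstance) w

theorem isOpen_orbitTopology_iff (h : S = orbit D m) {V : Set (Pts S)} :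
    IsOpen[orbitTopology D m S h] V ↔ ∀ w : Word D, IsOpen (orbitParam h w ⁻¹' V) := by
  rw [orbitTopology_eq, isOpen_iSup_iff]
  rfl

theorem continuous_incl_orbitTopology (h : S = orbit D m) :
    Continuous[orbitTopology D m S h, inferInstance] (fun x : Pts S ↦ x.1) := by
  rw [orbitTopology_eq, continuous_iSup_dom]
  intro w
  rw [continuous_coinduced_dom, continuous_iff_continuousAt]
  rintro ⟨T, hT⟩
  exact ContinuousAt.comp (f := Subtype.val) (g := fun T ↦ multiflow w.fields T m)
    (contMDiffAt_multiflow_time w.fields hT).continuousAt continuousAt_subtype_val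

/-- Orbit families are continuous for the natural topology of the orbit. -/
theorem IsOrbitFamily.continuousOn {F : Type*} [NormedAddCommGroup F] [NormedSpace ℝ F]
    (h : S = orbit D m) {W : Set F} {φ : F → M} (hφ : IsOrbitFamily D m W φ) {Φ : F → Pts S}
    (hΦ : ∀ u ∈ W, (Φ u).1 = φ u) :
    letI := orbitTopology D m S h
    ContinuousOn Φ W := by
  let := orbitTopology D m S h
  obtain ⟨w, A, hA, hAφ⟩ := hφ
  rw [continuousOn_iff_continuous_domRestrict]
  have h1 : Continuous (fun u : W ↦ (⟨A u, (hAφ u u.2).1⟩ : timeDomain w.fields m)) :=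
    (continuousOn_iff_continuous_domRestrict.1 hA.continuousOn).subtype_mk _
  have h2 : W.domRestrict Φ = orbitParam h w ∘ fun u : W ↦ ⟨A u, (hAφ u u.2).1⟩ :=
    funext fun u ↦ Subtype.ext ((hΦ u u.2).trans (hAφ u u.2).2.symm)
  rw [h2]
  exact (continuous_orbitParam h w).comp h1

/-- Plaques of `P_D` inside an orbit are open for the natural topology. -/
theorem isOpen_image_of_isPlaque (hD : EverywhereDefined D) (h : S = orbit D m) {k : ℕ}
    (hk : Module.finrank ℝ (orbitDistribution D m) = k) {U : Set (EuclideanSpace ℝ (Fin k))}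
    {φ : EuclideanSpace ℝ (Fin k) → M} (hφ : IsPlaque (orbitDistribution D) U φ)
    {Φ : EuclideanSpace ℝ (Fin k) → Pts S} (hΦ : ∀ u ∈ U, (Φ u).1 = φ u) :
    IsOpen[orbitTopology D m S h] (Φ '' U) := by
  rw [isOpen_orbitTopology_iff]
  intro w
  rw [isOpen_iff_mem_nhds]
  rintro ⟨T, hT⟩ ⟨u, hu, huT⟩
  have huT' : φ u = multiflow w.fields T m := (hΦ u hu).symm.trans (congrArg Subtype.val huT)
  -- The map `T ↦ ξ_T(m)` is tangent to `P_D`, whose rank is constant along it, so it factors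
  -- through the plaque near `T`. Thus nearby times also land in the image of the plaque.
  obtain ⟨g, W, hW, hTW, hWsub, -, -, hg⟩ := hφ.exists_factorization_vectorSpace
    (orbitDistribution_isSmooth hD) hu (isOpen_timeDomain w.fields m)
    (g := fun T ↦ multiflow w.fields T m)
    (fun T hT ↦ (contMDiffAt_multiflow_time w.fields hT).contMDiffWithinAt) hT huT'.symm
    (by
      rintro T hT _ ⟨a, rfl⟩
      exact mfderiv_multiflow_time_mem w.fields (fun i ↦ (w.2 i).2) hT a)
    (by
      intro T hT
      rw [finrank_orbitDistribution_of_mem_orbit (m := m) ⟨w, T, hT, rfl⟩, hk,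
        finrank_euclideanSpace_fin])
  filter_upwards [continuousAt_subtype_val.preimage_mem_nhds (hW.mem_nhds hTW)] with T' hT'
  exact ⟨g T', (hg T' hT').1, Subtype.ext ((hΦ _ (hg T' hT').1).trans (hg T' hT').2.symm)⟩

/-- The charts of an orbit. -/
theorem exists_orbit_chart (hD : EverywhereDefined D) (h : S = orbit D m) {k : ℕ}
    (hk : Module.finrank ℝ (orbitDistribution D m) = k) (x : Pts S) :
    letI := orbitTopology D m S h
    ∃ e : OpenPartialHomeomorph (Pts S) (EuclideanSpace ℝ (Fin k)), x ∈ e.source ∧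
      IsPlaque (orbitDistribution D) e.target ((fun x : Pts S ↦ x.1) ∘ e.symm) := by
  classical
  let := orbitTopology D m S h
  obtain ⟨U, φ, hφ, h0, hφ0, hfam, hinj⟩ := exists_orbit_plaque (h ▸ x.2 : x.1 ∈ orbit D m) hk
  have hmem : ∀ u ∈ U, φ u ∈ S := fun u hu ↦ by rw [h]; exact hfam.mem_orbit hu
  -- The value `x` outside `U` is a dummy.
  let Φ : EuclideanSpace ℝ (Fin k) → Pts S := fun u ↦ if hu : u ∈ U then Pts.mk (φ u) (hmem u hu) else x
  have hΦ : ∀ u ∈ U, (Φ u).1 = φ u := fun u hu ↦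
    congrArg Subtype.val (dif_pos hu : Φ u = Pts.mk (φ u) (hmem u hu))
  have hΦinj : InjOn Φ U := fun u hu v hv huv ↦
    hinj hu hv (by rw [← hΦ u hu, ← hΦ v hv, huv])
  let E := OpenPartialHomeomorph.ofContinuousOpenRestrict hΦinj.toPartialEquiv
    (hfam.continuousOn h hΦ) (by
      rintro V ⟨V', hV', rfl⟩
      convert isOpen_image_of_isPlaque hD h hk (hφ.mono (hφ.isOpen.inter hV') inter_subset_left)
        (Φ := Φ) (fun u hu ↦ hΦ u hu.1)
      ext y
      constructor
      · rintro ⟨⟨u, hu⟩, huV, rfl⟩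
        exact ⟨u, ⟨hu, huV⟩, rfl⟩
      · rintro ⟨u, ⟨hu, huV⟩, rfl⟩
        exact ⟨⟨u, hu⟩, huV, rfl⟩) hφ.isOpen
  refine ⟨E.symm, ⟨0, h0, Subtype.ext ((hΦ 0 h0).trans hφ0)⟩, ?_⟩
  exact hφ.congr hΦ

/-- Orbits are connected. -/
theorem connectedSpace_orbitTopology (hD : EverywhereDefined D) (h : S = orbit D m) :
    @ConnectedSpace (Pts S) (orbitTopology D m S h) := by
  classical
  let := orbitTopology D m S h
  have hm : m ∈ S := h ▸ mem_orbit_self hD m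
  have hcomp : ∀ x (hx : x ∈ S), Pts.mk x hx ∈ connectedComponent (Pts.mk m hm) := by
    suffices ∀ x ∈ orbit D m, ∀ hx : x ∈ S,
      Pts.mk x hx ∈ connectedComponent (Pts.mk m hm) from
      fun x hx ↦ this x (h ▸ hx) hx
    suffices ∀ x ∈ orbit D m, x ∈ orbit D m ∧ ∀ hx : x ∈ S,
      Pts.mk x hx ∈ connectedComponent (Pts.mk m hm) from fun x hx ↦ (this x hx).2
    refine orbit_induction ⟨mem_orbit_self hD m, fun _ ↦ mem_connectedComponent⟩ ?_
    rintro X hX t y ⟨hy, hyc⟩ ht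
    refine ⟨flow_mem_orbit hX hy ht, fun hx ↦ ?_⟩
    obtain ⟨a, b, h0, htab, hfl0, hline⟩ := exists_flow_line ht
    -- A flow line is a one-parameter orbit family, hence continuous for the natural topology; it
    -- joins its endpoints inside the orbit.
    have hfam : IsOrbitFamily D m (Ioo a b) (fun s ↦ flow X s y) :=
      (IsOrbitFamily.const hy (Ioo a b)).flow hX contDiffOn_id fun s hs ↦ (hline s hs).1
    let Φ : ℝ → Pts S := fun s ↦
      if hs : flow X s y ∈ S then Pts.mk (flow X s y) hs else Pts.mk m hm
    have hmem : ∀ s ∈ Ioo a b, flow X s y ∈ S := fun s hs ↦ by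
      rw [h]
      exact hfam.mem_orbit hs
    have hcont := hfam.continuousOn h (Φ := Φ) fun s hs ↦
      congrArg Subtype.val (dif_pos (hmem s hs) : Φ s = Pts.mk _ _)
    have hpre : IsPreconnected (Φ '' Ioo a b) := isPreconnected_Ioo.image _ hcont
    have hyS : y ∈ S := h ▸ hy
    have hy' : Pts.mk y hyS ∈ Φ '' Ioo a b := by
      refine ⟨0, h0, ?_⟩
      simp only [Φ, hfl0, dif_pos hyS]
    have ht' : Pts.mk (flow X t y) hx ∈ Φ '' Ioo a b :=
      ⟨t, htab, by simp only [Φ, dif_pos hx]⟩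
    rw [connectedComponent_eq (hyc hyS)]
    exact hpre.subset_connectedComponent hy' ht'
  have huniv : connectedComponent (Pts.mk m hm) = univ := eq_univ_of_forall fun x ↦ hcomp x.1 x.2
  exact connectedSpace_iff_univ.2 (huniv ▸ isConnected_connectedComponent)

/-- The manifold structure on an orbit of positive dimension. -/
theorem exists_immersiveStructure [ParacompactSpace M] (hD : EverywhereDefined D)
    (h : S = orbit D m) (hk : 1 ≤ Module.finrank ℝ (orbitDistribution D m)) :
    ∃ N : ImmersiveStructure d S, N.topology = orbitTopology D m S h ∧
      N.IsIntegral (orbitDistribution D) ∧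
      N.dim = Module.finrank ℝ (orbitDistribution D m) := by
  let := orbitTopology D m S h
  choose e he hpl using exists_orbit_chart hD h (k := Module.finrank ℝ (orbitDistribution D m)) rfl
  let := chartedSpaceOfCharts e he
  have := isManifold_of_isPlaque he hpl
  obtain ⟨h1, h2, h3⟩ := contMDiff_of_isPlaque he hpl
  have : ConnectedSpace (Pts S) := connectedSpace_orbitTopology hD h
  have hcont := continuous_incl_orbitTopology h
  have hinj : Function.Injective (fun x : Pts S ↦ x.1) := fun _ _ h ↦ Subtype.ext h
  have : T2Space (Pts S) := T2Space.of_injective_continuous hinj hcont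
  have : ParacompactSpace (Pts S) := paracompactSpace_of_injective (EuclideanSpace ℝ (Fin d))
    (EuclideanSpace ℝ (Fin (Module.finrank ℝ (orbitDistribution D m)))) hcont hinj
  exact ⟨{ dim := _, one_le_dim := hk, contMDiff_incl := h1, injective_mfderiv := h2 }, rfl, h3, rfl⟩

end OrbitManifold

/-! ### Brackets of fields tangent to integral manifolds -/

section Involutive

/-- A smooth vector field tangent to an immersion comes from a smooth vector field on its source. -/
theorem exists_lift_of_mem_range {E F : Type*} [NormedAddCommGroup E] [NormedSpace ℝ E]
    [FiniteDimensional ℝ E] [NormedAddCommGroup F] [NormedSpace ℝ F] [FiniteDimensional ℝ F]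
    {f : F → E} {U : Set F} (hU : IsOpen U) (hf : ContDiffOn ℝ ∞ f U) {u₀ : F} (hu₀ : u₀ ∈ U)
    (hinj : Function.Injective (fderiv ℝ f u₀)) {V : E → E} (hV : ContDiffAt ℝ ∞ V (f u₀))
    (hVf : ∀ᶠ u in 𝓝 u₀, ∃ ζ, fderiv ℝ f u ζ = V (f u)) :
    ∃ a : F → F, ContDiffAt ℝ ∞ a u₀ ∧ ∀ᶠ u in 𝓝 u₀, V (f u) = fderiv ℝ f u (a u) := by
  obtain ⟨r, hr, hru⟩ := exists_local_left_inverse hU hf hu₀ hinj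
  have hfu₀ : ContDiffAt ℝ ∞ f u₀ := hf.contDiffAt (hU.mem_nhds hu₀)
  have hr' : ContDiffAt ℝ ∞ (fderiv ℝ r) (f u₀) := hr.fderiv_right (by simp)
  have hrev : ∀ᶠ x in 𝓝 (f u₀), DifferentiableAt ℝ r x :=
    ((hr.of_le (m := 1) (by simp)).eventually (by simp)).mono
      fun x hx ↦ hx.differentiableAt (by simp)
  -- On vectors tangent to the immersion, the derivative of a left inverse `r` recovers the
  -- preimage, and it depends smoothly on the point.
  refine ⟨fun u ↦ fderiv ℝ r (f u) (V (f u)),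
    (hr'.comp u₀ hfu₀).clm_apply (hV.comp u₀ hfu₀), ?_⟩
  filter_upwards [hVf, hU.mem_nhds hu₀, hfu₀.continuousAt.eventually hrev, hru.eventually_nhds]
    with u ⟨ζ, hζ⟩ huU hdr hru'
  have hdf : DifferentiableAt ℝ f u :=
    (hf.contDiffAt (hU.mem_nhds huU)).differentiableAt (by simp)
  have hid : fderiv ℝ r (f u) (fderiv ℝ f u ζ) = ζ := by
    have h1 : HasFDerivAt (r ∘ f) ((fderiv ℝ r (f u)).comp (fderiv ℝ f u)) u :=
      hdr.hasFDerivAt.comp u hdf.hasFDerivAt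
    have h2 : HasFDerivAt (r ∘ f) (ContinuousLinearMap.id ℝ F) u :=
      (hasFDerivAt_id u).congr_of_eventuallyEq hru'
    exact DFunLike.congr_fun (h1.unique h2) ζ
  rw [← hζ, hid]

/-- The Lie bracket of two vector fields tangent to an immersion is tangent to it. -/
theorem lieBracket_mem_range {E F : Type*} [NormedAddCommGroup E] [NormedSpace ℝ E]
    [FiniteDimensional ℝ E] [NormedAddCommGroup F] [NormedSpace ℝ F] [FiniteDimensional ℝ F]
    {f : F → E} {U : Set F} (hU : IsOpen U) (hf : ContDiffOn ℝ ∞ f U) {u₀ : F} (hu₀ : u₀ ∈ U)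
    (hinj : Function.Injective (fderiv ℝ f u₀)) {V W : E → E} (hV : ContDiffAt ℝ ∞ V (f u₀))
    (hVf : ∀ᶠ u in 𝓝 u₀, ∃ ζ, fderiv ℝ f u ζ = V (f u)) (hW : ContDiffAt ℝ ∞ W (f u₀))
    (hWf : ∀ᶠ u in 𝓝 u₀, ∃ ζ, fderiv ℝ f u ζ = W (f u)) :
    ∃ ζ, fderiv ℝ f u₀ ζ = VectorField.lieBracket ℝ V W (f u₀) := by
  obtain ⟨a, ha, haV⟩ := exists_lift_of_mem_range hU hf hu₀ hinj hV hVf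
  obtain ⟨b, hb, hbW⟩ := exists_lift_of_mem_range hU hf hu₀ hinj hW hWf
  have hfu₀ : ContDiffAt ℝ ∞ f u₀ := hf.contDiffAt (hU.mem_nhds hu₀)
  have hsym := hfu₀.isSymmSndFDerivAt (by
    rw [minSmoothness_of_isRCLikeNormedField]
    exact WithTop.coe_le_coe.2 (le_top : (2 : ℕ∞) ≤ ⊤))
  have hdf : HasFDerivAt f (fderiv ℝ f u₀) u₀ := (hfu₀.differentiableAt (by simp)).hasFDerivAt
  have hdf' : HasFDerivAt (fderiv ℝ f) (fderiv ℝ (fderiv ℝ f) u₀) u₀ :=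
    ((hfu₀.fderiv_right (m := ∞) (by simp)).differentiableAt (by simp)).hasFDerivAt
  -- Obtained by differentiating `Z ∘ f = df(c)`. In the bracket the second derivative terms of `f`
  -- cancel by symmetry, which leaves the image under `df` of the bracket of the lifts.
  have key : ∀ {Z : E → E} {c : F → F}, ContDiffAt ℝ ∞ Z (f u₀) → ContDiffAt ℝ ∞ c u₀ →
      (∀ᶠ u in 𝓝 u₀, Z (f u) = fderiv ℝ f u (c u)) → ∀ ζ, fderiv ℝ Z (f u₀) (fderiv ℝ f u₀ ζ) =
        fderiv ℝ f u₀ (fderiv ℝ c u₀ ζ) + fderiv ℝ (fderiv ℝ f) u₀ ζ (c u₀) := by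
    intro Z c hZ hc hZc ζ
    have h1 := (hZ.differentiableAt (by simp)).hasFDerivAt.comp u₀ hdf
    have h2 := hdf'.clm_apply (hc.differentiableAt (by simp)).hasFDerivAt
    have h3 := h1.unique (h2.congr_of_eventuallyEq hZc)
    simpa using DFunLike.congr_fun h3 ζ
  refine ⟨fderiv ℝ b u₀ (a u₀) - fderiv ℝ a u₀ (b u₀), ?_⟩
  rw [VectorField.lieBracket, haV.self_of_nhds, hbW.self_of_nhds, key hW hb hbW, key hV ha haV,
    hsym (b u₀) (a u₀), map_sub]
  abel

variable {d : ℕ} {M : Type u} [TopologicalSpace M] [ChartedSpace (EuclideanSpace ℝ (Fin d)) M]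
  [IsManifold (𝓡 d) ∞ M]

local notation "𝔼" => EuclideanSpace ℝ (Fin d)

/-- The Lie bracket of vector fields is the Lie bracket of their expressions in a chart. -/
theorem mfderiv_extChartAt_mlieBracket (V W : (x : M) → TangentSpace (𝓡 d) x) (x₀ : M) :
    mfderiv (𝓡 d) 𝓘(ℝ, 𝔼) (extChartAt (𝓡 d) x₀) x₀ (VectorField.mlieBracket (𝓡 d) V W x₀) =
      VectorField.lieBracket ℝ (chartField x₀ V) (chartField x₀ W) (extChartAt (𝓡 d) x₀ x₀) := by
  have hev : ∀ Z : (x : M) → TangentSpace (𝓡 d) x,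
      (VectorField.mpullbackWithin 𝓘(ℝ, 𝔼) (𝓡 d) (extChartAt (𝓡 d) x₀).symm Z (range (𝓡 d)) :
        𝔼 → 𝔼) =ᶠ[𝓝 (extChartAt (𝓡 d) x₀ x₀)] chartField x₀ Z := by
    intro Z
    filter_upwards [extChartAt_target_mem_nhds (I := 𝓡 d) x₀] with e he
    have hinv := isInvertible_mfderivWithin_extChartAt_symm (I := 𝓡 d) he
    obtain ⟨A, hA⟩ := hinv
    change (mfderivWithin 𝓘(ℝ, 𝔼) (𝓡 d) (extChartAt (𝓡 d) x₀).symm (range (𝓡 d)) e).inverse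
      (Z ((extChartAt (𝓡 d) x₀).symm e)) = _
    rw [← hA, ContinuousLinearMap.inverse_equiv]
    refine (A.symm_apply_eq).2 ?_
    have h1 := mfderiv_symm_mfderiv_extChartAt x₀ he (Z ((extChartAt (𝓡 d) x₀).symm e))
    rw [← mfderivWithin_univ, ← ModelWithCorners.Boundaryless.range_eq_univ (I := 𝓡 d), ← hA] at h1
    exact h1.symm
  let pb (Z : (x : M) → TangentSpace (𝓡 d) x) : 𝔼 → 𝔼 :=
    VectorField.mpullbackWithin 𝓘(ℝ, 𝔼) (𝓡 d) (extChartAt (𝓡 d) x₀).symm Z (range (𝓡 d))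
  have hb : VectorField.lieBracketWithin ℝ (pb V) (pb W)
      ((extChartAt (𝓡 d) x₀).symm ⁻¹' univ ∩ range (𝓡 d)) (extChartAt (𝓡 d) x₀ x₀) =
      VectorField.lieBracket ℝ (chartField x₀ V) (chartField x₀ W) (extChartAt (𝓡 d) x₀ x₀) := by
    rw [preimage_univ, univ_inter, ModelWithCorners.Boundaryless.range_eq_univ,
      VectorField.lieBracketWithin_univ]
    exact (hev V).lieBracket_vectorField_eq (hev W)
  obtain ⟨A, hA⟩ := isInvertible_mfderiv_extChartAt (I := 𝓡 d) (mem_extChartAt_source (I := 𝓡 d) x₀)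
  rw [← VectorField.mlieBracketWithin_univ, VectorField.mlieBracketWithin_apply, ← hA,
    ContinuousLinearMap.inverse_equiv]
  exact (A.apply_symm_apply _).trans hb

/-- The Lie bracket of vector fields that belong to a distribution is tangent to its integral
manifolds. -/
theorem IsPlaque.mlieBracket_mem {F : Type*} [NormedAddCommGroup F] [NormedSpace ℝ F]
    [FiniteDimensional ℝ F] {Δ : Distribution d M} {U : Set F} {φ : F → M} (hφ : IsPlaque Δ U φ)
    {u₀ : F} (hu₀ : u₀ ∈ U) {X Y : LocalVectorField d M} (hX : X ∈ Δ.fields) (hY : Y ∈ Δ.fields)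
    (hXu : φ u₀ ∈ X.domain) (hYu : φ u₀ ∈ Y.domain) :
    VectorField.mlieBracket (𝓡 d) X.toFun Y.toFun (φ u₀) ∈ Δ (φ u₀) := by
  set x₀ := φ u₀ with hx₀
  have hsrc : φ u₀ ∈ (extChartAt (𝓡 d) x₀).source := mem_extChartAt_source x₀
  have hU' := isOpen_inter_preimage_source x₀ hφ.isOpen hφ.contMDiffOn
  have hφc : ContinuousAt φ u₀ :=
    hφ.contMDiffOn.continuousOn.continuousAt (hφ.isOpen.mem_nhds hu₀)
  have hdf : ∀ u ∈ U ∩ φ ⁻¹' (extChartAt (𝓡 d) x₀).source, ∀ ζ,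
      fderiv ℝ (fun u ↦ extChartAt (𝓡 d) x₀ (φ u)) u ζ =
        mfderiv (𝓡 d) 𝓘(ℝ, 𝔼) (extChartAt (𝓡 d) x₀) (φ u) (mfderiv 𝓘(ℝ, F) (𝓡 d) φ u ζ) := by
    intro u hu ζ
    rw [fderiv_chart_comp x₀ (hφ.mdifferentiableAt hu.1) hu.2]
    rfl
  have hsm : ∀ Z : LocalVectorField d M, x₀ ∈ Z.domain →
      ContDiffAt ℝ ∞ (chartField x₀ Z.toFun) (extChartAt (𝓡 d) x₀ x₀) := by
    intro Z hZ
    refine (Z.contDiffOn_chartField x₀).contDiffAt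
      ((isOpen_chart_preimage x₀ Z.domain.isOpen).mem_nhds ⟨mem_extChartAt_target x₀, ?_⟩)
    rw [mem_preimage, extChartAt_to_inv]
    exact hZ
  have htan : ∀ Z : LocalVectorField d M, Z ∈ Δ.fields → x₀ ∈ Z.domain → ∀ᶠ u in 𝓝 u₀,
      ∃ ζ, fderiv ℝ (fun u ↦ extChartAt (𝓡 d) x₀ (φ u)) u ζ =
        chartField x₀ Z.toFun (extChartAt (𝓡 d) x₀ (φ u)) := by
    intro Z hZΔ hZ
    filter_upwards [hU'.mem_nhds ⟨hu₀, hsrc⟩, hφc (Z.domain.isOpen.mem_nhds hZ)] with u hu huZ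
    have h1 := hZΔ (φ u) huZ
    rw [← hφ.range_eq u hu.1] at h1
    obtain ⟨ζ, hζ⟩ := h1
    refine ⟨ζ, (hdf u hu ζ).trans ?_⟩
    change _ = mfderiv (𝓡 d) 𝓘(ℝ, 𝔼) (extChartAt (𝓡 d) x₀)
      ((extChartAt (𝓡 d) x₀).symm (extChartAt (𝓡 d) x₀ (φ u)))
      (Z.toFun ((extChartAt (𝓡 d) x₀).symm (extChartAt (𝓡 d) x₀ (φ u))))
    rw [(extChartAt (𝓡 d) x₀).left_inv hu.2]
    exact congrArg _ hζ
  obtain ⟨ζ, hζ⟩ := lieBracket_mem_range hU' (contDiffOn_chart_comp x₀ hφ.contMDiffOn)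
    ⟨hu₀, hsrc⟩ (by
      rw [fderiv_chart_comp _ (hφ.mdifferentiableAt hu₀) hsrc]
      exact (injective_mfderiv_extChartAt x₀ hsrc).comp (hφ.injective u₀ hu₀))
    (hsm X hXu) (htan X hX hXu) (hsm Y hYu) (htan Y hY hYu)
  rw [← mfderiv_extChartAt_mlieBracket, hdf u₀ ⟨hu₀, hsrc⟩] at hζ
  rw [hx₀, ← hφ.range_eq u₀ hu₀]
  exact ⟨ζ, injective_mfderiv_extChartAt x₀ hsrc hζ⟩

theorem orbitDistribution_isInvolutive [T2Space M] {D : Set (LocalVectorField d M)}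
    (hD : EverywhereDefined D) : (orbitDistribution D).IsInvolutive := by
  intro X hX Y hY m hm
  obtain ⟨k, hk⟩ : ∃ k, Module.finrank ℝ (orbitDistribution D m) = k := ⟨_, rfl⟩
  obtain ⟨U, φ, hφ, h0, hφ0, -, -⟩ := exists_orbit_plaque (mem_orbit_self hD m) hk
  subst hφ0
  exact hφ.mlieBracket_mem h0 hX hY hm.1 hm.2

end Involutive

/-! ### Comparison of immersive and integral submanifolds -/

section Structures

variable {d : ℕ} {M : Type u} [TopologicalSpace M] [ChartedSpace (EuclideanSpace ℝ (Fin d)) M]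
  [IsManifold (𝓡 d) ∞ M] {R S : Set M} {Δ : Distribution d M}

namespace ImmersiveStructure

variable (N : ImmersiveStructure d S)

theorem contMDiff_incl' : ContMDiff (𝓡 N.dim) (𝓡 d) ∞ N.incl := N.contMDiff_incl

theorem injective_mfderiv_incl (x : N.Carrier) :
    Function.Injective (mfderiv (𝓡 N.dim) (𝓡 d) N.incl x) := N.injective_mfderiv x

theorem injective_incl : Function.Injective N.incl := fun _ _ h ↦ Subtype.ext h

theorem incl_mem (x : N.Carrier) : N.incl x ∈ S := x.2

theorem contMDiffOn_incl_extChartAt_symm (x : N.Carrier) :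
    ContMDiffOn 𝓘(ℝ, EuclideanSpace ℝ (Fin N.dim)) (𝓡 d) ∞
      (N.incl ∘ (extChartAt (𝓡 N.dim) x).symm) (extChartAt (𝓡 N.dim) x).target :=
  N.contMDiff_incl'.comp_contMDiffOn (contMDiffOn_extChartAt_symm x)

theorem mfderiv_incl_extChartAt_symm (x : N.Carrier) {u : EuclideanSpace ℝ (Fin N.dim)}
    (hu : u ∈ (extChartAt (𝓡 N.dim) x).target) :
    mfderiv 𝓘(ℝ, EuclideanSpace ℝ (Fin N.dim)) (𝓡 d) (N.incl ∘ (extChartAt (𝓡 N.dim) x).symm) u =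
      (mfderiv (𝓡 N.dim) (𝓡 d) N.incl ((extChartAt (𝓡 N.dim) x).symm u)).comp
        (mfderiv 𝓘(ℝ, EuclideanSpace ℝ (Fin N.dim)) (𝓡 N.dim)
          (extChartAt (𝓡 N.dim) x).symm u) :=
  mfderiv_comp u (N.contMDiff_incl'.mdifferentiableAt (by simp))
    (mdifferentiableAt_extChartAt_symm x hu)

theorem injective_mfderiv_incl_extChartAt_symm (x : N.Carrier)
    {u : EuclideanSpace ℝ (Fin N.dim)} (hu : u ∈ (extChartAt (𝓡 N.dim) x).target) :
    Function.Injective (mfderiv 𝓘(ℝ, EuclideanSpace ℝ (Fin N.dim)) (𝓡 d)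
      (N.incl ∘ (extChartAt (𝓡 N.dim) x).symm) u) := by
  rw [mfderiv_incl_extChartAt_symm N x hu]
  exact (N.injective_mfderiv_incl _).comp
    (Function.LeftInverse.injective (mfderiv_mfderiv_extChartAt_symm x hu))

variable {N}

/-- The charts of an integral manifold parametrize plaques. -/
theorem IsIntegral.isPlaque (hN : N.IsIntegral Δ) (x : N.Carrier) :
    IsPlaque Δ (extChartAt (𝓡 N.dim) x).target (N.incl ∘ (extChartAt (𝓡 N.dim) x).symm) := by
  refine ⟨isOpen_extChartAt_target x, N.contMDiffOn_incl_extChartAt_symm x,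
    fun u hu ↦ N.injective_mfderiv_incl_extChartAt_symm x hu, fun u hu ↦ ?_⟩
  rw [mfderiv_incl_extChartAt_symm N x hu]
  refine Eq.trans ?_ (hN ((extChartAt (𝓡 N.dim) x).symm u))
  refine LinearMap.range_comp_of_range_eq_top _ (LinearMap.range_eq_top.2 fun v ↦ ?_)
  exact ⟨_, mfderiv_symm_mfderiv_extChartAt x hu v⟩

theorem IsIntegral.finrank_eq (hN : N.IsIntegral Δ) (x : N.Carrier) :
    Module.finrank ℝ (Δ (N.incl x)) = N.dim := by
  rw [← hN x]
  exact (LinearMap.finrank_range_of_inj (N.injective_mfderiv_incl x)).trans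
    finrank_euclideanSpace_fin

theorem IsIntegral.ne_bot (hN : N.IsIntegral Δ) (x : N.Carrier) : Δ (N.incl x) ≠ ⊥ := by
  intro h
  have h1 := hN.finrank_eq x
  rw [h, finrank_bot] at h1
  have := N.one_le_dim
  omega

/-- A continuous map into an immersive submanifold is smooth if it is smooth as a map into the
ambient manifold. -/
theorem contMDiffAt_of_incl {k : ℕ} {P : Type*} [TopologicalSpace P]
    [ChartedSpace (EuclideanSpace ℝ (Fin k)) P] {f : P → N.Carrier}
    {p : P} (hf : ContinuousAt f p)
    (hfi : ContMDiffAt (𝓡 k) (𝓡 d) ∞ (fun q ↦ N.incl (f q)) p) :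
    ContMDiffAt (𝓡 k) (𝓡 N.dim) ∞ f p := by
  set ψ := extChartAt (𝓡 N.dim) (f p) with hψ
  have ht : ψ (f p) ∈ ψ.target := mem_extChartAt_target (f p)
  obtain ⟨r, hr, hru⟩ := exists_left_inverse_of_immersion (isOpen_extChartAt_target (f p))
    (N.contMDiffOn_incl_extChartAt_symm (f p)) ht
    (N.injective_mfderiv_incl_extChartAt_symm (f p) ht)
  have hback : ψ.symm (ψ (f p)) = f p := extChartAt_to_inv (f p)
  have hr' : ContMDiffAt (𝓡 d) 𝓘(ℝ, EuclideanSpace ℝ (Fin N.dim)) ∞ r (N.incl (f p)) := by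
    have := hr
    rw [← hψ, Function.comp_apply, hback] at this
    exact this
  refine contMDiffAt_iff_target.2 ⟨hf, ?_⟩
  -- In the chart around `f p` the map `f` is the left inverse `r` applied to `N.incl ∘ f`;
  -- continuity of `f` keeps nearby points inside this chart.
  refine (ContMDiffAt.comp p hr' hfi).congr_of_eventuallyEq ?_
  have hc : ContinuousAt (fun q ↦ ψ (f q)) p :=
    ContinuousAt.comp (f := f) (continuousAt_extChartAt (f p)) hf
  filter_upwards [hc.eventually hru, hf (extChartAt_source_mem_nhds (I := 𝓡 N.dim) (f p))]
    with q hq hqs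
  have h1 : ψ.symm (ψ (f q)) = f q := ψ.left_inv hqs
  have h2 : r (N.incl (ψ.symm (ψ (f q)))) = ψ (f q) := hq
  rw [h1] at h2
  exact h2.symm

variable {N' : ImmersiveStructure d R}

theorem contMDiff_inclusion_of_continuous {h : R ⊆ S} (hc : Continuous (N'.inclusion N h)) :
    ContMDiff (𝓡 N'.dim) (𝓡 N.dim) ∞ (N'.inclusion N h) := fun _ ↦
  contMDiffAt_of_incl hc.continuousAt N'.contMDiff_incl'.contMDiffAt

/-- Two structures with the same topology coincide. -/
theorem same_of_topology_eq {N N' : ImmersiveStructure d S} (h : N'.topology = N.topology) :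
    N'.Same N := by
  refine ⟨contMDiff_inclusion_of_continuous ?_, contMDiff_inclusion_of_continuous ?_⟩
  · change Continuous[N'.topology, N.topology] id
    rw [h]
    exact @continuous_id _ N.topology
  · change Continuous[N.topology, N'.topology] id
    rw [h]
    exact @continuous_id _ N.topology

/-- Near a common point, an integral manifold of a smooth distribution is mapped smoothly into
another one. -/
theorem IsIntegral.exists_local_map (hΔ : Δ.IsSmooth) (hN : N.IsIntegral Δ)
    (hN' : N'.IsIntegral Δ) {x : N.Carrier} {x' : N'.Carrier} (hx : N'.incl x' = N.incl x) :
    ∃ (h : N'.Carrier → N.Carrier) (W : Set N'.Carrier), IsOpen W ∧ x' ∈ W ∧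
      ContMDiffOn (𝓡 N'.dim) (𝓡 N.dim) ∞ h W ∧ ∀ y ∈ W, N.incl (h y) = N'.incl y := by
  have hback : (extChartAt (𝓡 N.dim) x).symm (extChartAt (𝓡 N.dim) x x) = x := extChartAt_to_inv x
  obtain ⟨h, W, hW, hxW, -, hsm, -, hh⟩ := (hN.isPlaque x).exists_factorization hΔ
    (mem_extChartAt_target x) (V := univ) isOpen_univ N'.contMDiff_incl'.contMDiffOn (mem_univ x')
    (by rw [Function.comp_apply, hback, hx]) (fun y _ ↦ (hN' y).le) (by
      intro y _
      rw [hN'.finrank_eq y, ← hN'.finrank_eq x', hx, hN.finrank_eq x, finrank_euclideanSpace_fin])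
  exact ⟨(extChartAt (𝓡 N.dim) x).symm ∘ h, W, hW, hxW,
    (contMDiffOn_extChartAt_symm x).comp hsm fun y hy ↦ (hh y hy).1, fun y hy ↦ (hh y hy).2.symm⟩

/-- No continuity is assumed: factorization gives a smooth local map over `M`, which must be the
inclusion because `N.incl` is injective. Openness and uniqueness of the topology both rest on this.
-/
theorem IsIntegral.contMDiff_inclusion (hΔ : Δ.IsSmooth) (hN : N.IsIntegral Δ)
    (hN' : N'.IsIntegral Δ) (hRS : R ⊆ S) :
    ContMDiff (𝓡 N'.dim) (𝓡 N.dim) ∞ (N'.inclusion N hRS) := by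
  intro x'
  obtain ⟨h, W, hW, hxW, hsm, hh⟩ := hN.exists_local_map hΔ hN' (x := N'.inclusion N hRS x')
    (x' := x') rfl
  refine (hsm.contMDiffAt (hW.mem_nhds hxW)).congr_of_eventuallyEq ?_
  filter_upwards [hW.mem_nhds hxW] with y hy
  exact N.injective_incl (hh y hy).symm

/-- An integral manifold contained in another one is an open submanifold. -/
theorem IsIntegral.isOpenSubmanifold (hΔ : Δ.IsSmooth) (hN : N.IsIntegral Δ)
    (hN' : N'.IsIntegral Δ) (hRS : R ⊆ S) : N'.IsOpenSubmanifold N := by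
  refine ⟨hRS, fun x' ↦ ?_⟩
  have hi := hN.contMDiff_inclusion hΔ hN' hRS
  -- Factorization with the roles exchanged provides a smooth local inverse of the inclusion.
  obtain ⟨h, W, hW, hxW, hsm, hh⟩ := hN'.exists_local_map hΔ hN (x := x')
    (x' := N'.inclusion N hRS x') rfl
  have hright : ∀ z ∈ W, N'.inclusion N hRS (h z) = z := fun z hz ↦
    N.injective_incl (hh z hz)
  refine ⟨{ toFun := N'.inclusion N hRS
            invFun := h
            source := N'.inclusion N hRS ⁻¹' W
            target := W
            map_source' := fun y hy ↦ hy
            map_target' := fun z hz ↦ ?_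
            left_inv' := fun y hy ↦ N'.injective_incl (hh _ hy)
            right_inv' := hright
            open_source := hW.preimage hi.continuous
            open_target := hW
            contMDiffOn_toFun := hi.contMDiffOn
            contMDiffOn_invFun := hsm }, hxW, fun _ _ ↦ rfl⟩
  rw [mem_preimage, hright z hz]
  exact hz

/-- There is at most one topology for which a set is an integral manifold of a smooth
distribution. -/
theorem IsIntegral.topology_eq {N N' : ImmersiveStructure d S} (hΔ : Δ.IsSmooth)
    (hN : N.IsIntegral Δ) (hN' : N'.IsIntegral Δ) : N.topology = N'.topology := by
  have h1 : Continuous[N.topology, N'.topology] id :=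
    (hN'.contMDiff_inclusion hΔ hN Subset.rfl).continuous
  have h2 : Continuous[N'.topology, N.topology] id :=
    (hN.contMDiff_inclusion hΔ hN' Subset.rfl).continuous
  exact le_antisymm (continuous_id_iff_le.1 h1) (continuous_id_iff_le.1 h2)

/-- By the chain rule, the smooth identity maps in the two directions give the two inclusions
between the tangent spaces. -/
theorem IsIntegral.of_same {N N' : ImmersiveStructure d S} (hN : N.IsIntegral Δ)
    (h : N'.Same N) : N'.IsIntegral Δ := by
  have hle : ∀ {N₁ N₂ : ImmersiveStructure d S},
      ContMDiff (𝓡 N₁.dim) (𝓡 N₂.dim) ∞ (N₁.inclusion N₂ Subset.rfl) → ∀ x : N₁.Carrier,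
      (mfderiv (𝓡 N₁.dim) (𝓡 d) N₁.incl x).range ≤
        (mfderiv (𝓡 N₂.dim) (𝓡 d) N₂.incl (N₁.inclusion N₂ Subset.rfl x)).range := by
    intro N₁ N₂ h x
    have h1 : mfderiv (𝓡 N₁.dim) (𝓡 d) N₁.incl x =
        (mfderiv (𝓡 N₂.dim) (𝓡 d) N₂.incl (N₁.inclusion N₂ Subset.rfl x)).comp
          (mfderiv (𝓡 N₁.dim) (𝓡 N₂.dim) (N₁.inclusion N₂ Subset.rfl) x) :=
      mfderiv_comp (M' := N₂.Carrier) (f := N₁.inclusion N₂ Subset.rfl) x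
        (N₂.contMDiff_incl'.mdifferentiableAt (by simp)) (h.mdifferentiableAt (by simp))
    rw [h1]
    exact LinearMap.range_comp_le_range _ _
  intro x
  exact (le_antisymm (hle h.1 x) (hle h.2 (N'.inclusion N Subset.rfl x))).trans
    (hN (N'.inclusion N Subset.rfl x))

end ImmersiveStructure

end Structures

/-! ### Trivial orbits, maximality and the converse -/

section Orbits

variable {d : ℕ} {M : Type u} [TopologicalSpace M] [ChartedSpace (EuclideanSpace ℝ (Fin d)) M]
  [IsManifold (𝓡 d) ∞ M] [T2Space M] {D : Set (LocalVectorField d M)} {m : M} {R S : Set M}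

/-- Zeros of a vector field are fixed by its flow. -/
theorem flow_eq_of_eq_zero {X : LocalVectorField d M} (hm : m ∈ X.domain) (h0 : X.toFun m = 0)
    (t : ℝ) : flow X t m = m := by
  have h : IsFlowCurve X t m (fun _ ↦ m) := by
    refine ⟨rfl, -(|t| + 1), |t| + 1, ⟨by linarith [abs_nonneg t], by linarith [abs_nonneg t]⟩,
      ⟨by linarith [neg_abs_le t], by linarith [le_abs_self t]⟩, ?_, fun _ _ ↦ hm⟩
    exact (isMIntegralCurve_const h0).isMIntegralCurveOn _
  exact h.flow_eq

theorem orbit_eq_singleton (hD : EverywhereDefined D)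
    (h0 : ∀ X ∈ D, m ∈ X.domain → X.toFun m = 0) : orbit D m = {m} := by
  refine Subset.antisymm ?_ (singleton_subset_iff.2 (mem_orbit_self hD m))
  refine orbit_induction (Q := fun x ↦ x ∈ ({m} : Set M)) rfl ?_
  rintro X hX t y rfl ht
  have hm := mem_domain_of_mem_flowDomain ht
  exact flow_eq_of_eq_zero hm (h0 X hX hm) t

/-- The point `m` is fixed by all flows of `D`, and by invertibility no other point is moved to it.
Hence the distribution that is `⊥` at `m` and `⊤` elsewhere is invariant and contains `Δ_D`. -/
theorem orbitDistribution_eq_bot (h0 : ∀ X ∈ D, m ∈ X.domain → X.toFun m = 0) :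
    orbitDistribution D m = ⊥ := by
  classical
  rw [eq_bot_iff]
  have hle : orbitDistribution D ≤ fun x ↦ if x = m then ⊥ else ⊤ := by
    refine orbitDistribution_le ?_ ?_
    · intro X hX x hx
      by_cases hxm : x = m
      · subst hxm
        simp [h0 X hX hx]
      · simp [hxm]
    · intro X hX t y ht v hv
      by_cases hy : y = m
      · subst hy
        rw [if_pos rfl, Submodule.mem_bot] at hv
        rw [hv, map_zero]
        exact Submodule.zero_mem _
      · have hne : flow X t y ≠ m := by
          intro h
          have h1 := flow_neg ht
          rw [h] at h1
          have hm := mem_domain_of_mem_flowDomain h1.1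
          exact hy (h1.2.symm.trans (flow_eq_of_eq_zero hm (h0 X hX hm) (-t)))
        rw [if_neg hne]
        trivial
  simpa using hle m

/-- The flow line of `X` through `m` stays in the orbit and is therefore constant, so its velocity
is zero. -/
theorem eq_zero_of_orbit_eq_singleton (hD : EverywhereDefined D) (h : orbit D m = {m})
    {X : LocalVectorField d M} (hX : X ∈ D) (hm : m ∈ X.domain) : X.toFun m = 0 := by
  obtain ⟨h0, h0'⟩ := flow_zero hm
  obtain ⟨a, b, h0m, -, -, hs⟩ := exists_flow_line h0
  have h1 := hasMFDerivAt_flow_time h0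
  have h2 : HasMFDerivAt 𝓘(ℝ, ℝ) (𝓡 d) (fun s ↦ flow X s m) (0 : ℝ)
      (0 : ℝ →L[ℝ] EuclideanSpace ℝ (Fin d)) := by
    refine (hasMFDerivAt_const m (0 : ℝ)).congr_of_eventuallyEq ?_
    filter_upwards [isOpen_Ioo.mem_nhds h0m] with s hs'
    have := flow_mem_orbit hX (mem_orbit_self hD m) (hs s hs').1
    rw [h] at this
    exact this
  have h3 := DFunLike.congr_fun (hasMFDerivAt_unique h1 h2) (1 : ℝ)
  rw [h0'] at h3
  exact (one_smul ℝ (X.toFun m)).symm.trans h3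

theorem orbitDistribution_eq_bot_iff (hD : EverywhereDefined D) :
    orbitDistribution D m = ⊥ ↔ orbit D m = {m} := by
  constructor
  · refine fun h ↦ orbit_eq_singleton hD fun X hX hm ↦ ?_
    have := mem_orbitDistribution hX hm
    rwa [h, Submodule.mem_bot] at this
  · exact fun h ↦ orbitDistribution_eq_bot fun X hX hm ↦ eq_zero_of_orbit_eq_singleton hD h hX hm

variable [ParacompactSpace M]

theorem exists_orbit_structure (hD : EverywhereDefined D) (h : S = orbit D m)
    (hm : orbitDistribution D m ≠ ⊥) :
    ∃ N : ImmersiveStructure d S, N.topology = orbitTopology D m S h ∧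
      N.IsIntegral (orbitDistribution D) ∧
      N.dim = Module.finrank ℝ (orbitDistribution D m) :=
  exists_immersiveStructure hD h (Submodule.one_le_finrank_iff.2 hm)

/-- A connected integral manifold of `P_D` which meets an orbit is contained in it. -/
theorem subset_orbit_of_isIntegral (hD : EverywhereDefined D) {N' : ImmersiveStructure d R}
    [ConnectedSpace N'.Carrier] (hN' : N'.IsIntegral (orbitDistribution D))
    (hR : (R ∩ orbit D m).Nonempty) : R ⊆ orbit D m := by
  have hΔ := orbitDistribution_isSmooth hD
  have hopen : ∀ x : N'.Carrier, ∀ᶠ y in 𝓝 x, N'.incl y ∈ orbit D (N'.incl x) := by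
    intro x
    obtain ⟨N, -, hN, -⟩ := exists_orbit_structure hD rfl (hN'.ne_bot x)
    obtain ⟨h, W, hW, hxW, -, hh⟩ := hN.exists_local_map hΔ hN'
      (x := Pts.mk (N'.incl x) (mem_orbit_self hD (N'.incl x))) (x' := x) rfl
    filter_upwards [hW.mem_nhds hxW] with y hy
    rw [← hh y hy]
    exact N.incl_mem _
  -- Orbits partition `M`, and by `hopen` each of them meets the integral manifold in an open set;
  -- so each such set is also closed.
  have hclopen : IsClopen {x : N'.Carrier | N'.incl x ∈ orbit D m} := by
    constructor
    · rw [← isOpen_compl_iff, isOpen_iff_mem_nhds]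
      intro x hx
      filter_upwards [hopen x] with y hy hym
      refine hx ?_
      have h1 := mem_orbit_self hD (N'.incl x)
      rwa [← orbit_eq hD hy, orbit_eq hD hym] at h1
    · rw [isOpen_iff_mem_nhds]
      intro x hx
      filter_upwards [hopen x] with y hy
      rwa [orbit_eq hD hx] at hy
  obtain ⟨x, hxR, hx⟩ := hR
  have huniv := hclopen.eq_univ ⟨(Pts.mk x hxR : N'.Carrier), hx⟩
  intro y hy
  exact (huniv ▸ mem_univ (Pts.mk y hy : N'.Carrier) :
    (Pts.mk y hy : N'.Carrier) ∈ {x : N'.Carrier | N'.incl x ∈ orbit D m})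

theorem isMaximalIntegral_of_topology_eq (hD : EverywhereDefined D) (h : S = orbit D m)
    (hm : orbitDistribution D m ≠ ⊥) {N : ImmersiveStructure d S}
    (hN : N.topology = orbitTopology D m S h) : N.IsMaximalIntegral (orbitDistribution D) := by
  obtain ⟨N₀, hN₀, hint, -⟩ := exists_orbit_structure hD h hm
  have hN' : N.IsIntegral (orbitDistribution D) :=
    hint.of_same (ImmersiveStructure.same_of_topology_eq (hN.trans hN₀.symm))
  refine ⟨?_, hN', fun R N' hc hi hRS ↦ ?_⟩
  · change @ConnectedSpace (Pts S) N.topology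
    rw [hN]
    exact connectedSpace_orbitTopology hD h
  · refine hN'.isOpenSubmanifold (orbitDistribution_isSmooth hD) hi ?_
    rw [h] at hRS ⊢
    exact subset_orbit_of_isIntegral hD hi hRS

/-- For the converse, maximality is tested against the orbit of one point of `S`, which gives `orbit
⊆ S`. The other inclusion holds for every connected integral manifold, and uniqueness of the
topology identifies it with the natural one. -/
theorem isMaximalIntegral_iff (hD : EverywhereDefined D) (N : ImmersiveStructure d S) :
    N.IsMaximalIntegral (orbitDistribution D) ↔
      ∃ (m : M) (h : S = orbit D m), S ≠ {m} ∧ N.topology = orbitTopology D m S h := by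
  constructor
  · rintro ⟨hc, hi, hmax⟩
    obtain ⟨x⟩ := hc.toNonempty
    have hx := hi.ne_bot x
    have hself := mem_orbit_self hD (N.incl x)
    obtain ⟨N₀, hN₀, hint, -⟩ := exists_orbit_structure hD rfl hx
    have hc₀ : ConnectedSpace N₀.Carrier := by
      change @ConnectedSpace (Pts _) N₀.topology
      rw [hN₀]
      exact connectedSpace_orbitTopology hD rfl
    obtain ⟨hsub, -⟩ := hmax _ N₀ hc₀ hint ⟨_, hself, N.incl_mem x⟩
    have hS : S = orbit D (N.incl x) :=
      Subset.antisymm (subset_orbit_of_isIntegral hD hi ⟨_, N.incl_mem x, hself⟩) hsub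
    refine ⟨N.incl x, hS, fun h ↦ hx ((orbitDistribution_eq_bot_iff hD).2 (hS ▸ h)), ?_⟩
    obtain ⟨N₁, hN₁, hint₁, -⟩ := exists_orbit_structure hD hS hx
    exact (hi.topology_eq (orbitDistribution_isSmooth hD) hint₁).trans hN₁
  · rintro ⟨m, h, hne, hN⟩
    refine isMaximalIntegral_of_topology_eq hD h (fun hbot ↦ hne ?_) hN
    rw [h, (orbitDistribution_eq_bot_iff hD).1 hbot]

/-- If `P_D` vanished at `m`, so would all fields belonging to it, and with them the smallest
distribution generated by these fields. So the hypothesis at `m` forces a non-trivial `D`-orbit. -/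
theorem hasMaximalIntegralManifolds (hD : EverywhereDefined D) :
    (orbitDistribution D).HasMaximalIntegralManifolds := by
  intro m hm
  have hm' : orbitDistribution D m ≠ ⊥ := by
    intro hbot
    refine hm (orbitDistribution_eq_bot fun X hX hmX ↦ ?_)
    have := hX m hmX
    rwa [hbot, Submodule.mem_bot] at this
  obtain ⟨N, hN, -, -⟩ := exists_orbit_structure hD rfl hm'
  exact ⟨orbit D m, N, mem_orbit_self hD m, isMaximalIntegral_of_topology_eq hD rfl hm' hN⟩

end Orbits

end Sussmann

end

theorem mainTheorem1 {d : ℕ} {M : Type*} [TopologicalSpace M]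
    [ChartedSpace (EuclideanSpace ℝ (Fin d)) M] [IsManifold (𝓡 d) ∞ M]
    [T2Space M] [ParacompactSpace M]
    (D : Set (Sussmann.LocalVectorField d M)) (hD : Sussmann.EverywhereDefined D) :
    -- (i) natural topology, existence and uniqueness of the smooth structure, dimension
    (∀ (m : M) (S : Set M) (h : S = Sussmann.orbit D m), S ≠ {m} →
      ∃ N : Sussmann.ImmersiveStructure d S, N.topology = Sussmann.orbitTopology D m S h ∧
        (∀ x ∈ S, N.dim = Module.finrank ℝ (Sussmann.orbitDistribution D x)) ∧
        ∀ N' : Sussmann.ImmersiveStructure d S, N'.topology = Sussmann.orbitTopology D m S h → N'.Same N) ∧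
    -- (ii) the non-trivial orbits are exactly the maximal integral manifolds
    (∀ (S : Set M) (N : Sussmann.ImmersiveStructure d S),
      N.IsMaximalIntegral (Sussmann.orbitDistribution D) ↔
        ∃ (m : M) (h : S = Sussmann.orbit D m), S ≠ {m} ∧ N.topology = Sussmann.orbitTopology D m S h) ∧
    -- (iii) the maximal integral manifold property
    ((Sussmann.orbitDistribution D).IsSmooth ∧ (Sussmann.orbitDistribution D).HasMaximalIntegralManifolds) ∧
    -- (iv) involutivity
    (Sussmann.orbitDistribution D).IsInvolutive := by
  refine ⟨fun m S h hne ↦ ?_, fun S N ↦ Sussmann.isMaximalIntegral_iff hD N,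
    ⟨Sussmann.orbitDistribution_isSmooth hD, Sussmann.hasMaximalIntegralManifolds hD⟩,
    Sussmann.orbitDistribution_isInvolutive hD⟩
  have hm : Sussmann.orbitDistribution D m ≠ ⊥ := fun hbot ↦
    hne (h.trans ((Sussmann.orbitDistribution_eq_bot_iff hD).1 hbot))
  obtain ⟨N, hN, -, hdim⟩ := Sussmann.exists_orbit_structure hD h hm
  refine ⟨N, hN, fun x hx ↦ ?_, fun N' hN' ↦
    Sussmann.ImmersiveStructure.same_of_topology_eq (hN'.trans hN.symm)⟩
  exact hdim.trans (Sussmann.finrank_orbitDistribution_of_mem_orbit (h ▸ hx)).symm
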